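/- **Setting.** Fix countably infinite sets of variables, of constants and of predicate names; there are no other function symbols. A CHR constraint is an atom $k=p(t_1,\dots,t_n)$ ($n\ge 0$) whose arguments are variables or constants; a built-in constraint is an equation $s=t$ between variables or constants, interpreted as equality on the set of constants. A single-headed CHR program $P$ (a CHR$_1(C)$ program) is a finite list of rules $h\Longleftrightarrow g\mid D$ (simplification) or $h\Longrightarrow g\mid D$ (propagation), with head $h$ one CHR constraint, guard $g$ a finite conjunction of equations and body $D$ a finite multiset of CHR and built-in constraints. A goal is a finite multiset of CHR and built-in constraints. **Semantics.** Configurations are $\langle G,S,B\rangle_n$, with $G$ a goal, $S$ a set of identified CHR constraints $k\#l$ ($l\in\mathbb N$), $B$ a conjunction of equations and $n\in\mathbb N$. The transitions are * (Solve) $\langle\{e\}\uplus G,S,B\rangle_n\to\langle G,S,e\wedge B\rangle_n$ for $e$ an equation; * (Introduce) $\langle\{k\}\uplus G,S,B\rangle_n\to\langle G,\{k\#n\}\cup S,B\rangle_{n+1}$ for $k$ a CHR constraint; * (Apply) if $h\odot g\mid D$, $\odot\in\{\Longleftrightarrow,\Longrightarrow\}$, is a rule of $P$ with its variables $\bar y$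 renamed so that none of them occurs in the configuration, if $k\#l\in S$ and $h$ have the same predicate name and arity, and if $\theta$ denotes the conjunction of the equations between corresponding arguments of $k$ and $h$, then, provided that every valuation satisfying $B$ can be changed on $\bar y$ only so as to satisfy $\theta\wedge g$, $\langle G,S,B\rangle_n\to\langle D\uplus G,S',\theta\wedge B\rangle_n$, where $S'=S$ for a propagation rule and $S'=S\setminus\{k\#l\}$ for a simplification rule. A computation for $G$ in $P$ is a sequence of transitions from $\langle G,\emptyset,true\rangle_1$. It is terminating if it ends in a final configuration, that is, one whose $B$ is unsatisfiable, or one whose goal is empty and to which no transition applies. **Forest.** The $i$-th repetition $k\#l^i$ of $k\#l$ in a computation $\delta$ is $k\#l$ after exactly $i$ applications of propagation rules to it. The forest $F_\delta$ has one root for every CHR constraint of the first configuration. A node is labelled by the $0$-th repetition $k\#l^0$ of the corresponding constraint $k$ of the goal (if $\delta$ never introduces it, the node is a leaf labelled by $k$ without an identifier). When a rule with body CHR constraints $k_1,\dots,k_m$ is applied to $k\#l^i$, the node $k\#l^i$ receives the following sons: for a propagation rule, $k\#l^{i+1}$ and one node for each $k_j$; for a simplification rule, one node for each $k_j$ if $m>0$,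 and a single leaf $\Box$ if $m=0$. (If a goal holds several equal constraints, which of them receives an identifier first is part of the choice of $F_\delta$.) An sc-computation is a path from a root to a leaf. Labels $h\#l^i$ and $k\#m^j$ are r-equal if $h=k\rho$ for a renaming (bijection of variables) $\rho$. An sc-computation is $p$-repetitive if $p$ is the largest number of pairwise r-equal (non-$\Box$) labels on it, and $F_\delta$ is $m$-repetitive if $m$ is the largest $p$ such that one of its sc-computations is $p$-repetitive ($m=0$ if $F_\delta$ is empty). **Theorem (decidability of termination).** Let $P$ be a single-headed program and $G$ a goal, let $u$ be the number of distinct constants used in $P$ and $G$, and let $w$ be the maximal arity of the CHR constraints occurring in $P$ and $G$ (with $w=0$ if there are none). Then $G$ has a terminating computation in $P$ if and only if there is a terminating computation $\delta$ for $G$ in $P$ such that $F_\delta$ is $m$-repetitive with $$m\;\le\; L=\sum_{i=0}^{w+2}2^{\,w(u+w)\,i},\qquad\text{that is, } L=\frac{2^{w(u+w)(w+3)}-1}{2^{w(u+w)}-1}\ \text{ if } w\ge 1,\quad L=3\ \text{ if } w=0.$$ Moreover, the existence of a terminating computation is decidable: the set of pairs $(P,G)$ such that $G$ has a terminating computation in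 $P$ is recursive. -/

import Mathlib

namespace CHR

/-! ## Syntax

The signature has countably many predicate symbols and countably many constants and no other
function symbol; the only built-in predicate is equality. -/

abbrev Var := ℕ

abbrev Const := ℕ

abbrev Pred := ℕ

inductive Term where
  | var (x : Var)
  | const (a : Const)

/-- A CHR (user-defined) constraint. The arity is the length of `args`, so a predicate symbol
is a name together with an arity. -/
structure Atom where
  pred : Pred
  args : List Term

/-- A built-in constraint `lhs = rhs`. -/
structure Eqn where
  lhs : Term
  rhs : Term

inductive Constraint where
  | builtin (e : Eqn)
  | chr (k : Atom)

/-- A single-headed rule: `head ==> guard | body` if `propagation` is `true`, and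
`head <=> guard | body` otherwise. The guard is the conjunction of its members, the body is read
as a multiset of constraints. -/
structure Rule where
  propagation : Bool
  head : Atom
  guard : List Eqn
  body : List Constraint

abbrev Program := List Rule

/-- A goal; the order of its members plays no role (see `Config.initial`). -/
abbrev Goal := List Constraint

/-! Variables, constants, arities, renamings. -/

def Term.vars : Term → List Var
  | .var x => [x]
  | .const _ => []

def Term.consts : Term → List Const
  | .var _ => []
  | .const a => [a]

def Atom.vars (k : Atom) : List Var := k.args.flatMap Term.vars

def Atom.consts (k : Atom) : List Const := k.args.flatMap Term.consts

def Eqn.vars (e : Eqn) : List Var := e.lhs.vars ++ e.rhs.vars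

def Eqn.consts (e : Eqn) : List Const := e.lhs.consts ++ e.rhs.consts

def Constraint.vars : Constraint → List Var
  | .builtin e => e.vars
  | .chr k => k.vars

def Constraint.consts : Constraint → List Const
  | .builtin e => e.consts
  | .chr k => k.consts

/-- The arity of a CHR constraint (built-in constraints do not count). -/
def Constraint.chrArity : Constraint → ℕ
  | .builtin _ => 0
  | .chr k => k.args.length

def Constraint.toAtom? : Constraint → Option Atom
  | .builtin _ => none
  | .chr k => some k

def Rule.vars (r : Rule) : List Var :=
  r.head.vars ++ r.guard.flatMap Eqn.vars ++ r.body.flatMap Constraint.vars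

def Rule.consts (r : Rule) : List Const :=
  r.head.consts ++ r.guard.flatMap Eqn.consts ++ r.body.flatMap Constraint.consts

/-- The arities of the CHR constraints that occur in a rule. -/
def Rule.arities (r : Rule) : List ℕ :=
  r.head.args.length :: r.body.map Constraint.chrArity

/-- The number of distinct constants used in `P` and in `G`. -/
def numConsts (P : Program) (G : Goal) : ℕ :=
  (P.flatMap Rule.consts ++ G.flatMap Constraint.consts).toFinset.card

/-- The maximal arity of the CHR constraints which occur in `P` and in `G`. -/
def maxArity (P : Program) (G : Goal) : ℕ :=
  (P.flatMap Rule.arities ++ G.map Constraint.chrArity).foldr max 0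

/-- A renaming of variables. -/
abbrev Renaming := Equiv.Perm Var

def Term.rename (ρ : Renaming) : Term → Term
  | .var x => .var (ρ x)
  | .const a => .const a

def Atom.rename (ρ : Renaming) (k : Atom) : Atom := ⟨k.pred, k.args.map (Term.rename ρ)⟩

def Eqn.rename (ρ : Renaming) (e : Eqn) : Eqn := ⟨e.lhs.rename ρ, e.rhs.rename ρ⟩

def Constraint.rename (ρ : Renaming) : Constraint → Constraint
  | .builtin e => .builtin (e.rename ρ)
  | .chr k => .chr (k.rename ρ)

def Rule.rename (ρ : Renaming) (r : Rule) : Rule :=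
  ⟨r.propagation, r.head.rename ρ, r.guard.map (Eqn.rename ρ), r.body.map (Constraint.rename ρ)⟩

/-! The evident codings of the syntax, for the decidability statement. -/

def Term.equiv : Term ≃ ℕ ⊕ ℕ where
  toFun
    | .var x => .inl x
    | .const a => .inr a
  invFun
    | .inl x => .var x
    | .inr a => .const a
  left_inv t := by cases t <;> rfl
  right_inv s := by cases s <;> rfl

instance : Primcodable Term := Primcodable.ofEquiv _ Term.equiv

def Atom.equiv : Atom ≃ ℕ × List Term where
  toFun k := (k.pred, k.args)
  invFun p := ⟨p.1, p.2⟩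
  left_inv _ := rfl
  right_inv _ := rfl

instance : Primcodable Atom := Primcodable.ofEquiv _ Atom.equiv

def Eqn.equiv : Eqn ≃ Term × Term where
  toFun e := (e.lhs, e.rhs)
  invFun p := ⟨p.1, p.2⟩
  left_inv _ := rfl
  right_inv _ := rfl

instance : Primcodable Eqn := Primcodable.ofEquiv _ Eqn.equiv

def Constraint.equiv : Constraint ≃ Eqn ⊕ Atom where
  toFun
    | .builtin e => .inl e
    | .chr k => .inr k
  invFun
    | .inl e => .builtin e
    | .inr k => .chr k
  left_inv c := by cases c <;> rfl
  right_inv s := by cases s <;> rfl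

instance : Primcodable Constraint := Primcodable.ofEquiv _ Constraint.equiv

def Rule.equiv : Rule ≃ Bool × Atom × List Eqn × List Constraint where
  toFun r := (r.propagation, r.head, r.guard, r.body)
  invFun p := ⟨p.1, p.2.1, p.2.2.1, p.2.2.2⟩
  left_inv _ := rfl
  right_inv _ := rfl

instance : Primcodable Rule := Primcodable.ofEquiv _ Rule.equiv

/-! ## Constraint theory: equality on the Herbrand universe, i.e. on the set of constants -/

def Term.eval (v : Var → Const) : Term → Const
  | .var x => v x
  | .const a => a

def Eqn.Holds (v : Var → Const) (e : Eqn) : Prop := e.lhs.eval v = e.rhs.eval v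

/-- The conjunction of `B` is true under `v`. -/
def AllHold (v : Var → Const) (B : List Eqn) : Prop := ∀ e ∈ B, e.Holds v

/-- The conjunction of `B` is equivalent to false. -/
def Inconsistent (B : List Eqn) : Prop := ¬ ∃ v, AllHold v B

/-- `B → ∃ X, C` is valid, where `X` is a set of variables. -/
def EntailsExists (B : List Eqn) (X : List Var) (C : List Eqn) : Prop :=
  ∀ v, AllHold v B → ∃ v', (∀ x, x ∉ X → v' x = v x) ∧ AllHold v' C

/-! ## The abstract operational semantics -/

/-- A configuration `⟨goal, store, builtins⟩_next`. A pair `(k, l)` in the CHR store is the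
identified constraint `k#l`; identifiers in a store are pairwise distinct in every computation, so
that the multiset `store` is a set. -/
structure Config where
  goal : Multiset Constraint
  store : Multiset (Atom × ℕ)
  builtins : List Eqn
  next : ℕ

def Config.initial (G : Goal) : Config := ⟨(G : Multiset Constraint), 0, [], 1⟩

/-- `x` occurs in the configuration. -/
def Config.HasVar (c : Config) (x : Var) : Prop :=
  (∃ k ∈ c.goal, x ∈ k.vars) ∨ (∃ k ∈ c.store, x ∈ k.1.vars) ∨ (∃ e ∈ c.builtins, x ∈ e.vars)

/-- The matching of the constraint `k` with the rule head `h`, as a conjunction of equations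
(to be used when the predicate symbols and the arities agree). -/
def matching (k h : Atom) : List Eqn := List.zipWith Eqn.mk k.args h.args

/-- What a transition does. `apply p k l ks` is the application to `k#l` of a rule that is a
propagation rule iff `p` is `true` and whose (renamed) body has the CHR constraints `ks`. -/
inductive Event where
  | solve
  | introduce (k : Atom) (l : ℕ)
  | apply (p : Bool) (k : Atom) (l : ℕ) (ks : List Atom)

/-- The transitions. In `apply`, the rule `r` is renamed apart by `ρ`; the rule fires if the
built-in store entails that `k` matches the head and that the guard holds, for some values of the
variables of the renamed rule; `k#l` stays in the store exactly when the rule is a propagation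
rule. -/
inductive Step (P : Program) : Config → Event → Config → Prop where
  | solve (e : Eqn) (G : Multiset Constraint) (S : Multiset (Atom × ℕ)) (B : List Eqn) (n : ℕ) :
      Step P ⟨.builtin e ::ₘ G, S, B, n⟩ .solve ⟨G, S, e :: B, n⟩
  | introduce (k : Atom) (G : Multiset Constraint) (S : Multiset (Atom × ℕ)) (B : List Eqn)
      (n : ℕ) :
      Step P ⟨.chr k ::ₘ G, S, B, n⟩ (.introduce k n) ⟨G, (k, n) ::ₘ S, B, n + 1⟩
  | apply (r : Rule) (ρ : Renaming) (k : Atom) (l : ℕ) (G : Multiset Constraint)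
      (S : Multiset (Atom × ℕ)) (B : List Eqn) (n : ℕ)
      (mem : r ∈ P)
      (apart : ∀ x ∈ (r.rename ρ).vars, ¬ Config.HasVar ⟨G, (k, l) ::ₘ S, B, n⟩ x)
      (pred_eq : k.pred = r.head.pred)
      (arity_eq : k.args.length = r.head.args.length)
      (entails : EntailsExists B (r.rename ρ).vars
        (matching k (r.rename ρ).head ++ (r.rename ρ).guard)) :
      Step P ⟨G, (k, l) ::ₘ S, B, n⟩
        (.apply r.propagation k l ((r.rename ρ).body.filterMap Constraint.toAtom?))
        ⟨((r.rename ρ).body : Multiset Constraint) + G,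
          if r.propagation then (k, l) ::ₘ S else S,
          matching k (r.rename ρ).head ++ B, n⟩

/-- A configuration is final if it is failed, or if its goal is empty and no rule is applicable. -/
def Config.Final (P : Program) (c : Config) : Prop :=
  Inconsistent c.builtins ∨ (c.goal = 0 ∧ ¬ ∃ a c', Step P c a c')

/-- The finite computations for `G` in `P` that end in a given configuration. -/
inductive Computation (P : Program) (G : Goal) : Config → Type where
  | start : Computation P G (Config.initial G)
  | step {c : Config} (δ : Computation P G c) (a : Event) (c' : Config) (h : Step P c a c') :
      Computation P G c'

/-- `G` has a terminating computation in `P`. -/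
def HasTerminatingComputation (P : Program) (G : Goal) : Prop :=
  ∃ (c : Config) (_ : Computation P G c), c.Final P

/-! ## The forest associated to a computation -/

/-- Labels of nodes: `rep k (some l) i` is the `i`-th repetition of `k#l`; `rep k none 0` is a CHR
constraint that is still in the goal and has no identifier yet; `box` is the box. -/
inductive Label where
  | rep (k : Atom) (id : Option ℕ) (i : ℕ)
  | box

inductive Tree where
  | node (lab : Label) (sons : List Tree)

abbrev Forest := List Tree

def Tree.leaf (a : Label) : Tree := .node a []

/-- `Replace t t' F F'`: the forest `F'` results from `F` by replacing one occurrence of the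
subtree `t` by `t'`. -/
inductive Replace (t t' : Tree) : Forest → Forest → Prop where
  | here (ts : Forest) : Replace t t' (t :: ts) (t' :: ts)
  | next (s : Tree) {ts ts' : Forest} : Replace t t' ts ts' → Replace t t' (s :: ts) (s :: ts')
  | sons (a : Label) (ts : Forest) {ss ss' : List Tree} : Replace t t' ss ss' →
      Replace t t' (.node a ss :: ts) (.node a ss' :: ts)

/-- The leaves for CHR constraints that have just appeared in a goal. -/
def newLeaves (ks : List Atom) : List Tree := ks.map fun k => .leaf (.rep k none 0)

/-- How one transition extends the forest. -/
inductive Grow : Event → Forest → Forest → Prop where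
  | solve (F : Forest) : Grow .solve F F
  | introduce (k : Atom) (l : ℕ) (F F' : Forest) :
      Replace (.leaf (.rep k none 0)) (.leaf (.rep k (some l) 0)) F F' →
      Grow (.introduce k l) F F'
  | propagate (k : Atom) (l i : ℕ) (ks : List Atom) (F F' : Forest) :
      Replace (.leaf (.rep k (some l) i))
        (.node (.rep k (some l) i) (.leaf (.rep k (some l) (i + 1)) :: newLeaves ks)) F F' →
      Grow (.apply true k l ks) F F'
  | simplify (k : Atom) (l i : ℕ) (ks : List Atom) (F F' : Forest) (hks : ks ≠ []) :
      Replace (.leaf (.rep k (some l) i)) (.node (.rep k (some l) i) (newLeaves ks)) F F' →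
      Grow (.apply false k l ks) F F'
  | erase (k : Atom) (l i : ℕ) (F F' : Forest) :
      Replace (.leaf (.rep k (some l) i)) (.node (.rep k (some l) i) [.leaf .box]) F F' →
      Grow (.apply false k l []) F F'

/-- `F` is the forest associated to `δ`. It is determined by `δ` up to the choice which of several
equal members of a goal receives an identifier first. -/
inductive IsForestOf {P : Program} {G : Goal} : {c : Config} → Computation P G c → Forest → Prop
    where
  | start : IsForestOf .start (newLeaves (G.filterMap Constraint.toAtom?))
  | step {c : Config} (δ : Computation P G c) (a : Event) (c' : Config) (h : Step P c a c')
      (F F' : Forest) : IsForestOf δ F → Grow a F F' → IsForestOf (.step δ a c' h) F'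

/-- `σ` is the sequence of labels on a path from the root of the tree to a leaf. -/
inductive Tree.IsPath : Tree → List Label → Prop where
  | leaf (a : Label) : Tree.IsPath (.node a []) [a]
  | son (a : Label) (ss : List Tree) (s : Tree) (σ : List Label) :
      s ∈ ss → Tree.IsPath s σ → Tree.IsPath (.node a ss) (a :: σ)

/-- `σ` is an sc-computation of the forest. -/
def Forest.IsScComputation (F : Forest) (σ : List Label) : Prop := ∃ t ∈ F, Tree.IsPath t σ

/-- r-equality of repetitions depends on their constraints only. -/
def REqual (h k : Atom) : Prop := ∃ ρ : Renaming, h = k.rename ρ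

/-- The repetitions in `σ` that are r-equal to repetitions of `h`. -/
def repsEqualTo (h : Atom) (σ : List Label) : Set Label :=
  {a | a ∈ σ ∧ ∃ k l j, a = .rep k l j ∧ REqual h k}

/-- The sc-computation `σ` is `p`-repetitive. -/
def ScRepetitive (σ : List Label) (p : ℕ) : Prop :=
  IsGreatest {q | ∃ h l i, Label.rep h l i ∈ σ ∧ q = (repsEqualTo h σ).ncard} p

/-- The forest is `m`-repetitive: `m` is the maximal repetitiveness of its sc-computations
(and `0` for the empty forest of a goal without CHR constraints). -/
def Forest.Repetitive (F : Forest) (m : ℕ) : Prop :=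
  IsLUB {p | ∃ σ, Forest.IsScComputation F σ ∧ ScRepetitive σ p} m

/-- The bound `L`, as a geometric sum; see `bound_eq` for the closed form. -/
def bound (u w : ℕ) : ℕ := ∑ i ∈ Finset.range (w + 3), (2 ^ (w * (u + w))) ^ i

theorem bound_eq (u w : ℕ) (hw : 0 < w) :
    (bound u w : ℚ) = (2 ^ (w * (u + w) * (w + 3)) - 1) / (2 ^ (w * (u + w)) - 1) := by
  have h : (2 : ℚ) ^ (w * (u + w)) ≠ 1 := by
    have hpos : w * (u + w) ≠ 0 := Nat.mul_ne_zero hw.ne' (by omega)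
    exact (one_lt_pow₀ (by norm_num) hpos).ne'
  unfold bound
  push_cast
  rw [geom_sum_eq h, ← pow_mul]

theorem bound_zero (u : ℕ) : bound u 0 = 3 := by simp [bound]

end CHR

/-!
The heart of the proof is that a shortest terminating computation cannot repeat itself along a path
of its forest.

*Eager derivations.* Whether a rule is applicable to a constraint `k` depends on the equations
between the arguments of `k` and constants that the built-in store entails (`pat`, `FiresPat`,
`fires_of_entails`, `entails_of_fires`), and it persists when the store grows. Hence equations may
be told to the store at once, and constraints may be introduced at once. `CanTerm P M t A B n` says
that from the constraints `A` and the equations `B` a terminal state is reached by at most `t`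
applications of rules in this eager semantics; a goal has a terminating computation with at most `t`
applications iff `CanTerm` holds for it (`Config.Final.canTerm`, `CanTerm.exists_final`).

*Grafting.* At a node `k` of the forest, the computation splits into an inner side, made of `k` and
its descendants, and an outer side. Since every rule is renamed apart and has a single head, the two
sides share nothing but the arguments of `k` and the constants; each side notices the other one only
through the entailed equations between these terms. The set of these equations grows with time, and
the history of the node lists its initial value and each growth, together with the side that has
caused it. If two nodes have r-equal constraints and the same history, then the outer side of the
one can be run together with the inner side of the other (`SplitRun.graft`, `NodeRun.canTerm`).
Along a path of the forest, the inner sides become strictly smaller; so, if the computation has the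
least possible number of applications, two nodes of a path with r-equal constraints have different
histories (`PathRuns.card_class_le`).

*Counting.* Let `u` be the number of constants and `w` the maximal arity. A satisfiable set of
equations is given by `w * (u + w)` bits, one of which, that of the equation of the first argument
with itself, is redundant and can be used for the side from which the next growth comes. With every
growth, a class of arguments without a constant disappears, or the store becomes contradictory,
which ends the computation. So a history is given by a list of at most `w + 1` such bit vectors,
and there are at most `bound u w` of them (`card_histories_le`; the case `w = 0`, where no bit is
redundant, is treated separately).

*Decidability.* The same count bounds the lengths of the paths in the forest of a shortest
terminating computation (`PathRuns.length_le`), and therefore the number of its applications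
(`IsForestOf.applies_le`) by a primitive recursive function of `P` and `G`. It remains to search all
eager derivations up to this length. Entailment by finitely many equations is decided by computing
representatives of terms (`replaceAll_solution_eq_iff`), and a rule is applicable iff its head and
guard entail no further equations between arguments of the constraint and constants (`active_iff`).
-/

namespace CHR

/-! ### Substitutions -/

/-- Simultaneous substitution of terms for variables. -/
def Term.sub (f : Var → Term) : Term → Term
  | .var x => f x
  | .const a => .const a

def Atom.sub (f : Var → Term) (k : Atom) : Atom := ⟨k.pred, k.args.map (Term.sub f)⟩

def Eqn.sub (f : Var → Term) (e : Eqn) : Eqn := ⟨e.lhs.sub f, e.rhs.sub f⟩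

def Constraint.sub (f : Var → Term) : Constraint → Constraint
  | .builtin e => .builtin (e.sub f)
  | .chr k => .chr (k.sub f)

@[simp] theorem Term.sub_const (f : Var → Term) (a : Const) : (Term.const a).sub f = .const a := rfl

@[simp] theorem Term.sub_var (f : Var → Term) (x : Var) : (Term.var x).sub f = f x := rfl

@[simp] theorem Atom.sub_pred (f : Var → Term) (k : Atom) : (k.sub f).pred = k.pred := rfl

@[simp] theorem Atom.sub_args (f : Var → Term) (k : Atom) :
    (k.sub f).args = k.args.map (Term.sub f) := rfl

theorem Term.sub_congr {f g : Var → Term} {t : Term} (h : ∀ x ∈ t.vars, f x = g x) :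
    t.sub f = t.sub g := by
  cases t with
  | var x => exact h x (by simp [Term.vars])
  | const a => rfl

theorem Atom.sub_congr {f g : Var → Term} {k : Atom} (h : ∀ x ∈ k.vars, f x = g x) :
    k.sub f = k.sub g := by
  unfold Atom.sub
  congr 1
  refine List.map_congr_left fun t ht => Term.sub_congr fun x hx => h x ?_
  exact List.mem_flatMap.2 ⟨t, ht, hx⟩

theorem Eqn.sub_congr {f g : Var → Term} {e : Eqn} (h : ∀ x ∈ e.vars, f x = g x) :
    e.sub f = e.sub g := by
  unfold Eqn.sub
  rw [Term.sub_congr fun x hx => h x (List.mem_append_left _ hx),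
    Term.sub_congr fun x hx => h x (List.mem_append_right _ hx)]

theorem Constraint.sub_congr {f g : Var → Term} {c : Constraint} (h : ∀ x ∈ c.vars, f x = g x) :
    c.sub f = c.sub g := by
  cases c with
  | builtin e => exact congrArg _ (Eqn.sub_congr h)
  | chr k => exact congrArg _ (Atom.sub_congr h)

theorem Term.rename_eq_sub (ρ : Renaming) (t : Term) : t.rename ρ = t.sub fun x => .var (ρ x) := by
  cases t <;> rfl

theorem Atom.rename_eq_sub (ρ : Renaming) (k : Atom) : k.rename ρ = k.sub fun x => .var (ρ x) := by
  have h : Term.rename ρ = Term.sub fun x => .var (ρ x) := funext (Term.rename_eq_sub ρ)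
  simp [Atom.sub, Atom.rename, h]

theorem Eqn.rename_eq_sub (ρ : Renaming) (e : Eqn) : e.rename ρ = e.sub fun x => .var (ρ x) := by
  simp [Eqn.sub, Eqn.rename, Term.rename_eq_sub]

theorem Constraint.rename_eq_sub (ρ : Renaming) (c : Constraint) :
    c.rename ρ = c.sub fun x => .var (ρ x) := by
  cases c <;> simp [Constraint.sub, Constraint.rename, Eqn.rename_eq_sub, Atom.rename_eq_sub]

theorem Term.mem_vars_sub {f : Var → Term} {t : Term} {x : Var} :
    x ∈ (t.sub f).vars ↔ ∃ y ∈ t.vars, x ∈ (f y).vars := by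
  cases t <;> simp [Term.vars]

theorem Atom.mem_vars_sub {f : Var → Term} {k : Atom} {x : Var} :
    x ∈ (k.sub f).vars ↔ ∃ y ∈ k.vars, x ∈ (f y).vars := by
  simp only [Atom.vars, Atom.sub_args, List.mem_flatMap, List.mem_map]
  constructor
  · rintro ⟨_, ⟨t, ht, rfl⟩, hx⟩
    obtain ⟨y, hy, hx⟩ := Term.mem_vars_sub.1 hx
    exact ⟨y, ⟨t, ht, hy⟩, hx⟩
  · rintro ⟨y, ⟨t, ht, hy⟩, hx⟩
    exact ⟨_, ⟨t, ht, rfl⟩, Term.mem_vars_sub.2 ⟨y, hy, hx⟩⟩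

theorem Eqn.mem_vars_sub {f : Var → Term} {e : Eqn} {x : Var} :
    x ∈ (e.sub f).vars ↔ ∃ y ∈ e.vars, x ∈ (f y).vars := by
  simp only [Eqn.vars, Eqn.sub, List.mem_append, Term.mem_vars_sub]
  constructor
  · rintro (⟨y, hy, hx⟩ | ⟨y, hy, hx⟩)
    exacts [⟨y, .inl hy, hx⟩, ⟨y, .inr hy, hx⟩]
  · rintro ⟨y, hy | hy, hx⟩
    exacts [.inl ⟨y, hy, hx⟩, .inr ⟨y, hy, hx⟩]

theorem Constraint.mem_vars_sub {f : Var → Term} {c : Constraint} {x : Var} :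
    x ∈ (c.sub f).vars ↔ ∃ y ∈ c.vars, x ∈ (f y).vars := by
  cases c
  · exact Eqn.mem_vars_sub
  · exact Atom.mem_vars_sub

theorem Term.consts_rename (ρ : Renaming) (t : Term) : (t.rename ρ).consts = t.consts := by
  cases t <;> rfl

theorem Atom.consts_rename (ρ : Renaming) (k : Atom) : (k.rename ρ).consts = k.consts := by
  simp [Atom.consts, Atom.rename, List.flatMap_map, Term.consts_rename]

theorem Eqn.consts_rename (ρ : Renaming) (e : Eqn) : (e.rename ρ).consts = e.consts := by
  simp [Eqn.consts, Eqn.rename, Term.consts_rename]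

theorem Term.eval_rename (ρ : Renaming) (v : Var → Const) (t : Term) :
    (t.rename ρ).eval v = t.eval fun x => v (ρ x) := by
  cases t <;> rfl

theorem Term.eval_congr {v v' : Var → Const} {t : Term} (h : ∀ x ∈ t.vars, v x = v' x) :
    t.eval v = t.eval v' := by
  cases t with
  | var x => exact h x (by simp [Term.vars])
  | const a => rfl

/-! ### Entailment of equations -/

/-- The equivalence relation on terms generated by the equations of `B`. -/
def Rel (B : Set Eqn) : Term → Term → Prop := Relation.EqvGen fun s t => Eqn.mk s t ∈ B

theorem Rel.refl {B : Set Eqn} (s : Term) : Rel B s s := Relation.EqvGen.refl s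

theorem Rel.symm {B : Set Eqn} {s t : Term} (h : Rel B s t) : Rel B t s := Relation.EqvGen.symm _ _ h

theorem Rel.trans {B : Set Eqn} {s t u : Term} (h : Rel B s t) (h' : Rel B t u) : Rel B s u :=
  Relation.EqvGen.trans _ _ _ h h'

theorem Rel.of_mem {B : Set Eqn} {e : Eqn} (h : e ∈ B) : Rel B e.lhs e.rhs :=
  Relation.EqvGen.rel _ _ h

theorem Rel.mono {B B' : Set Eqn} (h : B ⊆ B') {s t : Term} (hr : Rel B s t) : Rel B' s t :=
  Relation.EqvGen.mono (fun _ _ h' => h h') _ _ hr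

/-- To map `Rel B` into an equivalence relation, it is enough to map the equations of `B`. -/
theorem Rel.lift {B : Set Eqn} {Q : Term → Term → Prop} (hB : ∀ e ∈ B, Q e.lhs e.rhs)
    (hr : ∀ s, Q s s) (hs : ∀ s t, Q s t → Q t s) (ht : ∀ s t u, Q s t → Q t u → Q s u)
    {s t : Term} (h : Rel B s t) : Q s t := by
  induction h with
  | rel s t h => exact hB _ h
  | refl s => exact hr s
  | symm s t _ ih => exact hs _ _ ih
  | trans s t u _ _ ih ih' => exact ht _ _ _ ih ih'

theorem Rel.sub {B B' : Set Eqn} {f : Var → Term} (hB : ∀ e ∈ B, e.sub f ∈ B') {s t : Term}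
    (h : Rel B s t) : Rel B' (s.sub f) (t.sub f) :=
  h.lift (Q := fun s t => Rel B' (s.sub f) (t.sub f)) (fun e he => Rel.of_mem (hB e he))
    (fun _ => .refl _) (fun _ _ h => h.symm) fun _ _ _ h h' => h.trans h'

theorem Rel.eval {B : Set Eqn} {v : Var → Const} (hv : ∀ e ∈ B, e.Holds v) {s t : Term}
    (h : Rel B s t) : s.eval v = t.eval v :=
  h.lift (Q := fun s t => s.eval v = t.eval v) hv (fun _ => rfl) (fun _ _ h => h.symm)
    fun _ _ _ h h' => h.trans h'

theorem rel_empty {s t : Term} : Rel ∅ s t ↔ s = t :=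
  ⟨fun h => h.lift (fun _ h => h.elim) (fun _ => rfl) (fun _ _ h => h.symm)
    fun _ _ _ h h' => h.trans h', fun h => h ▸ Rel.refl _⟩

/-- A term that occurs in no equation of `B` is related to itself only. -/
theorem Rel.eq_or_mem {B : Set Eqn} {s t : Term} (h : Rel B s t) :
    s = t ∨ (∃ e ∈ B, s = e.lhs ∨ s = e.rhs) ∧ ∃ e ∈ B, t = e.lhs ∨ t = e.rhs :=
  h.lift (Q := fun s t => s = t ∨ (∃ e ∈ B, s = e.lhs ∨ s = e.rhs) ∧ ∃ e ∈ B, t = e.lhs ∨ t = e.rhs)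
    (fun e he => .inr ⟨⟨e, he, .inl rfl⟩, ⟨e, he, .inr rfl⟩⟩) (fun _ => .inl rfl)
    (fun s t h => h.elim (fun h => .inl h.symm) fun h => .inr h.symm) (by
      rintro s t u (rfl | h) (rfl | h')
      · exact .inl rfl
      · exact .inr h'
      · exact .inr h
      · exact .inr ⟨h.1, h'.2⟩)

/-- A chain of equations from `B ∪ S` splits at its first and its last member from `S`. Between
these two, any equivalence relation `Q` that contains `S`, and contains `Rel B` on the terms
of `S`, is preserved. -/
theorem Rel.union_cases {B S : Set Eqn} {D : Term → Prop} {Q : Term → Term → Prop}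
    (hS : ∀ e ∈ S, D e.lhs ∧ D e.rhs) (hQB : ∀ u u', D u → D u' → Rel B u u' → Q u u')
    (hQS : ∀ e ∈ S, Q e.lhs e.rhs) (hs : ∀ s t, Q s t → Q t s)
    (ht : ∀ s t u, Q s t → Q t u → Q s u) {s t : Term} (h : Rel (S ∪ B) s t) :
    Rel B s t ∨ ∃ u u', D u ∧ D u' ∧ Rel B s u ∧ Q u u' ∧ Rel B u' t := by
  refine h.lift (Q := fun s t => Rel B s t ∨ ∃ u u', D u ∧ D u' ∧ Rel B s u ∧ Q u u' ∧ Rel B u' t)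
    ?_ (fun s => .inl (.refl s)) ?_ ?_
  · rintro e (he | he)
    · exact .inr ⟨_, _, (hS e he).1, (hS e he).2, .refl _, hQS e he, .refl _⟩
    · exact .inl (.of_mem he)
  · rintro s t (h | ⟨u, u', hu, hu', h, hq, h'⟩)
    · exact .inl h.symm
    · exact .inr ⟨u', u, hu', hu, h'.symm, hs _ _ hq, h.symm⟩
  · rintro s t x (h | ⟨u, u', hu, hu', h, hq, h'⟩) (g | ⟨w, w', hw, hw', g, gq, g'⟩)
    · exact .inl (h.trans g)
    · exact .inr ⟨w, w', hw, hw', h.trans g, gq, g'⟩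
    · exact .inr ⟨u, u', hu, hu', h, hq, h'.trans g⟩
    · exact .inr ⟨u, w', hu, hw', h, ht _ _ _ hq
        (ht _ _ _ (hQB _ _ hu' hw (h'.trans g)) gq), g'⟩

theorem Rel.of_union {B S : Set Eqn} {D : Term → Prop} {Q : Term → Term → Prop}
    (hS : ∀ e ∈ S, D e.lhs ∧ D e.rhs) (hQB : ∀ u u', D u → D u' → Rel B u u' → Q u u')
    (hQS : ∀ e ∈ S, Q e.lhs e.rhs) (hs : ∀ s t, Q s t → Q t s)
    (ht : ∀ s t u, Q s t → Q t u → Q s u) {s t : Term} (hDs : D s) (hDt : D t)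
    (h : Rel (S ∪ B) s t) : Q s t := by
  obtain h | ⟨u, u', hu, hu', h, hq, h'⟩ := Rel.union_cases hS hQB hQS hs ht h
  · exact hQB _ _ hDs hDt h
  · exact ht _ _ _ (hQB _ _ hDs hu h) (ht _ _ _ hq (hQB _ _ hu' hDt h'))

/-- The equations of `B` identify two distinct constants. -/
def Bad (B : Set Eqn) : Prop := ∃ c d, c ≠ d ∧ Rel B (.const c) (.const d)

theorem Bad.mono {B B' : Set Eqn} (h : B ⊆ B') (hb : Bad B) : Bad B' := by
  obtain ⟨c, d, hcd, hr⟩ := hb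
  exact ⟨c, d, hcd, hr.mono h⟩

/-- `B` entails `s = t`: either the equations of `B` link `s` to `t`, or `B` is contradictory. -/
def Ent (B : Set Eqn) (s t : Term) : Prop := Rel B s t ∨ Bad B

theorem Ent.refl {B : Set Eqn} (s : Term) : Ent B s s := .inl (.refl s)

theorem Ent.symm {B : Set Eqn} {s t : Term} (h : Ent B s t) : Ent B t s := h.imp Rel.symm id

theorem Ent.trans {B : Set Eqn} {s t u : Term} (h : Ent B s t) (h' : Ent B t u) : Ent B s u := by
  obtain h | h := h
  · obtain h' | h' := h'
    · exact .inl (h.trans h')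
    · exact .inr h'
  · exact .inr h

theorem Ent.mono {B B' : Set Eqn} (h : B ⊆ B') {s t : Term} (hr : Ent B s t) : Ent B' s t :=
  hr.imp (Rel.mono h) (Bad.mono h)

theorem Ent.of_mem {B : Set Eqn} {e : Eqn} (h : e ∈ B) : Ent B e.lhs e.rhs := .inl (.of_mem h)

theorem bad_of_ent {B : Set Eqn} {c d : Const} (hcd : c ≠ d) (h : Ent B (.const c) (.const d)) :
    Bad B :=
  h.elim (fun h => ⟨c, d, hcd, h⟩) id

theorem bad_iff_ent {B : Set Eqn} : Bad B ↔ Ent B (.const 0) (.const 1) :=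
  ⟨.inr, bad_of_ent (by decide)⟩

theorem Ent.rel {B : Set Eqn} (hB : ¬ Bad B) {s t : Term} (h : Ent B s t) : Rel B s t :=
  h.resolve_right hB

/-- `Rel.of_union` for entailment, transported along a substitution. -/
theorem Ent.of_union {B S N : Set Eqn} {D : Term → Prop} {f : Var → Term}
    (hD : ∀ c, D (.const c)) (hS : ∀ e ∈ S, D e.lhs ∧ D e.rhs)
    (hB : ∀ u u', D u → D u' → Ent B u u' → Ent N (u.sub f) (u'.sub f))
    (hSN : ∀ e ∈ S, e.sub f ∈ N) {s t : Term} (hDs : D s) (hDt : D t) (h : Ent (S ∪ B) s t) :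
    Ent N (s.sub f) (t.sub f) := by
  have key : ∀ {s t : Term}, D s → D t → Rel (S ∪ B) s t → Ent N (s.sub f) (t.sub f) :=
    fun hs ht h => Rel.of_union (Q := fun s t => Ent N (s.sub f) (t.sub f)) hS
      (fun u u' hu hu' h => hB u u' hu hu' (.inl h)) (fun e he => Ent.of_mem (hSN e he))
      (fun _ _ h => h.symm) (fun _ _ _ h h' => h.trans h') hs ht h
  obtain h | ⟨c, d, hcd, h⟩ := h
  · exact key hDs hDt h
  · exact .inr (bad_of_ent hcd (key (hD c) (hD d) h))

/-! ### Patterns of entailed equations -/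

/-- A position in a list of terms, or a constant. -/
abbrev Port := ℕ ⊕ Const

/-- The term designated by a port of the list `q`. -/
def tm (q : List Term) : Port → Option Term
  | .inl i => q[i]?
  | .inr c => some (.const c)

/-- The equations between members of `q` and constants that are entailed by `B`. -/
def pat (q : List Term) (B : Set Eqn) : Set (Port × Port) :=
  {p | ∃ s t, tm q p.1 = some s ∧ tm q p.2 = some t ∧ Ent B s t}

theorem mem_pat {q : List Term} {B : Set Eqn} {x y : Port} :
    (x, y) ∈ pat q B ↔ ∃ s t, tm q x = some s ∧ tm q y = some t ∧ Ent B s t := Iff.rfl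

theorem pat_iff {q : List Term} {B : Set Eqn} {x y : Port} {s t : Term} (hs : tm q x = some s)
    (ht : tm q y = some t) : (x, y) ∈ pat q B ↔ Ent B s t := by
  rw [mem_pat]
  constructor
  · rintro ⟨s', t', hs', ht', h⟩
    rw [hs] at hs'; rw [ht] at ht'
    cases hs'; cases ht'
    exact h
  · exact fun h => ⟨s, t, hs, ht, h⟩

theorem pat_mono {q : List Term} {B B' : Set Eqn} (h : B ⊆ B') : pat q B ⊆ pat q B' := by
  rintro _ ⟨s, t, hs, ht, he⟩
  exact ⟨s, t, hs, ht, he.mono h⟩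

theorem bad_iff_pat {q : List Term} {B : Set Eqn} : Bad B ↔ (.inr 0, .inr 1) ∈ pat q B := by
  rw [pat_iff (s := .const 0) (t := .const 1) rfl rfl, bad_iff_ent]

theorem tm_map {q : List Term} {f : Var → Term} {x : Port} :
    tm (q.map (Term.sub f)) x = (tm q x).map (Term.sub f) := by
  cases x <;> simp [tm]

/-- The members of `q` can be given the values `vals`, as far as the pattern `E` is concerned. -/
def Respects (vals : ℕ → Const) (E : Set (Port × Port)) : Prop :=
  ∀ x y, (x, y) ∈ E → Sum.elim vals id x = Sum.elim vals id y

/-- Values for the members of `q` that satisfy all equations between these members and constants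
that `B` entails extend to a solution of `B`. -/
theorem exists_valuation {B : Set Eqn} {q : List Term} {vals : ℕ → Const}
    (h : Respects vals (pat q B)) :
    ∃ v : Var → Const, (∀ e ∈ B, e.Holds v) ∧
      ∀ i s, q[i]? = some s → s.eval v = vals i := by
  classical
  -- The value of a term is read off the class of the term, so that it is constant on classes.
  let val (s : Term) (a : Const) : Prop :=
    ∃ x t, tm q x = some t ∧ Rel B s t ∧ Sum.elim vals id x = a
  have huniq : ∀ {s a b}, val s a → val s b → a = b := by
    rintro s a b ⟨x, t, hx, hst, rfl⟩ ⟨y, u, hy, hsu, rfl⟩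
    exact h x y ((pat_iff hx hy).2 (.inl (hst.symm.trans hsu)))
  have hcongr : ∀ {s t}, Rel B s t → val s = val t := fun {s t} hst => by
    funext a
    refine propext ⟨?_, ?_⟩
    · rintro ⟨x, u, hx, hu, rfl⟩
      exact ⟨x, u, hx, hst.symm.trans hu, rfl⟩
    · rintro ⟨x, u, hx, hu, rfl⟩
      exact ⟨x, u, hx, hst.trans hu, rfl⟩
  let value (s : Term) : Const := if hs : ∃ a, val s a then hs.choose else 0
  have hvalue : ∀ {s a}, val s a → value s = a := fun {s a} hs => by
    have hs' : ∃ a, val s a := ⟨a, hs⟩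
    simp only [value, dif_pos hs']
    exact huniq hs'.choose_spec hs
  have heval : ∀ s : Term, s.eval (fun x => value (.var x)) = value s := by
    intro s
    cases s with
    | var x => rfl
    | const c => exact (hvalue ⟨.inr c, .const c, rfl, .refl _, rfl⟩).symm
  refine ⟨fun x => value (.var x), fun e he => ?_, fun i s hi => ?_⟩
  · unfold Eqn.Holds
    rw [heval, heval]
    have := hcongr (Rel.of_mem he)
    simp only [value, this]
  · rw [heval]
    exact hvalue ⟨.inl i, s, hi, .refl s, rfl⟩

theorem respects_of_holds {B : Set Eqn} (hB : ¬ Bad B) {q : List Term} {v : Var → Const}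
    (hv : ∀ e ∈ B, e.Holds v) {vals : ℕ → Const}
    (hq : ∀ i s, q[i]? = some s → s.eval v = vals i) : Respects vals (pat q B) := by
  have hval : ∀ x s, tm q x = some s → Sum.elim vals id x = s.eval v := by
    rintro (i | c) s hs
    · exact (hq i s hs).symm
    · simp only [tm, Option.some.injEq] at hs
      subst hs
      rfl
  rintro x y ⟨s, t, hs, ht, h⟩
  rw [hval x s hs, hval y t ht]
  exact (h.rel hB).eval hv

theorem inconsistent_iff {B : List Eqn} : Inconsistent B ↔ Bad {e | e ∈ B} := by
  constructor
  · intro h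
    by_contra hb
    obtain ⟨v, hv, -⟩ := exists_valuation (B := {e | e ∈ B}) (q := [])
      (vals := fun _ => 0) (by
      rintro x y ⟨s, t, hs, ht, h⟩
      cases x with
      | inl i => simp [tm] at hs
      | inr c =>
        cases y with
        | inl i => simp [tm] at ht
        | inr d =>
          simp only [tm, Option.some.injEq] at hs ht
          subst hs; subst ht
          by_contra hcd
          exact hb ⟨c, d, hcd, h.rel hb⟩)
    exact h ⟨v, hv⟩
  · rintro ⟨c, d, hcd, h⟩ ⟨v, hv⟩
    exact hcd (h.eval (v := v) hv)

/-! ### Applicability of a rule -/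

/-- The head of the rule matches any arguments that satisfy the pattern `E`, in such a way that the
guard holds. -/
def FiresPat (r : Rule) (E : Set (Port × Port)) : Prop :=
  ∀ vals : ℕ → Const, Respects vals E →
    ∃ y : Var → Const, (∀ i t, r.head.args[i]? = some t → t.eval y = vals i) ∧ AllHold y r.guard

/-- The rule `r` is applicable to `k` under the equations `B`. -/
def Fires (r : Rule) (k : Atom) (B : Set Eqn) : Prop :=
  k.pred = r.head.pred ∧ k.args.length = r.head.args.length ∧ FiresPat r (pat k.args B)

theorem FiresPat.mono {r : Rule} {E E' : Set (Port × Port)} (h : E ⊆ E') (hf : FiresPat r E) :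
    FiresPat r E' :=
  fun vals hv => hf vals fun x y hxy => hv x y (h hxy)

theorem Fires.transfer {r : Rule} {k k' : Atom} {B B' : Set Eqn} (hf : Fires r k B)
    (hp : k'.pred = k.pred) (hl : k'.args.length = k.args.length)
    (h : pat k.args B ⊆ pat k'.args B') : Fires r k' B' :=
  ⟨hp.trans hf.1, hl.trans hf.2.1, hf.2.2.mono h⟩

theorem mem_matching {k h : Atom} {e : Eqn} :
    e ∈ matching k h ↔ ∃ i : ℕ, k.args[i]? = some e.lhs ∧ h.args[i]? = some e.rhs := by
  unfold matching
  rw [List.mem_iff_getElem?]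
  refine exists_congr fun i => ?_
  rw [List.getElem?_zipWith_eq_some]
  constructor
  · rintro ⟨x, y, hx, hy, rfl⟩
    exact ⟨hx, hy⟩
  · rintro ⟨hx, hy⟩
    exact ⟨_, _, hx, hy, rfl⟩

theorem Rule.mem_vars {r : Rule} {x : Var} : x ∈ r.vars ↔
    x ∈ r.head.vars ∨ (∃ e ∈ r.guard, x ∈ e.vars) ∨ ∃ c ∈ r.body, x ∈ c.vars := by
  simp [Rule.vars]

theorem Rule.mem_vars_rename {r : Rule} {ρ : Renaming} {x : Var} :
    x ∈ (r.rename ρ).vars ↔ ∃ y ∈ r.vars, ρ y = x := by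
  simp only [Rule.mem_vars, Rule.rename, List.mem_map, Atom.rename_eq_sub, Eqn.rename_eq_sub,
    Constraint.rename_eq_sub, Atom.mem_vars_sub]
  constructor
  · rintro (⟨y, hy, hx⟩ | ⟨_, ⟨e, he, rfl⟩, hx⟩ | ⟨_, ⟨e, he, rfl⟩, hx⟩)
    · exact ⟨y, .inl hy, by simpa [Term.vars, eq_comm] using hx⟩
    · obtain ⟨y, hy, hx⟩ := Eqn.mem_vars_sub.1 hx
      exact ⟨y, .inr (.inl ⟨e, he, hy⟩), by simpa [Term.vars, eq_comm] using hx⟩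
    · obtain ⟨y, hy, hx⟩ := Constraint.mem_vars_sub.1 hx
      exact ⟨y, .inr (.inr ⟨e, he, hy⟩), by simpa [Term.vars, eq_comm] using hx⟩
  · rintro ⟨y, hy | ⟨e, he, hy⟩ | ⟨e, he, hy⟩, rfl⟩
    · exact .inl ⟨y, hy, by simp [Term.vars]⟩
    · exact .inr (.inl ⟨_, ⟨e, he, rfl⟩, Eqn.mem_vars_sub.2 ⟨y, hy, by simp [Term.vars]⟩⟩)
    · exact .inr (.inr ⟨_, ⟨e, he, rfl⟩, Constraint.mem_vars_sub.2 ⟨y, hy, by simp [Term.vars]⟩⟩)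

theorem Atom.mem_vars {k : Atom} {x : Var} :
    x ∈ k.vars ↔ ∃ (i : ℕ) (t : Term), k.args[i]? = some t ∧ x ∈ t.vars := by
  simp only [Atom.vars, List.mem_flatMap]
  constructor
  · rintro ⟨t, ht, hx⟩
    obtain ⟨i, hi⟩ := List.mem_iff_getElem?.1 ht
    exact ⟨i, t, hi, hx⟩
  · rintro ⟨i, t, hi, hx⟩
    exact ⟨t, List.mem_iff_getElem?.2 ⟨i, hi⟩, hx⟩

theorem Eqn.holds_rename (ρ : Renaming) (v : Var → Const) (e : Eqn) :
    (e.rename ρ).Holds v ↔ e.Holds fun x => v (ρ x) := by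
  simp [Eqn.Holds, Eqn.rename, Term.eval_rename]

/-- The applicability condition of the operational semantics implies `Fires`. -/
theorem fires_of_entails {r : Rule} {ρ : Renaming} {k : Atom} {B : List Eqn} {B' : Set Eqn}
    (hsub : {e | e ∈ B} ⊆ B') (hp : k.pred = r.head.pred)
    (hl : k.args.length = r.head.args.length)
    (hfresh : ∀ x ∈ (r.rename ρ).vars, x ∉ k.vars)
    (h : EntailsExists B (r.rename ρ).vars (matching k (r.rename ρ).head ++ (r.rename ρ).guard)) :
    Fires r k B' := by
  refine ⟨hp, hl, fun vals hv => ?_⟩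
  obtain ⟨v, hv, hq⟩ := exists_valuation hv
  obtain ⟨v', hv', hall⟩ := h v fun e he => hv e (hsub he)
  refine ⟨fun x => v' (ρ x), fun i t hi => ?_, fun e he => ?_⟩
  · have hlt : i < k.args.length := by
      rw [hl]
      exact (List.getElem?_eq_some_iff.1 hi).1
    have hs : k.args[i]? = some k.args[i] := List.getElem?_eq_getElem hlt
    have hm := hall ⟨k.args[i], t.rename ρ⟩ (List.mem_append_left _ (mem_matching.2 ⟨i, hs, by
      simp [Rule.rename, Atom.rename, hi]⟩))
    rw [← Term.eval_rename, ← hq i _ hs, ← (show _ = _ from hm)]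
    refine Term.eval_congr fun x hx => hv' x fun hx' => hfresh x hx' ?_
    exact Atom.mem_vars.2 ⟨i, _, hs, hx⟩
  · rw [← Eqn.holds_rename]
    exact hall _ (List.mem_append_right _ (List.mem_map_of_mem he))

theorem entails_of_fires {r : Rule} {ρ : Renaming} {k : Atom} {B : List Eqn}
    (hB : ¬ Bad {e | e ∈ B}) (hfresh : ∀ x ∈ (r.rename ρ).vars, x ∉ k.vars)
    (h : Fires r k {e | e ∈ B}) :
    EntailsExists B (r.rename ρ).vars
      (matching k (r.rename ρ).head ++ (r.rename ρ).guard) := by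
  classical
  intro v hv
  obtain ⟨y, hy, hg⟩ := h.2.2 (fun i => (k.args[i]?.getD (.const 0)).eval v)
    (respects_of_holds hB hv fun i s hi => by simp [hi])
  have hagree : ∀ x ∈ r.vars,
      (if ρ x ∈ (r.rename ρ).vars then y (ρ.symm (ρ x)) else v (ρ x)) = y x := fun x hx => by
    rw [if_pos (Rule.mem_vars_rename.2 ⟨x, hx, rfl⟩), Equiv.symm_apply_apply]
  refine ⟨fun x => if x ∈ (r.rename ρ).vars then y (ρ.symm x) else v x, fun x hx => if_neg hx, ?_⟩
  intro e he
  obtain he | he := List.mem_append.1 he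
  · obtain ⟨i, hk, hh⟩ := mem_matching.1 he
    simp only [Rule.rename, Atom.rename, List.getElem?_map, Option.map_eq_some_iff] at hh
    obtain ⟨t, ht, hte⟩ := hh
    unfold Eqn.Holds
    rw [← hte, Term.eval_rename, Term.eval_congr (t := e.lhs) (v' := v),
      Term.eval_congr (t := t) (v' := y), hy i t ht]
    · simp [hk]
    · exact fun x hx => hagree x (Rule.mem_vars.2 (.inl (Atom.mem_vars.2 ⟨i, t, ht, hx⟩)))
    · exact fun x hx => if_neg fun hx' => hfresh x hx' (Atom.mem_vars.2 ⟨i, _, hk, hx⟩)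
  · replace he : e ∈ r.guard.map (Eqn.rename ρ) := he
    obtain ⟨e, heg, rfl⟩ := List.mem_map.1 he
    rw [Eqn.holds_rename]
    have := hg e heg
    unfold Eqn.Holds at this ⊢
    rwa [Term.eval_congr (v' := y), Term.eval_congr (t := e.rhs) (v' := y)]
    · exact fun x hx => hagree x (Rule.mem_vars.2 (.inr (.inl ⟨e, heg, List.mem_append_right _ hx⟩)))
    · exact fun x hx => hagree x (Rule.mem_vars.2 (.inr (.inl ⟨e, heg, List.mem_append_left _ hx⟩)))

/-! ### The eager semantics -/

def Constraint.toEqn? : Constraint → Option Eqn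
  | .builtin e => some e
  | .chr _ => none

/-- The CHR constraints that replace `k` when the instance `f` of the rule `r` is applied to `k`:
those of the body and, for a propagation rule, `k` itself. -/
def Rule.kids (r : Rule) (f : Var → Term) (k : Atom) : List Atom :=
  (if r.propagation then [k] else []) ++ r.body.filterMap fun c => (c.sub f).toAtom?

/-- The equations that are added when the instance `f` of the rule `r` is applied to `k`. -/
def Rule.told (r : Rule) (f : Var → Term) (k : Atom) : List Eqn :=
  matching k (r.head.sub f) ++ r.body.filterMap fun c => (c.sub f).toEqn?

theorem Constraint.toAtom?_sub (f : Var → Term) (c : Constraint) :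
    (c.sub f).toAtom? = c.toAtom?.map (Atom.sub f) := by
  cases c <;> rfl

theorem Constraint.toEqn?_sub (f : Var → Term) (c : Constraint) :
    (c.sub f).toEqn? = c.toEqn?.map (Eqn.sub f) := by
  cases c <;> rfl

theorem Constraint.toAtom?_eq_some {c : Constraint} {k : Atom} :
    c.toAtom? = some k ↔ c = .chr k := by
  cases c <;> simp [Constraint.toAtom?]

theorem Constraint.toEqn?_eq_some {c : Constraint} {e : Eqn} :
    c.toEqn? = some e ↔ c = .builtin e := by
  cases c <;> simp [Constraint.toEqn?]

theorem Rule.mem_kids {r : Rule} {f : Var → Term} {k k' : Atom} :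
    k' ∈ r.kids f k ↔ (r.propagation = true ∧ k' = k) ∨ ∃ h, .chr h ∈ r.body ∧ h.sub f = k' := by
  simp only [Rule.kids, List.mem_append, List.mem_ite_nil_right, List.mem_singleton,
    List.mem_filterMap, Constraint.toAtom?_sub, Option.map_eq_some_iff,
    Constraint.toAtom?_eq_some]
  refine or_congr Iff.rfl ⟨?_, ?_⟩
  · rintro ⟨c, hc, h, rfl, rfl⟩
    exact ⟨h, hc, rfl⟩
  · rintro ⟨h, hc, rfl⟩
    exact ⟨_, hc, h, rfl, rfl⟩

theorem Rule.mem_told {r : Rule} {f : Var → Term} {k : Atom} {e : Eqn} :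
    e ∈ r.told f k ↔ e ∈ matching k (r.head.sub f) ∨ ∃ e', .builtin e' ∈ r.body ∧ e'.sub f = e := by
  simp only [Rule.told, List.mem_append, List.mem_filterMap, Constraint.toEqn?_sub,
    Option.map_eq_some_iff, Constraint.toEqn?_eq_some]
  refine or_congr Iff.rfl ⟨?_, ?_⟩
  · rintro ⟨c, hc, h, rfl, rfl⟩
    exact ⟨h, hc, rfl⟩
  · rintro ⟨h, hc, rfl⟩
    exact ⟨_, hc, h, rfl, rfl⟩

theorem Rule.map_kids {r : Rule} {f g g' : Var → Term} {k : Atom}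
    (h : ∀ x ∈ r.vars, (f x).sub g = g' x) :
    (r.kids f k).map (Atom.sub g) = r.kids g' (k.sub g) := by
  have hsub : ∀ t : Term, (∀ x ∈ t.vars, (f x).sub g = g' x) → (t.sub f).sub g = t.sub g' := by
    rintro (x | a) ht
    · exact ht x (by simp [Term.vars])
    · rfl
  unfold Rule.kids
  rw [List.map_append, List.map_filterMap]
  congr 1
  · split <;> rfl
  · refine List.filterMap_congr fun c hc => ?_
    rw [Constraint.toAtom?_sub, Constraint.toAtom?_sub, Option.map_map]
    cases c with
    | builtin e => rfl
    | chr a =>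
      simp only [Constraint.toAtom?, Option.map_some, Function.comp_apply, Atom.sub, List.map_map]
      congr 2
      refine List.map_congr_left fun t ht => hsub t fun x hx => h x ?_
      exact Rule.mem_vars.2 (.inr (.inr ⟨_, hc, List.mem_flatMap.2 ⟨t, ht, hx⟩⟩))

theorem Rule.map_told {r : Rule} {f g g' : Var → Term} {k : Atom}
    (h : ∀ x ∈ r.vars, (f x).sub g = g' x) :
    (r.told f k).map (Eqn.sub g) = r.told g' (k.sub g) := by
  have hsub : ∀ t : Term, (∀ x ∈ t.vars, (f x).sub g = g' x) → (t.sub f).sub g = t.sub g' := by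
    rintro (x | a) ht
    · exact ht x (by simp [Term.vars])
    · rfl
  unfold Rule.told
  rw [List.map_append, List.map_filterMap]
  congr 1
  · have hh : (r.head.sub g').args = (r.head.sub f).args.map (Term.sub g) := by
      rw [Atom.sub_args, Atom.sub_args, List.map_map]
      exact List.map_congr_left fun t ht => (hsub t fun x hx => h x
        (Rule.mem_vars.2 (.inl (List.mem_flatMap.2 ⟨t, ht, hx⟩)))).symm
    unfold matching
    rw [hh, Atom.sub_args g, List.map_zipWith, List.zipWith_map]
    rfl
  · refine List.filterMap_congr fun c hc => ?_
    rw [Constraint.toEqn?_sub, Constraint.toEqn?_sub, Option.map_map]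
    cases c with
    | chr a => rfl
    | builtin e =>
      simp only [Constraint.toEqn?, Option.map_some, Function.comp_apply, Eqn.sub]
      rw [hsub, hsub]
      · exact fun x hx => h x (Rule.mem_vars.2 (.inr (.inr ⟨_, hc, List.mem_append_right _ hx⟩)))
      · exact fun x hx => h x (Rule.mem_vars.2 (.inr (.inr ⟨_, hc, List.mem_append_left _ hx⟩)))

theorem Rule.vars_kids {r : Rule} {f : Var → Term} {k k' : Atom} (hk : k' ∈ r.kids f k) {x : Var}
    (hx : x ∈ k'.vars) : x ∈ k.vars ∨ ∃ y ∈ r.vars, x ∈ (f y).vars := by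
  obtain ⟨-, rfl⟩ | ⟨h, hh, rfl⟩ := Rule.mem_kids.1 hk
  · exact .inl hx
  · obtain ⟨y, hy, hx⟩ := Atom.mem_vars_sub.1 hx
    exact .inr ⟨y, Rule.mem_vars.2 (.inr (.inr ⟨_, hh, hy⟩)), hx⟩

theorem Rule.vars_told {r : Rule} {f : Var → Term} {k : Atom} {e : Eqn} (he : e ∈ r.told f k)
    {x : Var} (hx : x ∈ e.vars) : x ∈ k.vars ∨ ∃ y ∈ r.vars, x ∈ (f y).vars := by
  obtain he | ⟨e', he', rfl⟩ := Rule.mem_told.1 he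
  · obtain ⟨i, hk, hh⟩ := mem_matching.1 he
    obtain hx | hx := List.mem_append.1 hx
    · exact .inl (Atom.mem_vars.2 ⟨i, _, hk, hx⟩)
    · obtain ⟨y, hy, hx⟩ := Atom.mem_vars_sub.1 (Atom.mem_vars.2 ⟨i, _, hh, hx⟩)
      exact .inr ⟨y, Rule.mem_vars.2 (.inl hy), hx⟩
  · obtain ⟨y, hy, hx⟩ := Eqn.mem_vars_sub.1 hx
    exact .inr ⟨y, Rule.mem_vars.2 (.inr (.inr ⟨_, he', hy⟩)), hx⟩

/-- The substitution that renames by the permutation `ρ`. -/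
abbrev permSub (ρ : Renaming) (x : Var) : Term := .var (ρ x)

/-- The substitution that adds `n` to each variable. -/
def shift (n : ℕ) (x : Var) : Term := .var (x + n)

/-- `B` is contradictory, or no rule is applicable to a member of `A`. -/
def Terminal (P : Program) (A : Multiset Atom) (B : Set Eqn) : Prop :=
  Bad B ∨ ∀ k ∈ A, ∀ r ∈ P, ¬ Fires r k B

instance : DecidableEq Term := Encodable.decidableEqOfEncodable Term

instance : DecidableEq Atom := Encodable.decidableEqOfEncodable Atom

/-- From the CHR constraints `A` and the equations `B`, at most `t` applications of rules lead to a
terminal state. Goals are flushed at once: all constraints of a body are introduced and solved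
together with the application. Rules are renamed apart by `shift n`, where `n` increases by `M` from
one application to the next. -/
inductive CanTerm (P : Program) (M : ℕ) : ℕ → List Atom → List Eqn → ℕ → Prop
  | done {t : ℕ} {A : List Atom} {B : List Eqn} {n : ℕ} (h : Terminal P A {e | e ∈ B}) :
      CanTerm P M t A B n
  | step {t : ℕ} {A : List Atom} {B : List Eqn} {n : ℕ} (k : Atom) (r : Rule) (hk : k ∈ A)
      (hr : r ∈ P) (hf : Fires r k {e | e ∈ B})
      (h : CanTerm P M t (r.kids (shift n) k ++ A.erase k) (r.told (shift n) k ++ B) (n + M)) :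
      CanTerm P M (t + 1) A B n

/-- All CHR constraints of a configuration, introduced or not. -/
def Config.atoms (c : Config) : Multiset Atom :=
  c.goal.filterMap Constraint.toAtom? + c.store.map Prod.fst

/-- All equations of a configuration, solved or not. -/
def Config.eqs (c : Config) : Set Eqn := {e | e ∈ c.builtins ∨ .builtin e ∈ c.goal}

theorem Config.mem_atoms {c : Config} {k : Atom} :
    k ∈ c.atoms ↔ .chr k ∈ c.goal ∨ ∃ l, (k, l) ∈ c.store := by
  simp only [Config.atoms, Multiset.mem_add, Multiset.mem_filterMap, Multiset.mem_map,
    Constraint.toAtom?_eq_some]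
  refine or_congr ⟨?_, fun h => ⟨_, h, rfl⟩⟩ ⟨?_, ?_⟩
  · rintro ⟨_, h, rfl⟩
    exact h
  · rintro ⟨⟨_, l⟩, h, rfl⟩
    exact ⟨l, h⟩
  · rintro ⟨l, h⟩
    exact ⟨_, h, rfl⟩

theorem Config.hasVar_iff {c : Config} {x : Var} :
    c.HasVar x ↔ (∃ k ∈ c.atoms, x ∈ k.vars) ∨ ∃ e ∈ c.eqs, x ∈ e.vars := by
  unfold Config.HasVar
  simp only [Config.mem_atoms, Config.eqs, Set.mem_ofPred_eq]
  constructor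
  · rintro (⟨k | k, hk, hx⟩ | ⟨⟨k, l⟩, hk, hx⟩ | ⟨e, he, hx⟩)
    · exact .inr ⟨k, .inr hk, hx⟩
    · exact .inl ⟨k, .inl hk, hx⟩
    · exact .inl ⟨k, .inr ⟨l, hk⟩, hx⟩
    · exact .inr ⟨e, .inl he, hx⟩
  · rintro (⟨k, hk | ⟨l, hk⟩, hx⟩ | ⟨e, he | he, hx⟩)
    · exact .inl ⟨_, hk, hx⟩
    · exact .inr (.inl ⟨_, hk, hx⟩)
    · exact .inr (.inr ⟨_, he, hx⟩)
    · exact .inl ⟨_, he, hx⟩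

theorem eqs_solve (e : Eqn) (G : Multiset Constraint) (S : Multiset (Atom × ℕ)) (B : List Eqn)
    (n : ℕ) : Config.eqs ⟨G, S, e :: B, n⟩ = Config.eqs ⟨.builtin e ::ₘ G, S, B, n⟩ := by
  ext e'
  simp only [Config.eqs, List.mem_cons, Multiset.mem_cons, Set.mem_ofPred_eq,
    Constraint.builtin.injEq]
  tauto

theorem atoms_solve (e : Eqn) (G : Multiset Constraint) (S : Multiset (Atom × ℕ)) (B : List Eqn)
    (n : ℕ) : Config.atoms ⟨G, S, e :: B, n⟩ = Config.atoms ⟨.builtin e ::ₘ G, S, B, n⟩ := by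
  simp [Config.atoms, Multiset.filterMap_cons, Constraint.toAtom?]

theorem eqs_introduce (k : Atom) (G : Multiset Constraint) (S : Multiset (Atom × ℕ))
    (B : List Eqn) (n : ℕ) :
    Config.eqs ⟨G, (k, n) ::ₘ S, B, n + 1⟩ = Config.eqs ⟨.chr k ::ₘ G, S, B, n⟩ := by
  ext e'
  simp [Config.eqs]

theorem atoms_introduce (k : Atom) (G : Multiset Constraint) (S : Multiset (Atom × ℕ))
    (B : List Eqn) (n : ℕ) :
    Config.atoms ⟨G, (k, n) ::ₘ S, B, n + 1⟩ = Config.atoms ⟨.chr k ::ₘ G, S, B, n⟩ := by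
  simp only [Config.atoms, Multiset.filterMap_cons, Constraint.toAtom?, Multiset.map_cons,
    Option.map_some, Option.getD_some]
  rw [← Multiset.singleton_add, ← add_assoc, add_comm (Multiset.filterMap _ _)]

theorem body_rename (r : Rule) (ρ : Renaming) :
    (r.rename ρ).body.filterMap Constraint.toAtom? =
      r.body.filterMap fun c => (c.sub (permSub ρ)).toAtom? := by
  simp only [Rule.rename, List.filterMap_map]
  refine List.filterMap_congr fun c _ => ?_
  rw [Function.comp_apply, Constraint.rename_eq_sub]

theorem atoms_apply_left (k : Atom) (l : ℕ) (G : Multiset Constraint)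
    (S : Multiset (Atom × ℕ)) (B : List Eqn) (n : ℕ) :
    Config.atoms ⟨G, (k, l) ::ₘ S, B, n⟩ = k ::ₘ Config.atoms ⟨G, S, B, n⟩ := by
  simp [Config.atoms]

theorem atoms_apply (r : Rule) (ρ : Renaming) (k : Atom) (l : ℕ) (G : Multiset Constraint)
    (S : Multiset (Atom × ℕ)) (B B' : List Eqn) (n : ℕ) :
    Config.atoms ⟨((r.rename ρ).body : Multiset Constraint) + G,
      if r.propagation then (k, l) ::ₘ S else S, B', n⟩ =
      (r.kids (permSub ρ) k : Multiset Atom) + Config.atoms ⟨G, S, B, n⟩ := by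
  simp only [Config.atoms, Multiset.filterMap_add, Multiset.filterMap_coe, body_rename, Rule.kids,
    ← Multiset.coe_add]
  split
  · simp only [Multiset.map_cons, Multiset.coe_singleton, Multiset.singleton_add,
      Multiset.cons_add, Multiset.add_cons, add_assoc]
  · simp [add_assoc]

theorem eqs_apply (r : Rule) (ρ : Renaming) (k : Atom) (G : Multiset Constraint)
    (S' S'' : Multiset (Atom × ℕ)) (B : List Eqn) (n : ℕ) :
    Config.eqs ⟨((r.rename ρ).body : Multiset Constraint) + G, S',
      matching k (r.rename ρ).head ++ B, n⟩ =
      {e | e ∈ r.told (permSub ρ) k} ∪ Config.eqs ⟨G, S'', B, n⟩ := by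
  ext e
  simp only [Config.eqs, Multiset.mem_add, Multiset.mem_coe, List.mem_append, Set.mem_ofPred_eq,
    Set.mem_union, Rule.mem_told, Rule.rename, Atom.rename_eq_sub, List.mem_map]
  have : (∃ a ∈ r.body, Constraint.rename ρ a = .builtin e) ↔
      ∃ e', .builtin e' ∈ r.body ∧ e'.sub (permSub ρ) = e := by
    constructor
    · rintro ⟨a | a, ha, h⟩
      · exact ⟨a, ha, by simpa [Constraint.rename, Eqn.rename_eq_sub] using h⟩
      · simp [Constraint.rename] at h
    · rintro ⟨e', he', rfl⟩
      exact ⟨_, he', by simp [Constraint.rename, Eqn.rename_eq_sub]⟩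
  rw [this]
  exact or_or_or_comm

/-! ### Executing eager derivations -/

/-- The number of applications of rules in a computation. -/
def Computation.applies {P : Program} {G : Goal} : {c : Config} → Computation P G c → ℕ
  | _, .start => 0
  | _, .step δ (.apply ..) _ _ => δ.applies + 1
  | _, .step δ .solve _ _ => δ.applies
  | _, .step δ (.introduce ..) _ _ => δ.applies

theorem blockSwap_involutive {m n : ℕ} (h : m ≤ n) : Function.Involutive fun x : ℕ =>
    if x < m then x + n else if n ≤ x ∧ x < n + m then x - n else x := by
  intro x
  dsimp only
  split_ifs <;> omega

/-- The permutation that exchanges the `m` variables from `0` with those from `n`. -/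
def blockSwap (m n : ℕ) (h : m ≤ n) : Renaming := (blockSwap_involutive h).toPerm

theorem blockSwap_apply {m n : ℕ} (h : m ≤ n) {x : ℕ} (hx : x < m) :
    blockSwap m n h x = x + n :=
  if_pos hx

theorem exists_flush {P : Program} {G : Goal} : ∀ (d : ℕ) (c : Config) (δ : Computation P G c),
    Multiset.card c.goal = d → ∃ (c' : Config) (δ' : Computation P G c'), c'.goal = 0 ∧
      c'.atoms = c.atoms ∧ c'.eqs = c.eqs ∧ δ'.applies = δ.applies := by
  intro d
  induction d with
  | zero => exact fun c δ h => ⟨c, δ, Multiset.card_eq_zero.1 h, rfl, rfl, rfl⟩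
  | succ d ih =>
    rintro ⟨g, S, B, n⟩ δ h
    obtain ⟨a, ha⟩ : ∃ a, a ∈ g :=
      Multiset.card_pos_iff_exists_mem.1 (lt_of_lt_of_eq (Nat.succ_pos d) h.symm)
    obtain ⟨G', rfl⟩ := Multiset.exists_cons_of_mem ha
    have hG : Multiset.card G' = d := by simpa using h
    cases a with
    | builtin e =>
      obtain ⟨c', δ', h0, ha, he, hn⟩ := ih _ (.step δ _ _ (.solve e G' S B n)) hG
      exact ⟨c', δ', h0, ha.trans (atoms_solve ..), he.trans (eqs_solve ..), hn⟩
    | chr k =>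
      obtain ⟨c', δ', h0, ha, he, hn⟩ := ih _ (.step δ _ _ (.introduce k G' S B n)) hG
      exact ⟨c', δ', h0, ha.trans (atoms_introduce ..), he.trans (eqs_introduce ..), hn⟩

theorem Config.eqs_of_goal {c : Config} (h : c.goal = 0) : c.eqs = {e | e ∈ c.builtins} := by
  simp [Config.eqs, h]

theorem Config.final_of_terminal {P : Program} {c : Config} (h0 : c.goal = 0)
    (h : Terminal P c.atoms c.eqs) : c.Final P := by
  obtain h | h := h
  · exact .inl (inconsistent_iff.2 (Config.eqs_of_goal h0 ▸ h))
  · refine .inr ⟨h0, ?_⟩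
    rintro ⟨a, c', hs⟩
    cases hs with
    | solve => simp at h0
    | introduce => simp at h0
    | apply r ρ k l G S B n mem apart hp hl he =>
      refine h k (Config.mem_atoms.2 (.inr ⟨l, Multiset.mem_cons_self _ _⟩)) r mem ?_
      refine fires_of_entails (fun e he => .inl he) hp hl (fun x hx hxk => apart x hx ?_) he
      exact .inr (.inl ⟨(k, l), Multiset.mem_cons_self _ _, hxk⟩)

/-- Above the largest variable of the program, `shift` agrees with a permutation on each rule. -/
theorem exists_perm_shift {r : Rule} {M n : ℕ} (hM : ∀ x ∈ r.vars, x < M) (hn : M ≤ n) :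
    ∃ ρ : Renaming, (∀ x ∈ r.vars, permSub ρ x = shift n x) ∧
      ∀ x ∈ (r.rename ρ).vars, n ≤ x ∧ x < n + M := by
  have h : ∀ x ∈ r.vars, blockSwap M n hn x = x + n := fun x hx => blockSwap_apply hn (hM x hx)
  refine ⟨blockSwap M n hn, fun x hx => congrArg _ (h x hx), fun x hx => ?_⟩
  obtain ⟨y, hy, rfl⟩ := Rule.mem_vars_rename.1 hx
  rw [h y hy]
  exact ⟨Nat.le_add_left n y, (Nat.add_lt_add_right (hM y hy) n).trans_eq (Nat.add_comm M n)⟩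

theorem Rule.kids_congr {r : Rule} {f g : Var → Term} {k : Atom} (h : ∀ x ∈ r.vars, f x = g x) :
    r.kids f k = r.kids g k := by
  unfold Rule.kids
  congr 1
  refine List.filterMap_congr fun c hc => ?_
  rw [Constraint.sub_congr fun x hx => h x (Rule.mem_vars.2 (.inr (.inr ⟨c, hc, hx⟩)))]

theorem Rule.told_congr {r : Rule} {f g : Var → Term} {k : Atom} (h : ∀ x ∈ r.vars, f x = g x) :
    r.told f k = r.told g k := by
  unfold Rule.told
  rw [Atom.sub_congr fun x hx => h x (Rule.mem_vars.2 (.inl hx))]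
  congr 1
  refine List.filterMap_congr fun c hc => ?_
  rw [Constraint.sub_congr fun x hx => h x (Rule.mem_vars.2 (.inr (.inr ⟨c, hc, hx⟩)))]

/-- Eager derivations are computations. -/
theorem CanTerm.exists_computation {P : Program} {G : Goal} {M t : ℕ} {A : List Atom}
    {B : List Eqn} {n : ℕ} (hM : ∀ r ∈ P, ∀ x ∈ r.vars, x < M) (h : CanTerm P M t A B n) :
    ∀ (c : Config) (δ : Computation P G c), c.goal = 0 → c.atoms = A → c.eqs = {e | e ∈ B} →
      (∀ x, c.HasVar x → x < n) → M ≤ n →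
      ∃ (c' : Config) (δ' : Computation P G c'), c'.Final P ∧ δ'.applies ≤ δ.applies + t := by
  induction h with
  | @done t A B n h =>
    intro c δ h0 hA hB _ _
    exact ⟨c, δ, Config.final_of_terminal h0 (by rwa [hA, hB]), Nat.le_add_right _ _⟩
  | @step t A B n k r hk hr hf _ ih =>
    intro c δ h0 hA hB hlt hn
    by_cases hbad : Bad {e | e ∈ B}
    · exact ⟨c, δ, Config.final_of_terminal h0 (.inl (hB ▸ hbad)), Nat.le_add_right _ _⟩
    obtain ⟨ρ, hρ, hρlt⟩ := exists_perm_shift (hM r hr) hn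
    obtain ⟨g, S, B₀, m⟩ := c
    obtain rfl : g = 0 := h0
    have hB₀ : {e | e ∈ B₀} = {e | e ∈ B} := by rw [← hB, Config.eqs_of_goal rfl]
    have hkA : k ∈ Config.atoms ⟨0, S, B₀, m⟩ := hA ▸ hk
    obtain ⟨l, hl⟩ : ∃ l, (k, l) ∈ S := by simpa [Config.mem_atoms] using hkA
    obtain ⟨S, rfl⟩ := Multiset.exists_cons_of_mem hl
    have hfresh : ∀ x ∈ (r.rename ρ).vars, ¬ Config.HasVar ⟨0, (k, l) ::ₘ S, B₀, m⟩ x :=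
      fun x hx hv => (hlt x hv).not_ge (hρlt x hx).1
    have hfreshk : ∀ x ∈ (r.rename ρ).vars, x ∉ k.vars := fun x hx hxk => hfresh x hx
      (.inr (.inl ⟨(k, l), Multiset.mem_cons_self _ _, hxk⟩))
    have hent := entails_of_fires (ρ := ρ) (B := B₀) (hB₀ ▸ hbad) hfreshk (hB₀ ▸ hf)
    obtain ⟨c', δ', hg', hA', hB', happ⟩ := exists_flush _ _
      (.step δ _ _ (.apply r ρ k l 0 S B₀ m hr hfresh hf.1 hf.2.1 hent)) rfl
    have hkids : r.kids (permSub ρ) k = r.kids (shift n) k := Rule.kids_congr hρ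
    have htold : r.told (permSub ρ) k = r.told (shift n) k := Rule.told_congr hρ
    rw [atoms_apply (B := B₀), hkids] at hA'
    rw [eqs_apply (S'' := S), htold] at hB'
    rw [atoms_apply_left] at hA
    have hAe : (A.erase k : Multiset Atom) = Config.atoms ⟨0, S, B₀, m⟩ := by
      rw [← Multiset.coe_erase, ← hA, Multiset.erase_cons_head]
    have hBe : Config.eqs ⟨0, S, B₀, m⟩ = {e | e ∈ B} := by rw [← hB₀, Config.eqs_of_goal rfl]
    obtain ⟨c'', δ'', hfin, hle⟩ := ih c' δ' hg' (by rw [hA', ← hAe, Multiset.coe_add])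
      (by rw [hB', hBe]; ext e; simp) (by
        intro x hx
        have hkv : ∀ x ∈ k.vars, x < n := fun x hx => hlt x
          (.inr (.inl ⟨(k, l), Multiset.mem_cons_self _ _, hx⟩))
        have hnew : ∀ {x}, (x ∈ k.vars ∨ ∃ y ∈ r.vars, x ∈ (shift n y).vars) → x < n + M := by
          rintro x (hx | ⟨y, hy, hx⟩)
          · exact (hkv x hx).trans_le (Nat.le_add_right _ _)
          · simp only [shift, Term.vars, List.mem_singleton] at hx
            subst hx
            exact (Nat.add_lt_add_right (hM r hr y hy) n).trans_eq (Nat.add_comm M n)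
        rw [Config.hasVar_iff, hA', hB'] at hx
        obtain ⟨k', hk', hx⟩ | ⟨e, he | he, hx⟩ := hx
        · obtain hk' | hk' := Multiset.mem_add.1 hk'
          · exact hnew (Rule.vars_kids (Multiset.mem_coe.1 hk') hx)
          · refine (hlt x (Config.hasVar_iff.2 (.inl ⟨k', ?_, hx⟩))).trans_le (Nat.le_add_right _ _)
            rw [atoms_apply_left]
            exact Multiset.mem_cons_of_mem hk'
        · exact hnew (Rule.vars_told he hx)
        · exact (hlt x (Config.hasVar_iff.2 (.inr ⟨e, he, hx⟩))).trans_le (Nat.le_add_right _ _))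
      (by omega)
    refine ⟨c'', δ'', hfin, ?_⟩
    have : δ'.applies = δ.applies + 1 := happ
    omega

/-! ### Amalgamating two parts of derivations -/

/-- The variable `x` occurs in the constraints `X`, the equations `BX` or the terms `q`. -/
def Over (X : Multiset Atom) (BX : Set Eqn) (q : List Term) (x : Var) : Prop :=
  (∃ k ∈ X, x ∈ k.vars) ∨ (∃ e ∈ BX, x ∈ e.vars) ∨ ∃ t ∈ q, x ∈ t.vars

/-- All variables of `t` satisfy `Over X BX q`. -/
def OverTerm (X : Multiset Atom) (BX : Set Eqn) (q : List Term) (t : Term) : Prop :=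
  ∀ x ∈ t.vars, Over X BX q x

section Over

variable {X : Multiset Atom} {BX : Set Eqn} {q : List Term}

theorem OverTerm.const (c : Const) : OverTerm X BX q (.const c) := by
  simp [OverTerm, Term.vars]

theorem overTerm_var {x : Var} : OverTerm X BX q (.var x) ↔ Over X BX q x := by
  simp [OverTerm, Term.vars]

theorem OverTerm.of_tm {x : Port} {t : Term} (h : tm q x = some t) : OverTerm X BX q t := by
  cases x with
  | inl i => exact fun x hx => .inr (.inr ⟨t, List.mem_of_getElem? h, hx⟩)
  | inr c =>
    simp only [tm, Option.some.injEq] at h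
    exact h ▸ OverTerm.const c

theorem OverTerm.of_arg {k : Atom} (hk : k ∈ X) {t : Term} (ht : t ∈ k.args) :
    OverTerm X BX q t :=
  fun _ hx => .inl ⟨k, hk, List.mem_flatMap.2 ⟨t, ht, hx⟩⟩

theorem OverTerm.of_mem {e : Eqn} (he : e ∈ BX) :
    OverTerm X BX q e.lhs ∧ OverTerm X BX q e.rhs :=
  ⟨fun _ hx => .inr (.inl ⟨e, he, List.mem_append_left _ hx⟩),
    fun _ hx => .inr (.inl ⟨e, he, List.mem_append_right _ hx⟩)⟩

/-- The variables after an application are those before it and those of the rule. -/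
theorem Over.of_apply {k : Atom} {r : Rule} {ρ : Renaming} {x : Var}
    (h : Over ((r.kids (permSub ρ) k : Multiset Atom) + X)
      ({e | e ∈ r.told (permSub ρ) k} ∪ BX) q x) :
    Over (k ::ₘ X) BX q x ∨ x ∈ (r.rename ρ).vars := by
  have key : (x ∈ k.vars ∨ ∃ y ∈ r.vars, x ∈ (permSub ρ y).vars) →
      Over (k ::ₘ X) BX q x ∨ x ∈ (r.rename ρ).vars := by
    rintro (hx | ⟨y, hy, hx⟩)
    · exact .inl (.inl ⟨k, Multiset.mem_cons_self _ _, hx⟩)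
    · exact .inr (Rule.mem_vars_rename.2 ⟨y, hy, (List.mem_singleton.1 hx).symm⟩)
  obtain ⟨k', hk', hx⟩ | ⟨e, he | he, hx⟩ | h := h
  · obtain hk' | hk' := Multiset.mem_add.1 hk'
    · exact key (Rule.vars_kids (Multiset.mem_coe.1 hk') hx)
    · exact .inl (.inl ⟨k', Multiset.mem_cons_of_mem hk', hx⟩)
  · exact key (Rule.vars_told he hx)
  · exact .inl (.inr (.inl ⟨e, he, hx⟩))
  · exact .inl (.inr (.inr h))

end Over

/-- The state `A`, `B`, `n` is made of a copy, under `f₁`, of the constraints `X₁` and the equations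
`B₁`, and of a copy, under `f₂`, of `X₂` and `B₂`. The two copies share the terms of `q₁`, which are
identified with the terms of `q₂`, and the constants, but nothing else. -/
structure Joint (X₁ : Multiset Atom) (B₁ : Set Eqn) (q₁ : List Term) (f₁ : Var → Term)
    (X₂ : Multiset Atom) (B₂ : Set Eqn) (q₂ : List Term) (f₂ : Var → Term)
    (A : List Atom) (B : List Eqn) (n : ℕ) : Prop where
  atoms : (A : Multiset Atom) = X₁.map (Atom.sub f₁) + X₂.map (Atom.sub f₂)
  eqs : {e | e ∈ B} = Eqn.sub f₁ '' B₁ ∪ Eqn.sub f₂ '' B₂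
  lt₁ : ∀ x, Over X₁ B₁ q₁ x → ∀ y ∈ (f₁ x).vars, y < n
  lt₂ : ∀ x, Over X₂ B₂ q₂ x → ∀ y ∈ (f₂ x).vars, y < n
  inj₁ : ∀ s t, OverTerm X₁ B₁ q₁ s → OverTerm X₁ B₁ q₁ t → s.sub f₁ = t.sub f₁ → s = t
  inj₂ : ∀ s t, OverTerm X₂ B₂ q₂ s → OverTerm X₂ B₂ q₂ t → s.sub f₂ = t.sub f₂ → s = t
  cross : ∀ s t, OverTerm X₁ B₁ q₁ s → OverTerm X₂ B₂ q₂ t → s.sub f₁ = t.sub f₂ →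
    ∃ x, tm q₁ x = some s ∧ tm q₂ x = some t

theorem Joint.swap {X₁ X₂ : Multiset Atom} {B₁ B₂ : Set Eqn} {q₁ q₂ : List Term}
    {f₁ f₂ : Var → Term} {A : List Atom} {B : List Eqn} {n : ℕ}
    (h : Joint X₁ B₁ q₁ f₁ X₂ B₂ q₂ f₂ A B n) : Joint X₂ B₂ q₂ f₂ X₁ B₁ q₁ f₁ A B n where
  atoms := h.atoms.trans (add_comm _ _)
  eqs := h.eqs.trans (Set.union_comm _ _)
  lt₁ := h.lt₂
  lt₂ := h.lt₁
  inj₁ := h.inj₂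
  inj₂ := h.inj₁
  cross s t hs ht hst := by
    obtain ⟨x, hx, hx'⟩ := h.cross t s ht hs hst.symm
    exact ⟨x, hx', hx⟩

/-- An application in the first part is copied: its fresh variables become the next fresh variables
of the joint state. -/
theorem Joint.apply {X₁ X₂ : Multiset Atom} {B₁ B₂ : Set Eqn} {q₁ q₂ : List Term}
    {f₁ f₂ : Var → Term} {A : List Atom} {B : List Eqn} {n M : ℕ} {k : Atom} {r : Rule}
    {ρ : Renaming} (h : Joint (k ::ₘ X₁) B₁ q₁ f₁ X₂ B₂ q₂ f₂ A B n)
    (hM : ∀ x ∈ r.vars, x < M)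
    (hfresh : ∀ x ∈ (r.rename ρ).vars, ¬ Over (k ::ₘ X₁) B₁ q₁ x) :
    k.sub f₁ ∈ A ∧ ∃ f₁' : Var → Term, (∀ x, Over (k ::ₘ X₁) B₁ q₁ x → f₁' x = f₁ x) ∧
      Joint ((r.kids (permSub ρ) k : Multiset Atom) + X₁) ({e | e ∈ r.told (permSub ρ) k} ∪ B₁)
        q₁ f₁' X₂ B₂ q₂ f₂ (r.kids (shift n) (k.sub f₁) ++ A.erase (k.sub f₁))
        (r.told (shift n) (k.sub f₁) ++ B) (n + M) := by
  classical
  have hmem : k.sub f₁ ∈ A := by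
    rw [← Multiset.mem_coe, h.atoms]
    simp
  refine ⟨hmem, fun v => if v ∈ (r.rename ρ).vars then shift n (ρ.symm v) else f₁ v,
    fun x hx => if_neg fun hx' => hfresh x hx' hx, ?_⟩
  set f₁' : Var → Term := fun v => if v ∈ (r.rename ρ).vars then shift n (ρ.symm v) else f₁ v
    with hf₁'
  have hold : ∀ x, Over (k ::ₘ X₁) B₁ q₁ x → f₁' x = f₁ x :=
    fun x hx => if_neg fun hx' => hfresh x hx' hx
  have hnew : ∀ x ∈ r.vars, (permSub ρ x).sub f₁' = shift n x := fun x hx => by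
    simp only [Term.sub_var, hf₁', Equiv.symm_apply_apply]
    exact if_pos (Rule.mem_vars_rename.2 ⟨x, hx, rfl⟩)
  have hcases : ∀ x, Over ((r.kids (permSub ρ) k : Multiset Atom) + X₁)
      ({e | e ∈ r.told (permSub ρ) k} ∪ B₁) q₁ x →
      (Over (k ::ₘ X₁) B₁ q₁ x ∧ f₁' x = f₁ x) ∨
        ∃ y ∈ r.vars, x = ρ y ∧ f₁' x = shift n y := fun x hx => by
    obtain hx | hx := hx.of_apply
    · exact .inl ⟨hx, hold x hx⟩
    · obtain ⟨y, hy, rfl⟩ := Rule.mem_vars_rename.1 hx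
      exact .inr ⟨y, hy, rfl, hnew y hy⟩
  have hk : k.sub f₁' = k.sub f₁ := Atom.sub_congr fun x hx =>
    hold x (.inl ⟨k, Multiset.mem_cons_self _ _, hx⟩)
  have htcases : ∀ t, OverTerm ((r.kids (permSub ρ) k : Multiset Atom) + X₁)
      ({e | e ∈ r.told (permSub ρ) k} ∪ B₁) q₁ t →
      (OverTerm (k ::ₘ X₁) B₁ q₁ t ∧ t.sub f₁' = t.sub f₁) ∨
        ∃ y ∈ r.vars, t = .var (ρ y) ∧ t.sub f₁' = shift n y := by
    rintro (x | c) ht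
    · obtain ⟨hx, he⟩ | ⟨y, hy, rfl, he⟩ := hcases x (overTerm_var.1 ht)
      · exact .inl ⟨overTerm_var.2 hx, he⟩
      · exact .inr ⟨y, hy, rfl, he⟩
    · exact .inl ⟨OverTerm.const c, rfl⟩
  have hfar₁ : ∀ t y, OverTerm (k ::ₘ X₁) B₁ q₁ t → t.sub f₁ ≠ shift n y := by
    rintro (x | c) y ht he
    · have := h.lt₁ x (overTerm_var.1 ht) (y + n) (by
        rw [show f₁ x = shift n y from he]
        simp [shift, Term.vars])
      exact this.not_ge (Nat.le_add_left _ _)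
    · cases he
  have hfar₂ : ∀ t y, OverTerm X₂ B₂ q₂ t → t.sub f₂ ≠ shift n y := by
    rintro (x | c) y ht he
    · have := h.lt₂ x (overTerm_var.1 ht) (y + n) (by
        rw [show f₂ x = shift n y from he]
        simp [shift, Term.vars])
      exact this.not_ge (Nat.le_add_left _ _)
    · cases he
  refine ⟨?_, ?_, ?_, fun x hx y hy => (h.lt₂ x hx y hy).trans_le (Nat.le_add_right _ _), ?_,
    h.inj₂, ?_⟩
  · have hX : X₁.map (Atom.sub f₁') = X₁.map (Atom.sub f₁) :=
      Multiset.map_congr rfl fun a ha => Atom.sub_congr fun x hx =>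
        hold x (.inl ⟨a, Multiset.mem_cons_of_mem ha, hx⟩)
    rw [← Multiset.coe_add, ← Multiset.coe_erase, h.atoms, Multiset.map_cons, Multiset.cons_add,
      Multiset.erase_cons_head, Multiset.map_add, Multiset.map_coe, Rule.map_kids hnew, hk, hX,
      add_assoc]
  · have hB : Eqn.sub f₁' '' B₁ = Eqn.sub f₁ '' B₁ :=
      Set.image_congr fun e he => Eqn.sub_congr fun x hx => hold x (.inr (.inl ⟨e, he, hx⟩))
    have hT : Eqn.sub f₁' '' {e | e ∈ r.told (permSub ρ) k} =
        {e | e ∈ r.told (shift n) (k.sub f₁)} := by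
      rw [← hk, ← Rule.map_told hnew]
      ext e
      simp
    rw [Set.image_union, hB, hT, Set.union_assoc, ← h.eqs]
    ext e
    simp
  · intro x hx y hy
    obtain ⟨hx, he⟩ | ⟨z, hz, rfl, he⟩ := hcases x hx
    · exact (h.lt₁ x hx y (he ▸ hy)).trans_le (Nat.le_add_right _ _)
    · rw [he] at hy
      simp only [shift, Term.vars, List.mem_singleton] at hy
      subst hy
      exact (Nat.add_lt_add_right (hM z hz) n).trans_eq (Nat.add_comm M n)
  · intro s t hs ht hst
    obtain ⟨hs, hes⟩ | ⟨y, hy, rfl, hes⟩ := htcases s hs <;>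
      obtain ⟨ht, het⟩ | ⟨z, hz, rfl, het⟩ := htcases t ht <;> rw [hes, het] at hst
    · exact h.inj₁ s t hs ht hst
    · exact absurd hst (hfar₁ s z hs)
    · exact absurd hst.symm (hfar₁ t y ht)
    · simp only [shift, Term.var.injEq] at hst
      rw [Nat.add_right_cancel hst]
  · intro s t hs ht hst
    obtain ⟨hs, hes⟩ | ⟨y, hy, rfl, hes⟩ := htcases s hs <;> rw [hes] at hst
    · exact h.cross s t hs ht hst
    · exact absurd hst.symm (hfar₂ t y ht)

/-- The terms common to the two sides of a split state are the terms of `q` and the constants. -/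
def Separated (X : Multiset Atom) (BX : Set Eqn) (Y : Multiset Atom) (BY : Set Eqn)
    (q : List Term) : Prop :=
  ∀ x, Over X BX q x → Over Y BY q x → ∃ t ∈ q, x ∈ t.vars

theorem Separated.symm {X Y : Multiset Atom} {BX BY : Set Eqn} {q : List Term}
    (h : Separated X BX Y BY q) : Separated Y BY X BX q := fun x hx hy => h x hy hx

theorem Separated.exists_port {X Y : Multiset Atom} {BX BY : Set Eqn} {q : List Term}
    (h : Separated X BX Y BY q) {t : Term} (hX : OverTerm X BX q t) (hY : OverTerm Y BY q t) :
    ∃ x, tm q x = some t := by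
  cases t with
  | const c => exact ⟨.inr c, rfl⟩
  | var v =>
    obtain ⟨t, ht, hv⟩ := h v (overTerm_var.1 hX) (overTerm_var.1 hY)
    obtain ⟨i, hi⟩ := List.mem_iff_getElem?.1 ht
    cases t with
    | const c => simp [Term.vars] at hv
    | var w => exact ⟨.inl i, by rw [List.mem_singleton.1 hv]; exact hi⟩

theorem Separated.apply {X Y : Multiset Atom} {BX BY : Set Eqn} {q : List Term} {k : Atom}
    {r : Rule} {ρ : Renaming} (h : Separated (k ::ₘ X) BX Y BY q)
    (hfresh : ∀ x ∈ (r.rename ρ).vars, ¬ Over Y BY q x) :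
    Separated ((r.kids (permSub ρ) k : Multiset Atom) + X) ({e | e ∈ r.told (permSub ρ) k} ∪ BX)
      Y BY q := by
  intro x hx hy
  obtain hx | hx := hx.of_apply
  · exact h x hx hy
  · exact absurd hy (hfresh x hx)

/-- `N` entails, under `f`, the equations between ports that `C` entails. -/
def EntPorts (q : List Term) (C : Set Eqn) (f : Var → Term) (N : Set Eqn) : Prop :=
  ∀ x y s t, tm q x = some s → tm q y = some t → Ent C s t → Ent N (s.sub f) (t.sub f)

/-- Interpolation: the equations of the other side matter only through the equations between ports
that they contribute to. Here `BX'` is only used to speak of further variables of the same side. -/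
theorem Separated.ent {X Y : Multiset Atom} {BX BX' BY N : Set Eqn} {q : List Term}
    {f : Var → Term} (h : Separated X BX' Y BY q) (hBX : BX ⊆ BX') (hN : ∀ e ∈ BX, e.sub f ∈ N)
    (hp : EntPorts q (BX ∪ BY) f N) {s t : Term} (hs : OverTerm X BX' q s)
    (ht : OverTerm X BX' q t) (hst : Ent (BX ∪ BY) s t) : Ent N (s.sub f) (t.sub f) := by
  have hport : ∀ {u s}, OverTerm X BX' q s → OverTerm Y BY q u → Rel BX s u →
      ∃ x, tm q x = some u := fun {u s} hs hu hsu => by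
    obtain rfl | ⟨-, e, he, hue⟩ := hsu.eq_or_mem
    · exact h.exists_port hs hu
    · obtain rfl | rfl := hue
      · exact h.exists_port (OverTerm.of_mem (hBX he)).1 hu
      · exact h.exists_port (OverTerm.of_mem (hBX he)).2 hu
  have key : ∀ {s t}, OverTerm X BX' q s → OverTerm X BX' q t → Rel (BX ∪ BY) s t →
      Ent N (s.sub f) (t.sub f) := fun {s t} hs ht hst => by
    rw [Set.union_comm] at hst
    obtain h' | ⟨u, u', hu, hu', h1, h2, h3⟩ := hst.union_cases (Q := Rel (BY ∪ BX))
      (D := OverTerm Y BY q) (fun e he => OverTerm.of_mem he)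
      (fun _ _ _ _ h => h.mono Set.subset_union_right)
      (fun e he => .of_mem (.inl he)) (fun _ _ h => h.symm) (fun _ _ _ h h' => h.trans h')
    · exact .inl (h'.sub hN)
    · obtain ⟨x, hx⟩ := hport hs hu h1
      obtain ⟨y, hy⟩ := hport ht hu' h3.symm
      refine Ent.trans (.inl (h1.sub hN)) (Ent.trans (hp x y u u' hx hy (.inl ?_))
        (.inl (h3.sub hN)))
      rwa [Set.union_comm]
  obtain hst | ⟨c, d, hcd, hst⟩ := hst
  · exact key hs ht hst
  · exact .inr (bad_of_ent hcd (key (OverTerm.const c) (OverTerm.const d) hst))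

/-- `Joint.apply` preserves the entailed equations between ports. -/
theorem Joint.step {P : Program} {X₁ X₂ Y₁ : Multiset Atom} {B₁ B₂ C₁ : Set Eqn}
    {q₁ q₂ : List Term} {f₁ f₂ : Var → Term} {A : List Atom} {B : List Eqn} {n M : ℕ} {k : Atom}
    {r : Rule} {ρ : Renaming} (h : Joint (k ::ₘ X₁) B₁ q₁ f₁ X₂ B₂ q₂ f₂ A B n)
    (hsep : Separated (k ::ₘ X₁) B₁ Y₁ C₁ q₁) (hp : EntPorts q₁ (B₁ ∪ C₁) f₁ {e | e ∈ B})
    (hr : r ∈ P) (hM : ∀ x ∈ r.vars, x < M) (hf : Fires r k (B₁ ∪ C₁))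
    (hfresh : ∀ x ∈ (r.rename ρ).vars, ¬ Over (k ::ₘ X₁) B₁ q₁ x ∧ ¬ Over Y₁ C₁ q₁ x) :
    ∃ (f₁' : Var → Term) (A' : List Atom) (B' : List Eqn),
      (∀ x, Over (k ::ₘ X₁) B₁ q₁ x → f₁' x = f₁ x) ∧ {e | e ∈ B} ⊆ {e | e ∈ B'} ∧
      Joint ((r.kids (permSub ρ) k : Multiset Atom) + X₁) ({e | e ∈ r.told (permSub ρ) k} ∪ B₁)
        q₁ f₁' X₂ B₂ q₂ f₂ A' B' (n + M) ∧
      Separated ((r.kids (permSub ρ) k : Multiset Atom) + X₁)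
        ({e | e ∈ r.told (permSub ρ) k} ∪ B₁) Y₁ C₁ q₁ ∧
      EntPorts q₁ ({e | e ∈ r.told (permSub ρ) k} ∪ B₁ ∪ C₁) f₁' {e | e ∈ B'} ∧
      ∀ m, CanTerm P M m A' B' (n + M) → CanTerm P M (m + 1) A B n := by
  obtain ⟨hk, f₁', hf', hJ⟩ := h.apply hM fun x hx => (hfresh x hx).1
  have hsub : {e | e ∈ B} ⊆ {e | e ∈ r.told (shift n) (k.sub f₁) ++ B} := fun e he =>
    List.mem_append_right _ he
  have hsep' := hsep.apply fun x hx => (hfresh x hx).2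
  have hN : ∀ e ∈ B₁, e.sub f₁ ∈ {e | e ∈ B} := fun e he => by
    rw [h.eqs]
    exact .inl ⟨e, he, rfl⟩
  have hN' : ∀ e ∈ {e | e ∈ r.told (permSub ρ) k} ∪ B₁,
      e.sub f₁' ∈ {e | e ∈ r.told (shift n) (k.sub f₁) ++ B} := fun e he => by
    rw [hJ.eqs]
    exact .inl ⟨e, he, rfl⟩
  have hagree : ∀ {x s}, tm q₁ x = some s → s.sub f₁' = s.sub f₁ := fun hs =>
    Term.sub_congr fun x hx => hf' x (OverTerm.of_tm hs x hx)
  have hp' : EntPorts q₁ (B₁ ∪ C₁) f₁' {e | e ∈ r.told (shift n) (k.sub f₁) ++ B} := by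
    intro x y s t hs ht hst
    rw [hagree hs, hagree ht]
    exact (hp x y s t hs ht hst).mono hsub
  refine ⟨f₁', _, _, hf', hsub, hJ, hsep', ?_, fun m hm => .step _ r hk hr ?_ hm⟩
  · intro x y s t hs ht hst
    rw [Set.union_assoc] at hst
    refine hst.of_union (fun c => OverTerm.const c) (fun e he => OverTerm.of_mem (.inl he))
      (fun u u' hu hu' hr => hsep'.ent Set.subset_union_right (fun e he => hN' e (.inr he)) hp'
        hu hu' hr) (fun e he => hN' e (.inl he)) (OverTerm.of_tm hs) (OverTerm.of_tm ht)
  · refine hf.transfer rfl (by simp) ?_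
    rintro ⟨x, y⟩ ⟨s, t, hs, ht, hst⟩
    have hover : ∀ {x s}, tm k.args x = some s → OverTerm (k ::ₘ X₁) B₁ q₁ s := by
      rintro (i | c) s hs
      · exact OverTerm.of_arg (Multiset.mem_cons_self _ _) (List.mem_of_getElem? hs)
      · simp only [tm, Option.some.injEq] at hs
        exact hs ▸ OverTerm.const c
    refine ⟨s.sub f₁, t.sub f₁, ?_, ?_, hsep.ent subset_rfl hN hp (hover hs) (hover ht) hst⟩
    · rw [Atom.sub_args, tm_map, hs]; rfl
    · rw [Atom.sub_args, tm_map, ht]; rfl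

/-- If the two parts are cut from states with the same entailed equations between ports, then the
joint state entails no equation in the first part that the first state does not entail: the two
sets of equivalence classes can be amalgamated along the ports. -/
theorem Joint.rel_of_rel {X₁ X₂ : Multiset Atom} {B₁ B₂ C₁ C₂ : Set Eqn} {q₁ q₂ : List Term}
    {f₁ f₂ : Var → Term} {A : List Atom} {B : List Eqn} {n : ℕ}
    (h : Joint X₁ B₁ q₁ f₁ X₂ B₂ q₂ f₂ A B n) (h₁ : B₁ ⊆ C₁) (h₂ : B₂ ⊆ C₂)
    (hC₁ : ¬ Bad C₁) (hC₂ : ¬ Bad C₂) (hpat : pat q₁ C₁ = pat q₂ C₂)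
    {s t : Term} (hs : OverTerm X₁ B₁ q₁ s) (ht : OverTerm X₁ B₁ q₁ t)
    (hst : Rel {e | e ∈ B} (s.sub f₁) (t.sub f₁)) : Rel C₁ s t := by
  classical
  have hports : ∀ {x y s₁ s₁' t₁ t₁'}, tm q₁ x = some s₁ → tm q₁ y = some s₁' →
      tm q₂ x = some t₁ → tm q₂ y = some t₁' → (Rel C₁ s₁ s₁' ↔ Rel C₂ t₁ t₁') := by
    intro x y s₁ s₁' t₁ t₁' hx hy hx' hy'
    have e₁ := pat_iff (B := C₁) hx hy
    have e₂ := pat_iff (B := C₂) hx' hy'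
    rw [hpat] at e₁
    exact ⟨fun h => (e₂.1 (e₁.2 (.inl h))).rel hC₂, fun h => (e₁.1 (e₂.2 (.inl h))).rel hC₁⟩
  -- The class of a term of either part in the amalgam, as a set of terms of both parts.
  let cl₁ (s : Term) : Term ⊕ Term → Prop := Sum.elim (fun s' => Rel C₁ s s') fun t' =>
    ∃ x s₁ t₁, tm q₁ x = some s₁ ∧ tm q₂ x = some t₁ ∧ Rel C₁ s s₁ ∧ Rel C₂ t₁ t'
  let cl₂ (t : Term) : Term ⊕ Term → Prop := Sum.elim
    (fun s' => ∃ x s₁ t₁, tm q₁ x = some s₁ ∧ tm q₂ x = some t₁ ∧ Rel C₁ s₁ s' ∧ Rel C₂ t t₁)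
    fun t' => Rel C₂ t t'
  have hcl₁ : ∀ {s s'}, Rel C₁ s s' → cl₁ s = cl₁ s' := fun {s s'} hss => by
    funext z
    obtain z | z := z
    · exact propext ⟨hss.symm.trans, hss.trans⟩
    · refine propext ⟨?_, ?_⟩
      · rintro ⟨x, s₁, t₁, hx, hx', h, h'⟩
        exact ⟨x, s₁, t₁, hx, hx', hss.symm.trans h, h'⟩
      · rintro ⟨x, s₁, t₁, hx, hx', h, h'⟩
        exact ⟨x, s₁, t₁, hx, hx', hss.trans h, h'⟩
  have hcl₂ : ∀ {t t'}, Rel C₂ t t' → cl₂ t = cl₂ t' := fun {t t'} htt => by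
    funext z
    obtain z | z := z
    · refine propext ⟨?_, ?_⟩
      · rintro ⟨x, s₁, t₁, hx, hx', h, h'⟩
        exact ⟨x, s₁, t₁, hx, hx', h, htt.symm.trans h'⟩
      · rintro ⟨x, s₁, t₁, hx, hx', h, h'⟩
        exact ⟨x, s₁, t₁, hx, hx', h, htt.trans h'⟩
    · exact propext ⟨htt.symm.trans, htt.trans⟩
  have hcl : ∀ {x s t}, tm q₁ x = some s → tm q₂ x = some t → cl₁ s = cl₂ t := by
    intro x s t hx hx'
    funext z
    obtain z | z := z
    · refine propext ⟨fun h => ⟨x, s, t, hx, hx', h, .refl _⟩, ?_⟩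
      rintro ⟨y, s₁, t₁, hy, hy', h, h'⟩
      exact ((hports hx hy hx' hy').2 h').trans h
    · refine propext ⟨?_, fun h => ⟨x, s, t, hx, hx', .refl _, h⟩⟩
      rintro ⟨y, s₁, t₁, hy, hy', h, h'⟩
      exact ((hports hx hy hx' hy').1 h).trans h'
  let g (z : Term) : Term ⊕ Term → Prop :=
    if h : ∃ s, OverTerm X₁ B₁ q₁ s ∧ s.sub f₁ = z then cl₁ h.choose
    else if h : ∃ t, OverTerm X₂ B₂ q₂ t ∧ t.sub f₂ = z then cl₂ h.choose else fun _ => False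
  have hg₁ : ∀ {s}, OverTerm X₁ B₁ q₁ s → g (s.sub f₁) = cl₁ s := fun {s} hs => by
    have hex : ∃ s', OverTerm X₁ B₁ q₁ s' ∧ s'.sub f₁ = s.sub f₁ := ⟨s, hs, rfl⟩
    simp only [g, dif_pos hex]
    rw [h.inj₁ _ _ hex.choose_spec.1 hs hex.choose_spec.2]
  have hg₂ : ∀ {t}, OverTerm X₂ B₂ q₂ t → g (t.sub f₂) = cl₂ t := fun {t} ht => by
    by_cases hex : ∃ s, OverTerm X₁ B₁ q₁ s ∧ s.sub f₁ = t.sub f₂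
    · obtain ⟨s, hs, hst⟩ := hex
      obtain ⟨x, hx, hx'⟩ := h.cross s t hs ht hst
      rw [← hst, hg₁ hs, hcl hx hx']
    · have hex' : ∃ t', OverTerm X₂ B₂ q₂ t' ∧ t'.sub f₂ = t.sub f₂ := ⟨t, ht, rfl⟩
      simp only [g, dif_neg hex, dif_pos hex']
      rw [h.inj₂ _ _ hex'.choose_spec.1 ht hex'.choose_spec.2]
  have hgB : g (s.sub f₁) = g (t.sub f₁) := by
    refine hst.lift (Q := fun s t => g s = g t) (fun e he => ?_) (fun _ => rfl)
      (fun _ _ h => h.symm) (fun _ _ _ h h' => h.trans h')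
    rw [h.eqs] at he
    obtain ⟨e, he, rfl⟩ | ⟨e, he, rfl⟩ := he
    · simp only [Eqn.sub]
      rw [hg₁ (OverTerm.of_mem he).1, hg₁ (OverTerm.of_mem he).2]
      exact hcl₁ (.of_mem (h₁ he))
    · simp only [Eqn.sub]
      rw [hg₂ (OverTerm.of_mem he).1, hg₂ (OverTerm.of_mem he).2]
      exact hcl₂ (.of_mem (h₂ he))
  rw [hg₁ hs, hg₁ ht] at hgB
  have : cl₁ s (.inl t) = cl₁ t (.inl t) := congrFun hgB _
  exact this.mpr (Rel.refl t)

theorem Joint.not_fires {X₁ X₂ : Multiset Atom} {B₁ B₂ C₁ C₂ : Set Eqn} {q₁ q₂ : List Term}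
    {f₁ f₂ : Var → Term} {A : List Atom} {B : List Eqn} {n : ℕ}
    (h : Joint X₁ B₁ q₁ f₁ X₂ B₂ q₂ f₂ A B n) (h₁ : B₁ ⊆ C₁) (h₂ : B₂ ⊆ C₂)
    (hC₁ : ¬ Bad C₁) (hC₂ : ¬ Bad C₂) (hpat : pat q₁ C₁ = pat q₂ C₂) (hB : ¬ Bad {e | e ∈ B})
    {k : Atom} (hk : k ∈ X₁) {r : Rule} (hf : ¬ Fires r k C₁) :
    ¬ Fires r (k.sub f₁) {e | e ∈ B} := by
  refine fun hf' => hf (hf'.transfer rfl (by simp) ?_)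
  have hover : ∀ {x s}, tm (k.sub f₁).args x = some s →
      ∃ s', OverTerm X₁ B₁ q₁ s' ∧ tm k.args x = some s' ∧ s'.sub f₁ = s := by
    rintro (i | c) s hs
    · rw [Atom.sub_args, tm_map, Option.map_eq_some_iff] at hs
      obtain ⟨s', hs', rfl⟩ := hs
      exact ⟨s', OverTerm.of_arg hk (List.mem_of_getElem? hs'), hs', rfl⟩
    · exact ⟨.const c, OverTerm.const c, rfl, Option.some.inj hs⟩
  rintro ⟨x, y⟩ ⟨s, t, hs, ht, hst⟩
  obtain ⟨s, hos, hs', rfl⟩ := hover hs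
  obtain ⟨t, hot, ht', rfl⟩ := hover ht
  exact ⟨s, t, hs', ht', .inl (h.rel_of_rel h₁ h₂ hC₁ hC₂ hpat hos hot (hst.rel hB))⟩

/-! ### Grafting -/

open Classical in
/-- Records in front of `ch` that the entailed equations between ports grow from `E` to `E'`, by a
step of the side `d`; nothing is recorded if they stay the same. -/
noncomputable def jump (d : Bool) (E E' : Set (Port × Port))
    (ch : List (Bool × Set (Port × Port))) : List (Bool × Set (Port × Port)) :=
  if E = E' then ch else (d, E') :: ch

/-- A derivation split into an outer and an inner side, which have the terms of `q` and the
constants in common. The outer side has the constraints `O` and the equations `BO`, the inner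
side has `I` and `BI`. In `SplitRun P q O BO I BI ch a b`, there are `a` outer and `b` inner
applications of rules, which lead to a terminal state, and `ch` is the history of the entailed
equations between ports: each growth is listed with its side (`true` is outer) and its result. -/
inductive SplitRun (P : Program) (q : List Term) : Multiset Atom → Set Eqn → Multiset Atom →
    Set Eqn → List (Bool × Set (Port × Port)) → ℕ → ℕ → Prop
  | done {O : Multiset Atom} {BO : Set Eqn} {I : Multiset Atom} {BI : Set Eqn}
      (h : Terminal P (O + I) (BO ∪ BI)) : SplitRun P q O BO I BI [] 0 0
  | outer {O : Multiset Atom} {BO : Set Eqn} {I : Multiset Atom} {BI : Set Eqn}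
      {ch : List (Bool × Set (Port × Port))} {a b : ℕ} (k : Atom) (r : Rule) (ρ : Renaming)
      (hr : r ∈ P) (hB : ¬ Bad (BO ∪ BI)) (hf : Fires r k (BO ∪ BI))
      (hfresh : ∀ x ∈ (r.rename ρ).vars, ¬ Over (k ::ₘ O) BO q x ∧ ¬ Over I BI q x)
      (h : SplitRun P q ((r.kids (permSub ρ) k : Multiset Atom) + O)
        ({e | e ∈ r.told (permSub ρ) k} ∪ BO) I BI ch a b) :
      SplitRun P q (k ::ₘ O) BO I BI (jump true (pat q (BO ∪ BI))
        (pat q ({e | e ∈ r.told (permSub ρ) k} ∪ BO ∪ BI)) ch) (a + 1) b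
  | inner {O : Multiset Atom} {BO : Set Eqn} {I : Multiset Atom} {BI : Set Eqn}
      {ch : List (Bool × Set (Port × Port))} {a b : ℕ} (k : Atom) (r : Rule) (ρ : Renaming)
      (hr : r ∈ P) (hB : ¬ Bad (BO ∪ BI)) (hf : Fires r k (BO ∪ BI))
      (hfresh : ∀ x ∈ (r.rename ρ).vars, ¬ Over (k ::ₘ I) BI q x ∧ ¬ Over O BO q x)
      (h : SplitRun P q O BO ((r.kids (permSub ρ) k : Multiset Atom) + I)
        ({e | e ∈ r.told (permSub ρ) k} ∪ BI) ch a b) :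
      SplitRun P q O BO (k ::ₘ I) BI (jump false (pat q (BO ∪ BI))
        (pat q (BO ∪ ({e | e ∈ r.told (permSub ρ) k} ∪ BI))) ch) a (b + 1)

theorem EntPorts.congr {q : List Term} {C C' : Set Eqn} {f : Var → Term} {N : Set Eqn}
    (h : EntPorts q C f N) (hC : pat q C = pat q C') : EntPorts q C' f N :=
  fun x y s t hs ht hst => h x y s t hs ht ((pat_iff hs ht).1 (hC ▸ (pat_iff hs ht).2 hst))

theorem EntPorts.mono {q : List Term} {C : Set Eqn} {f : Var → Term} {N N' : Set Eqn}
    (h : EntPorts q C f N) (hN : N ⊆ N') : EntPorts q C f N' :=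
  fun x y s t hs ht hst => (h x y s t hs ht hst).mono hN

theorem EntPorts.transfer {q₁ q₂ : List Term} {C₁ C₂ : Set Eqn} {f₁ f₂ : Var → Term} {N : Set Eqn}
    (h : EntPorts q₁ C₁ f₁ N) (hq : q₁.map (Term.sub f₁) = q₂.map (Term.sub f₂))
    (hpat : pat q₁ C₁ = pat q₂ C₂) : EntPorts q₂ C₂ f₂ N := by
  have key : ∀ {x t}, tm q₂ x = some t → ∃ s, tm q₁ x = some s ∧ s.sub f₁ = t.sub f₂ :=
    fun {x t} ht => by
      have := congrArg (fun l => tm l x) hq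
      simpa [tm_map, ht] using this
  intro x y t t' ht ht' htt
  obtain ⟨s, hs, hst⟩ := key ht
  obtain ⟨s', hs', hst'⟩ := key ht'
  rw [← hst, ← hst']
  exact h x y s s' hs hs' ((pat_iff hs hs').1 (hpat ▸ (pat_iff ht ht').2 htt))

theorem map_ports_congr {X : Multiset Atom} {BX : Set Eqn} {q : List Term} {f f' : Var → Term}
    (h : ∀ x, Over X BX q x → f' x = f x) : q.map (Term.sub f) = q.map (Term.sub f') :=
  List.map_congr_left fun t ht => Term.sub_congr fun x hx => (h x (.inr (.inr ⟨t, ht, hx⟩))).symm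

/-- Two split derivations with the same history at their ports: the outer side of the first can be
executed together with the inner side of the second. Steps which do not change the equations
between ports are executed, or skipped, one at a time; where these equations grow, both derivations
advance, and the side which has caused the growth is the same in both, so that exactly one of
the two steps is executed. -/
theorem SplitRun.graft {P : Program} {M : ℕ} (hM : ∀ r ∈ P, ∀ x ∈ r.vars, x < M)
    {q₁ q₂ : List Term} : ∀ (d : ℕ) {O₁ I₁ O₂ I₂ : Multiset Atom} {BO₁ BI₁ BO₂ BI₂ : Set Eqn}
    {ch₁ ch₂ : List (Bool × Set (Port × Port))} {a₁ b₁ a₂ b₂ : ℕ} {f₁ f₂ : Var → Term}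
    {A : List Atom} {B : List Eqn} {n : ℕ}, a₁ + b₁ + (a₂ + b₂) = d →
    SplitRun P q₁ O₁ BO₁ I₁ BI₁ ch₁ a₁ b₁ → SplitRun P q₂ O₂ BO₂ I₂ BI₂ ch₂ a₂ b₂ →
    ch₁ = ch₂ → Separated O₁ BO₁ I₁ BI₁ q₁ → Separated O₂ BO₂ I₂ BI₂ q₂ →
    pat q₁ (BO₁ ∪ BI₁) = pat q₂ (BO₂ ∪ BI₂) → Joint O₁ BO₁ q₁ f₁ I₂ BI₂ q₂ f₂ A B n →
    q₁.map (Term.sub f₁) = q₂.map (Term.sub f₂) → EntPorts q₁ (BO₁ ∪ BI₁) f₁ {e | e ∈ B} →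
    CanTerm P M (a₁ + b₂) A B n := by
  intro d
  induction d using Nat.strong_induction_on with
  | _ d ih =>
  intro O₁ I₁ O₂ I₂ BO₁ BI₁ BO₂ BI₂ ch₁ ch₂ a₁ b₁ a₂ b₂ f₁ f₂ A B n hd h₁ h₂ hch hs₁ hs₂ hpat
    hJ hq hE
  -- The second derivation skips an outer step that leaves the equations between ports unchanged.
  have skip₂ : ∀ {O : Multiset Atom} {ch : List (Bool × Set (Port × Port))} {a : ℕ} (k : Atom)
      (r : Rule) (ρ : Renaming), O₂ = k ::ₘ O → a₂ = a + 1 →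
      (∀ x ∈ (r.rename ρ).vars, ¬ Over (k ::ₘ O) BO₂ q₂ x ∧ ¬ Over I₂ BI₂ q₂ x) →
      SplitRun P q₂ ((r.kids (permSub ρ) k : Multiset Atom) + O)
        ({e | e ∈ r.told (permSub ρ) k} ∪ BO₂) I₂ BI₂ ch a b₂ → ch₁ = ch →
      pat q₂ (BO₂ ∪ BI₂) = pat q₂ ({e | e ∈ r.told (permSub ρ) k} ∪ BO₂ ∪ BI₂) →
      CanTerm P M (a₁ + b₂) A B n := by
    rintro O ch a k r ρ rfl rfl hfresh h hch he
    exact ih _ (by omega) rfl h₁ h hch hs₁ (hs₂.apply fun x hx => (hfresh x hx).2)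
      (hpat.trans he) hJ hq hE
  -- The second derivation executes an inner step.
  have exec₂ : ∀ {I : Multiset Atom} {b : ℕ} (k : Atom) (r : Rule) (ρ : Renaming),
      I₂ = k ::ₘ I → r ∈ P → Fires r k (BO₂ ∪ BI₂) →
      (∀ x ∈ (r.rename ρ).vars, ¬ Over (k ::ₘ I) BI₂ q₂ x ∧ ¬ Over O₂ BO₂ q₂ x) →
      (∀ (f₂' : Var → Term) (A' : List Atom) (B' : List Eqn), {e | e ∈ B} ⊆ {e | e ∈ B'} →
        Separated O₂ BO₂ ((r.kids (permSub ρ) k : Multiset Atom) + I)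
          ({e | e ∈ r.told (permSub ρ) k} ∪ BI₂) q₂ →
        Joint O₁ BO₁ q₁ f₁ ((r.kids (permSub ρ) k : Multiset Atom) + I)
          ({e | e ∈ r.told (permSub ρ) k} ∪ BI₂) q₂ f₂' A' B' (n + M) →
        q₁.map (Term.sub f₁) = q₂.map (Term.sub f₂') →
        EntPorts q₂ (BO₂ ∪ ({e | e ∈ r.told (permSub ρ) k} ∪ BI₂)) f₂' {e | e ∈ B'} →
        CanTerm P M (a₁ + b) A' B' (n + M)) → CanTerm P M (a₁ + (b + 1)) A B n := by
    rintro I b k r ρ rfl hr hf hfresh hnext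
    have hE₂ : EntPorts q₂ (BI₂ ∪ BO₂) f₂ {e | e ∈ B} :=
      Set.union_comm BO₂ BI₂ ▸ hE.transfer hq hpat
    obtain ⟨f₂', A', B', hf', hB', hJ', hs', hE', hstep⟩ := hJ.swap.step hs₂.symm hE₂ hr (hM r hr)
      (Set.union_comm BO₂ BI₂ ▸ hf) hfresh
    rw [Set.union_comm] at hE'
    exact hstep _ (hnext f₂' A' B' hB' hs'.symm hJ'.swap (hq.trans (map_ports_congr hf')) hE')
  cases h₁ with
  | done ht₁ =>
    cases h₂ with
    | done ht₂ =>
      refine .done ?_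
      by_cases hbad : Bad {e | e ∈ B}
      · exact .inl hbad
      have hC₁ : ¬ Bad (BO₁ ∪ BI₁) := fun h => hbad (bad_iff_ent.2
        (hE (.inr 0) (.inr 1) _ _ rfl rfl (bad_iff_ent.1 h)))
      have hC₂ : ¬ Bad (BO₂ ∪ BI₂) := fun h => hC₁ (bad_iff_pat.2 (hpat ▸ bad_iff_pat.1 h))
      refine .inr fun k hk r hr => ?_
      rw [hJ.atoms] at hk
      obtain hk | hk := Multiset.mem_add.1 hk
      · obtain ⟨k', hk', rfl⟩ := Multiset.mem_map.1 hk
        exact hJ.not_fires Set.subset_union_left Set.subset_union_right hC₁ hC₂ hpat hbad hk'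
          (ht₁.resolve_left hC₁ k' (Multiset.mem_add.2 (.inl hk')) r hr)
      · obtain ⟨k', hk', rfl⟩ := Multiset.mem_map.1 hk
        exact hJ.swap.not_fires Set.subset_union_right Set.subset_union_left hC₂ hC₁ hpat.symm
          hbad hk' (ht₂.resolve_left hC₂ k' (Multiset.mem_add.2 (.inr hk')) r hr)
    | outer k r ρ hr hB hf hfresh h =>
      unfold jump at hch
      split_ifs at hch with he
      exact skip₂ k r ρ rfl rfl hfresh h hch he
    | inner k r ρ hr hB hf hfresh h =>
      unfold jump at hch
      split_ifs at hch with he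
      refine exec₂ k r ρ rfl hr hf hfresh fun f₂' A' B' hB' hs' hJ' hq' hE' => ?_
      exact ih _ (by omega) rfl (.done ht₁) h hch hs₁ hs' (hpat.trans he) hJ' hq' (hE.mono hB')
  | @outer O₁ _ _ _ ch₁ a₁ _ k₁ r₁ ρ₁ hr₁ hB₁ hf₁ hfresh₁ h₁' =>
    have exec₁ : ∀ {b₂ : ℕ}, (∀ (f₁' : Var → Term) (A' : List Atom) (B' : List Eqn),
        Separated ((r₁.kids (permSub ρ₁) k₁ : Multiset Atom) + O₁)
          ({e | e ∈ r₁.told (permSub ρ₁) k₁} ∪ BO₁) I₁ BI₁ q₁ →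
        Joint ((r₁.kids (permSub ρ₁) k₁ : Multiset Atom) + O₁)
          ({e | e ∈ r₁.told (permSub ρ₁) k₁} ∪ BO₁) q₁ f₁' I₂ BI₂ q₂ f₂ A' B' (n + M) →
        q₁.map (Term.sub f₁') = q₂.map (Term.sub f₂) →
        EntPorts q₁ ({e | e ∈ r₁.told (permSub ρ₁) k₁} ∪ BO₁ ∪ BI₁) f₁' {e | e ∈ B'} →
        CanTerm P M (a₁ + b₂) A' B' (n + M)) → CanTerm P M (a₁ + 1 + b₂) A B n := by
      intro b₂ hnext
      obtain ⟨f₁', A', B', hf', hB', hJ', hs', hE', hstep⟩ :=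
        hJ.step hs₁ hE hr₁ (hM r₁ hr₁) hf₁ hfresh₁
      rw [Nat.add_right_comm]
      exact hstep _ (hnext f₁' A' B' hs' hJ' ((map_ports_congr hf').symm.trans hq) hE')
    have h₁ := SplitRun.outer k₁ r₁ ρ₁ hr₁ hB₁ hf₁ hfresh₁ h₁'
    by_cases he₁ : pat q₁ (BO₁ ∪ BI₁) =
        pat q₁ ({e | e ∈ r₁.told (permSub ρ₁) k₁} ∪ BO₁ ∪ BI₁)
    · rw [jump, if_pos he₁] at hch
      refine exec₁ fun f₁' A' B' hs' hJ' hq' hE' => ?_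
      exact ih _ (by omega) rfl h₁' h₂ hch hs' hs₂ (he₁.symm.trans hpat) hJ' hq' hE'
    cases h₂ with
    | done ht₂ => rw [jump, if_neg he₁] at hch; cases hch
    | outer k r ρ hr hB hf hfresh h =>
      by_cases he : pat q₂ (BO₂ ∪ BI₂) = pat q₂ ({e | e ∈ r.told (permSub ρ) k} ∪ BO₂ ∪ BI₂)
      · exact skip₂ k r ρ rfl rfl hfresh h (hch.trans (if_pos he)) he
      · rw [jump, if_neg he₁, jump, if_neg he, List.cons.injEq, Prod.mk.injEq] at hch
        refine exec₁ fun f₁' A' B' hs' hJ' hq' hE' => ?_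
        exact ih _ (by omega) rfl h₁' h hch.2 hs' (hs₂.apply fun x hx => (hfresh x hx).2)
          hch.1.2 hJ' hq' hE'
    | inner k r ρ hr hB hf hfresh h =>
      by_cases he : pat q₂ (BO₂ ∪ BI₂) = pat q₂ (BO₂ ∪ ({e | e ∈ r.told (permSub ρ) k} ∪ BI₂))
      · refine exec₂ k r ρ rfl hr hf hfresh fun f₂' A' B' hB' hs' hJ' hq' hE' => ?_
        exact ih _ (by omega) rfl h₁ h (hch.trans (if_pos he)) hs₁ hs' (hpat.trans he) hJ' hq'
          (hE.mono hB')
      · rw [jump, if_neg he₁, jump, if_neg he, List.cons.injEq, Prod.mk.injEq] at hch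
        cases hch.1.1
  | @inner _ _ I₁ _ ch₁ _ b₁ k₁ r₁ ρ₁ hr₁ hB₁ hf₁ hfresh₁ h₁' =>
    have h₁ := SplitRun.inner k₁ r₁ ρ₁ hr₁ hB₁ hf₁ hfresh₁ h₁'
    have hs₁' := (hs₁.symm.apply fun x hx => (hfresh₁ x hx).2).symm
    by_cases he₁ : pat q₁ (BO₁ ∪ BI₁) =
        pat q₁ (BO₁ ∪ ({e | e ∈ r₁.told (permSub ρ₁) k₁} ∪ BI₁))
    · rw [jump, if_pos he₁] at hch
      exact ih _ (by omega) rfl h₁' h₂ hch hs₁' hs₂ (he₁.symm.trans hpat) hJ hq (hE.congr he₁)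
    cases h₂ with
    | done ht₂ => rw [jump, if_neg he₁] at hch; cases hch
    | outer k r ρ hr hB hf hfresh h =>
      by_cases he : pat q₂ (BO₂ ∪ BI₂) = pat q₂ ({e | e ∈ r.told (permSub ρ) k} ∪ BO₂ ∪ BI₂)
      · exact skip₂ k r ρ rfl rfl hfresh h (hch.trans (if_pos he)) he
      · rw [jump, if_neg he₁, jump, if_neg he, List.cons.injEq, Prod.mk.injEq] at hch
        cases hch.1.1
    | inner k r ρ hr hB hf hfresh h =>
      by_cases he : pat q₂ (BO₂ ∪ BI₂) = pat q₂ (BO₂ ∪ ({e | e ∈ r.told (permSub ρ) k} ∪ BI₂))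
      · refine exec₂ k r ρ rfl hr hf hfresh fun f₂' A' B' hB' hs' hJ' hq' hE' => ?_
        exact ih _ (by omega) rfl h₁ h (hch.trans (if_pos he)) hs₁ hs' (hpat.trans he) hJ' hq'
          (hE.mono hB')
      · rw [jump, if_neg he₁, jump, if_neg he, List.cons.injEq, Prod.mk.injEq] at hch
        refine exec₂ k r ρ rfl hr hf hfresh fun f₂' A' B' hB' hs' hJ' hq' hE' => ?_
        exact ih _ (by omega) rfl h₁' h hch.2 hs₁' hs' hch.1.2 hJ' hq'
          (hE'.transfer hq'.symm hch.1.2.symm)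

/-- The CHR constraints of a goal, as the start of an eager derivation. -/
def initAtoms (G : Goal) : List Atom := G.filterMap Constraint.toAtom?

/-- The equations of a goal, as the start of an eager derivation. -/
def initEqns (G : Goal) : List Eqn := G.filterMap Constraint.toEqn?

theorem mem_initEqns {G : Goal} {e : Eqn} : e ∈ initEqns G ↔ .builtin e ∈ G := by
  simp [initEqns, Constraint.toEqn?_eq_some]

theorem mem_initAtoms {G : Goal} {k : Atom} : k ∈ initAtoms G ↔ .chr k ∈ G := by
  simp [initAtoms, Constraint.toAtom?_eq_some]

theorem Config.atoms_initial (G : Goal) : (Config.initial G).atoms = initAtoms G := by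
  simp [Config.atoms, Config.initial, initAtoms]

theorem Config.eqs_initial (G : Goal) : (Config.initial G).eqs = {e | e ∈ initEqns G} := by
  ext e
  rw [Set.mem_ofPred_eq, mem_initEqns]
  simp [Config.eqs, Config.initial]

/-- The state with constraints `A` and equations `C` is reached from `G` by `m` applications:
a state that is a copy of it can be reached by `m` steps of the eager semantics. -/
def Reached (P : Program) (M : ℕ) (G : Goal) (A : Multiset Atom) (C : Set Eqn) (m : ℕ) : Prop :=
  ∀ t, (∀ f A' B' n, Joint A C [] f 0 ∅ [] .var A' B' n → CanTerm P M t A' B' n) →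
    CanTerm P M (m + t) (initAtoms G) (initEqns G) M

theorem not_over_zero {x : Var} : ¬ Over 0 ∅ [] x := by
  simp [Over]

theorem Term.sub_var_eq (t : Term) : t.sub .var = t := by
  cases t <;> rfl

theorem Atom.sub_var_eq (k : Atom) : k.sub .var = k := by
  have h : Term.sub .var = id := funext Term.sub_var_eq
  simp [Atom.sub, h]

theorem Eqn.sub_var_eq (e : Eqn) : e.sub .var = e := by
  simp [Eqn.sub, Term.sub_var_eq]

theorem Reached.initial {P : Program} {M : ℕ} {G : Goal} (hM : ∀ c ∈ G, ∀ x ∈ c.vars, x < M) :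
    Reached P M G (Config.initial G).atoms (Config.initial G).eqs 0 := by
  intro t h
  rw [Nat.zero_add]
  rw [Config.atoms_initial, Config.eqs_initial] at h
  refine h .var _ _ _ ⟨?_, ?_, ?_, fun x hx => absurd hx not_over_zero, ?_, ?_, ?_⟩
  · rw [show Atom.sub .var = id from funext Atom.sub_var_eq]
    simp
  · rw [show Eqn.sub .var = id from funext Eqn.sub_var_eq]
    simp
  · rintro x (⟨k, hk, hx⟩ | ⟨e, he, hx⟩ | ⟨t, ht, hx⟩) y hy
    · obtain rfl := List.mem_singleton.1 hy
      exact hM _ (mem_initAtoms.1 (Multiset.mem_coe.1 hk)) y hx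
    · obtain rfl := List.mem_singleton.1 hy
      exact hM _ (mem_initEqns.1 he) y hx
    · cases ht
  · intro s t _ _ hst
    rwa [Term.sub_var_eq, Term.sub_var_eq] at hst
  · intro s t _ _ hst
    rwa [Term.sub_var_eq, Term.sub_var_eq] at hst
  · rintro s (x | c) hs ht hst
    · exact absurd (overTerm_var.1 ht) not_over_zero
    · rw [Term.sub_var_eq, Term.sub_var_eq] at hst
      exact ⟨.inr c, congrArg some hst.symm, rfl⟩

theorem Joint.entPorts {X₁ X₂ : Multiset Atom} {B₁ : Set Eqn} {q q₁ q₂ : List Term}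
    {f₁ f₂ : Var → Term} {A : List Atom} {B : List Eqn} {n : ℕ}
    (h : Joint X₁ B₁ q₁ f₁ X₂ ∅ q₂ f₂ A B n) : EntPorts q (B₁ ∪ ∅) f₁ {e | e ∈ B} := by
  intro x y s t hs ht hst
  rw [Set.union_empty] at hst
  have hB : ∀ e ∈ B₁, e.sub f₁ ∈ {e | e ∈ B} := fun e he => by
    rw [h.eqs]
    exact .inl ⟨e, he, rfl⟩
  obtain hst | ⟨c, d, hcd, hst⟩ := hst
  · exact .inl (hst.sub hB)
  · exact .inr ⟨c, d, hcd, hst.sub hB⟩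

theorem Reached.apply {P : Program} {M : ℕ} {G : Goal} {A : Multiset Atom} {C : Set Eqn} {m : ℕ}
    {k : Atom} {r : Rule} {ρ : Renaming} (h : Reached P M G (k ::ₘ A) C m)
    (hr : r ∈ P) (hM : ∀ x ∈ r.vars, x < M) (hf : Fires r k C)
    (hfresh : ∀ x ∈ (r.rename ρ).vars, ¬ Over (k ::ₘ A) C [] x) :
    Reached P M G ((r.kids (permSub ρ) k : Multiset Atom) + A)
      ({e | e ∈ r.told (permSub ρ) k} ∪ C) (m + 1) := by
  intro t ht
  rw [add_assoc, add_comm 1 t]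
  refine h (t + 1) fun f A' B' n hJ => ?_
  obtain ⟨f', A'', B'', -, -, hJ', -, -, hstep⟩ := hJ.step (Y₁ := 0) (C₁ := ∅)
    (fun x _ hx => absurd hx not_over_zero) hJ.entPorts hr hM (by rwa [Set.union_empty])
    (fun x hx => ⟨hfresh x hx, not_over_zero⟩)
  exact hstep t (ht f' A'' B'' _ hJ')

theorem not_bad_empty : ¬ Bad ∅ := by
  rintro ⟨c, d, hcd, h⟩
  exact hcd (Term.const.inj (rel_empty.1 h))

/-- The pattern for the empty set of equations expresses equality of terms. -/
theorem mem_pat_empty {q : List Term} {x y : Port} {s t : Term} (hs : tm q x = some s)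
    (ht : tm q y = some t) : (x, y) ∈ pat q ∅ ↔ s = t := by
  rw [pat_iff hs ht, ← rel_empty]
  exact ⟨fun h => h.rel not_bad_empty, .inl⟩

/-- In a copy of a state with a constraint `k₁`, this constraint can be taken for a copy of `k₂`, if
the same members of the two lists of arguments are equal to one another or to constants. -/
theorem Joint.rebase {X : Multiset Atom} {C : Set Eqn} {k₁ k₂ : Atom} {f : Var → Term}
    {A : List Atom} {B : List Eqn} {n : ℕ} (h : Joint (k₁ ::ₘ X) C [] f 0 ∅ [] .var A B n)
    (hpred : k₁.pred = k₂.pred) (hlen : k₁.args.length = k₂.args.length)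
    (hpat : pat k₁.args ∅ = pat k₂.args ∅) :
    ∃ f₂, Joint X C k₁.args f {k₂} ∅ k₂.args f₂ A B n ∧
      k₁.args.map (Term.sub f) = k₂.args.map (Term.sub f₂) := by
  classical
  have hport : ∀ {x t}, tm k₂.args x = some t → ∃ s, tm k₁.args x = some s := by
    rintro (i | c) t ht
    · have : i < k₁.args.length := hlen ▸ (List.getElem?_eq_some_iff.1 ht).1
      exact ⟨_, List.getElem?_eq_getElem this⟩
    · exact ⟨_, rfl⟩
  have hsyn : ∀ {x y s s' t t'}, tm k₁.args x = some s → tm k₁.args y = some s' →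
      tm k₂.args x = some t → tm k₂.args y = some t' → (s = s' ↔ t = t') := fun hx hy hx' hy' => by
    rw [← mem_pat_empty hx hy, hpat, mem_pat_empty hx' hy']
  let f₂ (y : Var) : Term :=
    if h : ∃ x s, tm k₂.args x = some (.var y) ∧ tm k₁.args x = some s then h.choose_spec.choose.sub f
    else .const 0
  have hf₂ : ∀ {x s t}, tm k₁.args x = some s → tm k₂.args x = some t → t.sub f₂ = s.sub f := by
    rintro x s (y | c) hs ht
    · have hex : ∃ x s, tm k₂.args x = some (.var y) ∧ tm k₁.args x = some s := ⟨x, s, ht, hs⟩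
      have hspec := hex.choose_spec.choose_spec
      simp only [Term.sub_var, f₂, dif_pos hex]
      rw [(hsyn hs hspec.2 ht hspec.1).2 rfl]
    · rw [(hsyn (y := .inr c) hs rfl ht rfl).2 rfl]
      rfl
  have hover₁ : ∀ {s}, OverTerm X C k₁.args s → OverTerm (k₁ ::ₘ X) C [] s := fun hs x hx => by
    obtain ⟨k, hk, hx⟩ | hx | ⟨t, ht, hx⟩ := hs x hx
    · exact .inl ⟨k, Multiset.mem_cons_of_mem hk, hx⟩
    · exact .inr (.inl hx)
    · exact .inl ⟨k₁, Multiset.mem_cons_self _ _, List.mem_flatMap.2 ⟨t, ht, hx⟩⟩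
  have hover₂ : ∀ {t}, OverTerm {k₂} ∅ k₂.args t → ∃ x, tm k₂.args x = some t := by
    rintro (y | c) ht
    · have hy : ∃ t ∈ k₂.args, y ∈ t.vars := by
        obtain ⟨k, hk, hx⟩ | ⟨e, he, -⟩ | hx := overTerm_var.1 ht
        · obtain rfl := Multiset.mem_singleton.1 hk
          exact List.mem_flatMap.1 hx
        · exact he.elim
        · exact hx
      obtain ⟨t, ht, hy⟩ := hy
      obtain ⟨i, hi⟩ := List.mem_iff_getElem?.1 ht
      cases t with
      | const c => simp [Term.vars] at hy
      | var w => exact ⟨.inl i, by rw [List.mem_singleton.1 hy]; exact hi⟩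
    · exact ⟨.inr c, rfl⟩
  have hmap : k₁.args.map (Term.sub f) = k₂.args.map (Term.sub f₂) := by
    refine List.ext_getElem? fun i => ?_
    have hx : tm (k₁.args.map (Term.sub f)) (.inl i) = tm (k₂.args.map (Term.sub f₂)) (.inl i) := by
      rw [tm_map, tm_map]
      cases ht : tm k₂.args (.inl i) with
      | none =>
        have : k₁.args.length ≤ i := hlen ▸ List.getElem?_eq_none_iff.1 ht
        rw [show tm k₁.args (.inl i) = none from List.getElem?_eq_none_iff.2 this]
        rfl
      | some t =>
        obtain ⟨s, hs⟩ := hport ht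
        rw [hs, Option.map_some, Option.map_some, hf₂ hs ht]
    exact hx
  refine ⟨f₂, ⟨?_, ?_, ?_, ?_, ?_, ?_, ?_⟩, hmap⟩
  · have hk : k₁.sub f = k₂.sub f₂ := by
      unfold Atom.sub
      rw [hpred, hmap]
    rw [h.atoms, Multiset.map_singleton, ← hk, Multiset.map_zero, add_zero, Multiset.map_cons,
      ← Multiset.singleton_add, add_comm]
  · rw [h.eqs]
    simp
  · intro x hx y hy
    exact h.lt₁ x (overTerm_var.1 (hover₁ (overTerm_var.2 hx))) y hy
  · intro x hx y hy
    obtain ⟨p, hp⟩ := hover₂ (overTerm_var.2 hx)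
    obtain ⟨s, hs⟩ := hport hp
    have he : f₂ x = s.sub f := hf₂ hs hp
    rw [he] at hy
    obtain ⟨z, hz, hy⟩ := Term.mem_vars_sub.1 hy
    exact h.lt₁ z (hover₁ (OverTerm.of_tm hs) z hz) y hy
  · exact fun s t hs ht hst => h.inj₁ s t (hover₁ hs) (hover₁ ht) hst
  · intro s t hs ht hst
    obtain ⟨x, hx⟩ := hover₂ hs
    obtain ⟨y, hy⟩ := hover₂ ht
    obtain ⟨s', hs'⟩ := hport hx
    obtain ⟨t', ht'⟩ := hport hy
    rw [hf₂ hs' hx, hf₂ ht' hy] at hst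
    exact (hsyn hs' ht' hx hy).1 (h.inj₁ _ _ (hover₁ (OverTerm.of_tm hs'))
      (hover₁ (OverTerm.of_tm ht')) hst)
  · intro s t hs ht hst
    obtain ⟨y, hy⟩ := hover₂ ht
    obtain ⟨t', ht'⟩ := hport hy
    rw [hf₂ ht' hy] at hst
    rw [h.inj₁ _ _ (hover₁ hs) (hover₁ (OverTerm.of_tm ht')) hst]
    exact ⟨y, ht', hy⟩

theorem separated_single {X : Multiset Atom} {C : Set Eqn} {k : Atom} :
    Separated X C {k} ∅ k.args := by
  rintro x - (⟨k', hk, hx⟩ | ⟨e, he, -⟩ | hx)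
  · obtain rfl := Multiset.mem_singleton.1 hk
    exact List.mem_flatMap.1 hx
  · exact he.elim
  · exact hx

/-- All constants belong to `U`, and the predicate symbols with their arities to `K`. -/
structure InSig (U : Set Const) (K : Set (ℕ × ℕ)) (A : Multiset Atom) (C : Set Eqn) : Prop where
  sig : ∀ k ∈ A, (k.pred, k.args.length) ∈ K
  atoms : ∀ k ∈ A, ∀ c ∈ k.consts, c ∈ U
  eqs : ∀ e ∈ C, ∀ c ∈ e.consts, c ∈ U

/-- `InSig` for the rules of a program. -/
structure Program.InSig (U : Set Const) (K : Set (ℕ × ℕ)) (P : Program) : Prop where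
  body : ∀ r ∈ P, ∀ h, .chr h ∈ r.body → (h.pred, h.args.length) ∈ K
  consts : ∀ r ∈ P, ∀ c ∈ r.consts, c ∈ U

theorem Atom.mem_consts {k : Atom} {c : Const} : c ∈ k.consts ↔ .const c ∈ k.args := by
  simp only [Atom.consts, List.mem_flatMap]
  constructor
  · rintro ⟨x | d, ht, hc⟩
    · simp [Term.consts] at hc
    · rwa [List.mem_singleton.1 hc]
  · exact fun h => ⟨_, h, by simp [Term.consts]⟩

theorem InSig.apply {U : Set Const} {K : Set (ℕ × ℕ)} {A : Multiset Atom} {C : Set Eqn}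
    {P : Program} {k : Atom} {r : Rule} {ρ : Renaming} (h : InSig U K (k ::ₘ A) C)
    (hP : P.InSig U K) (hr : r ∈ P) :
    InSig U K ((r.kids (permSub ρ) k : Multiset Atom) + A)
      ({e | e ∈ r.told (permSub ρ) k} ∪ C) := by
  have hk := h.atoms k (Multiset.mem_cons_self _ _)
  have hU := hP.consts r hr
  have hbody : ∀ c ∈ r.body, ∀ a ∈ c.consts, a ∈ U := fun c hc a ha =>
    hU a (List.mem_append_right _ (List.mem_flatMap.2 ⟨c, hc, ha⟩))
  refine ⟨fun k' hk' => ?_, fun k' hk' => ?_, ?_⟩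
  · obtain hk' | hk' := Multiset.mem_add.1 hk'
    · obtain ⟨-, rfl⟩ | ⟨h', hh, rfl⟩ := Rule.mem_kids.1 (Multiset.mem_coe.1 hk')
      · exact h.sig _ (Multiset.mem_cons_self _ _)
      · simpa using hP.body r hr h' hh
    · exact h.sig k' (Multiset.mem_cons_of_mem hk')
  · obtain hk' | hk' := Multiset.mem_add.1 hk'
    · obtain ⟨-, rfl⟩ | ⟨h', hh, rfl⟩ := Rule.mem_kids.1 (Multiset.mem_coe.1 hk')
      · exact hk
      · intro c hc
        rw [← Atom.rename_eq_sub, Atom.consts_rename] at hc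
        exact hbody _ hh c hc
    · exact h.atoms k' (Multiset.mem_cons_of_mem hk')
  · rintro e (he | he)
    · obtain he | ⟨e', he', rfl⟩ := Rule.mem_told.1 he
      · obtain ⟨i, hi, hi'⟩ := mem_matching.1 he
        rw [← Atom.rename_eq_sub] at hi'
        intro c hc
        obtain hc | hc := List.mem_append.1 hc
        · exact hk c (List.mem_flatMap.2 ⟨_, List.mem_of_getElem? hi, hc⟩)
        · refine hU c (List.mem_append_left _ (List.mem_append_left _ ?_))
          rw [← Atom.consts_rename ρ]
          exact List.mem_flatMap.2 ⟨_, List.mem_of_getElem? hi', hc⟩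
      · intro c hc
        rw [← Eqn.rename_eq_sub, Eqn.consts_rename] at hc
        exact hbody _ he' c hc
    · exact h.eqs e he

/-- A derivation of `T` steps from `G` that is split when the constraint `k` appears; `E` are the
equations between the arguments of `k` that are entailed at this moment, `ch` is the further
history of these equations, and `b` steps belong to `k` and its descendants. -/
def NodeRun (P : Program) (M : ℕ) (G : Goal) (U : Set Const) (K : Set (ℕ × ℕ)) (T : ℕ) (k : Atom)
    (E : Set (Port × Port)) (ch : List (Bool × Set (Port × Port))) (b : ℕ) : Prop :=
  ∃ (X : Multiset Atom) (C : Set Eqn) (m a : ℕ), Reached P M G (k ::ₘ X) C m ∧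
    SplitRun P k.args X C {k} ∅ ch a b ∧ E = pat k.args (C ∪ ∅) ∧ m + a + b = T ∧
    InSig U K (k ::ₘ X) C

/-- Replacing the part of a derivation that belongs to `k₁` by the part that belongs to `k₂`. -/
theorem NodeRun.canTerm {P : Program} {M : ℕ} {G : Goal} {U : Set Const} {K : Set (ℕ × ℕ)} {T : ℕ}
    {k₁ k₂ : Atom} {E : Set (Port × Port)} {ch : List (Bool × Set (Port × Port))} {b₁ b₂ : ℕ}
    (hM : ∀ r ∈ P, ∀ x ∈ r.vars, x < M)
    (h₁ : NodeRun P M G U K T k₁ E ch b₁) (h₂ : NodeRun P M G U K T k₂ E ch b₂)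
    (hpred : k₁.pred = k₂.pred) (hlen : k₁.args.length = k₂.args.length)
    (hpat : pat k₁.args ∅ = pat k₂.args ∅) (hb : b₂ < b₁) :
    ∃ t < T, CanTerm P M t (initAtoms G) (initEqns G) M := by
  obtain ⟨X₁, C₁, m₁, a₁, hR₁, hS₁, rfl, hT₁, -⟩ := h₁
  obtain ⟨X₂, C₂, m₂, a₂, -, hS₂, hE, hT₂, -⟩ := h₂
  refine ⟨m₁ + (a₁ + b₂), by omega, hR₁ _ fun f A B n hJ => ?_⟩
  obtain ⟨f₂, hJ', hq⟩ := hJ.rebase hpred hlen hpat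
  exact SplitRun.graft hM _ rfl hS₁ hS₂ rfl separated_single separated_single hE hJ' hq hJ'.entPorts

/-! ### Forests -/

/-- The constraint of a label; the value at the box is irrelevant. -/
def Label.atom : Label → Atom
  | .rep k _ _ => k
  | .box => ⟨0, []⟩

/-- The constraint of a label together with its identifier. -/
def Label.key : Label → Atom × Option ℕ
  | .rep k l _ => (k, l)
  | .box => (⟨0, []⟩, none)

def Tree.root : Tree → Label
  | .node a _ => a

def Tree.sons : Tree → List Tree
  | .node _ ss => ss

mutual
/-- The labels of the leaves of a tree, except for boxes: the constraints that are still present. -/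
def Tree.leaves : Tree → Multiset Label
  | .node .box [] => 0
  | .node (.rep k l i) [] => {.rep k l i}
  | .node _ (s :: ss) => s.leaves + leavesList ss

/-- The labels of the leaves of a forest, except for boxes. -/
def leavesList : List Tree → Multiset Label
  | [] => 0
  | t :: ts => t.leaves + leavesList ts
end

mutual
/-- The number of inner nodes of a tree. -/
def Tree.inner : Tree → ℕ
  | .node _ [] => 0
  | .node _ (s :: ss) => s.inner + innerList ss + 1

/-- The number of inner nodes of a forest. -/
def innerList : List Tree → ℕ
  | [] => 0
  | t :: ts => t.inner + innerList ts
end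

theorem leaves_node {a : Label} {ss : List Tree} (h : ss ≠ []) :
    (Tree.node a ss).leaves = leavesList ss := by
  cases ss with
  | nil => exact absurd rfl h
  | cons s ss => simp [Tree.leaves, leavesList]

theorem inner_node {a : Label} {ss : List Tree} (h : ss ≠ []) :
    (Tree.node a ss).inner = innerList ss + 1 := by
  cases ss with
  | nil => exact absurd rfl h
  | cons s ss => simp [Tree.inner, innerList]

theorem leaves_leaf {k : Atom} {l : Option ℕ} {i : ℕ} :
    (Tree.leaf (.rep k l i)).leaves = {.rep k l i} := by
  simp [Tree.leaf, Tree.leaves]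

theorem inner_leaf {a : Label} : (Tree.leaf a).inner = 0 := by
  simp [Tree.leaf, Tree.inner]

theorem leavesList_newLeaves (ks : List Atom) :
    leavesList (newLeaves ks) = ((ks.map fun k => Label.rep k none 0 : List Label) : Multiset Label)
    := by
  induction ks with
  | nil => simp [newLeaves, leavesList]
  | cons k ks ih =>
    rw [newLeaves, List.map_cons, leavesList, leaves_leaf]
    change _ + leavesList (newLeaves ks) = _
    rw [ih]
    simp

theorem innerList_newLeaves (ks : List Atom) : innerList (newLeaves ks) = 0 := by
  induction ks with
  | nil => simp [newLeaves, innerList]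
  | cons k ks ih =>
    rw [newLeaves, List.map_cons, innerList, inner_leaf]
    exact (Nat.zero_add _).trans ih

theorem Replace.ne_nil {t t' : Tree} {F F' : Forest} (h : Replace t t' F F') : F ≠ [] ∧ F' ≠ [] := by
  cases h <;> simp

/-- The effect on the leaves and on the inner nodes of the replacement of a leaf. -/
theorem Replace.leaves {k : Atom} {l : Option ℕ} {i : ℕ} {t' : Tree} {F F' : Forest}
    (h : Replace (.leaf (.rep k l i)) t' F F') :
    ∃ R, leavesList F = .rep k l i ::ₘ R ∧ leavesList F' = t'.leaves + R ∧
      innerList F' = innerList F + t'.inner := by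
  induction h with
  | here ts =>
    refine ⟨leavesList ts, ?_, by simp [leavesList], ?_⟩
    · rw [leavesList, leaves_leaf, Multiset.singleton_add]
    · simp [innerList, inner_leaf, add_comm]
  | next s h ih =>
    obtain ⟨R, h1, h2, h3⟩ := ih
    refine ⟨s.leaves + R, ?_, ?_, ?_⟩
    · rw [leavesList, h1, Multiset.add_cons]
    · rw [leavesList, h2, add_left_comm]
    · rw [innerList, innerList, h3, add_assoc]
  | sons a ts h ih =>
    obtain ⟨R, h1, h2, h3⟩ := ih
    refine ⟨R + leavesList ts, ?_, ?_, ?_⟩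
    · rw [leavesList, leaves_node h.ne_nil.1, h1, Multiset.cons_add]
    · rw [leavesList, leaves_node h.ne_nil.2, h2, add_assoc]
    · rw [innerList, innerList, inner_node h.ne_nil.1, inner_node h.ne_nil.2, h3]
      omega

mutual
theorem exists_replace_tree {k : Atom} {l : Option ℕ} {i : ℕ} (t' : Tree) :
    ∀ t : Tree, .rep k l i ∈ t.leaves → ∀ ts : Forest,
      ∃ F', Replace (.leaf (.rep k l i)) t' (t :: ts) F'
  | .node .box [], h, _ => by simp [Tree.leaves] at h
  | .node (.rep _ _ _) [], h, ts => by
    simp only [Tree.leaves, Multiset.mem_singleton] at h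
    exact ⟨t' :: ts, h ▸ .here ts⟩
  | .node a (s :: ss), h, ts => by
    rw [leaves_node (by simp)] at h
    obtain ⟨F', hF'⟩ := exists_replace t' (s :: ss) h
    exact ⟨_, .sons a ts hF'⟩

/-- Every leaf of a forest that is not a box can be replaced. -/
theorem exists_replace {k : Atom} {l : Option ℕ} {i : ℕ} (t' : Tree) :
    ∀ F : Forest, .rep k l i ∈ leavesList F → ∃ F', Replace (.leaf (.rep k l i)) t' F F'
  | [], h => by simp [leavesList] at h
  | t :: ts, h => by
    rw [leavesList] at h
    by_cases ht : .rep k l i ∈ t.leaves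
    · exact exists_replace_tree t' t ht ts
    · obtain ⟨F', hF'⟩ := exists_replace t' ts ((Multiset.mem_add.1 h).resolve_left ht)
      exact ⟨_, .next t hF'⟩
end

/-- `Sub t F R`: the tree `t` is a subtree of `F`, and `R` are the labels of the leaves of `F`
outside `t`, except for boxes. -/
inductive Sub (t : Tree) : Forest → Multiset Label → Prop
  | here (ts : Forest) : Sub t (t :: ts) (leavesList ts)
  | next (s : Tree) {ts : Forest} {R : Multiset Label} : Sub t ts R → Sub t (s :: ts) (s.leaves + R)
  | sons (a : Label) {ss : List Tree} (ts : Forest) {R : Multiset Label} : Sub t ss R →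
      Sub t (.node a ss :: ts) (R + leavesList ts)

theorem Sub.ne_nil {t : Tree} {F : Forest} {R : Multiset Label} (h : Sub t F R) : F ≠ [] := by
  cases h <;> simp

theorem Sub.leaves {t : Tree} {F : Forest} {R : Multiset Label} (h : Sub t F R) :
    leavesList F = t.leaves + R := by
  induction h with
  | here ts => rfl
  | next s _ ih => rw [leavesList, ih, add_left_comm]
  | sons a ts h ih => rw [leavesList, leaves_node h.ne_nil, ih, add_assoc]

theorem Sub.inner_le {t : Tree} {F : Forest} {R : Multiset Label} (h : Sub t F R) :
    t.inner ≤ innerList F := by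
  induction h with
  | here ts => exact Nat.le_add_right _ _
  | next s _ ih => exact ih.trans (Nat.le_add_left _ _)
  | sons a ts h ih =>
    rw [innerList, inner_node h.ne_nil]
    omega

theorem Sub.son {a : Label} {ss : List Tree} {F : Forest} {R : Multiset Label}
    (h : Sub (.node a ss) F R) {s : Tree} {R' : Multiset Label} (hs : Sub s ss R') :
    ∃ R'', Sub s F R'' := by
  induction h with
  | here ts => exact ⟨_, .sons a ts hs⟩
  | next s _ ih => exact ⟨_, .next s ih.choose_spec⟩
  | sons b ts _ ih => exact ⟨_, .sons b ts ih.choose_spec⟩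

theorem exists_sub_of_mem {t : Tree} {F : Forest} (h : t ∈ F) : ∃ R, Sub t F R := by
  induction F with
  | nil => cases h
  | cons s ts ih =>
    obtain rfl | h := List.mem_cons.1 h
    · exact ⟨_, .here ts⟩
    · exact ⟨_, .next s (ih h).choose_spec⟩

/-- The subtrees of a forest after the replacement of a leaf by `t₀`: those disjoint from the leaf,
those that contained the leaf, and the proper subtrees of `t₀`. -/
theorem Replace.sub_cases {k : Atom} {l : Option ℕ} {i : ℕ} {t₀ : Tree} {F F' : Forest}
    (h : Replace (.leaf (.rep k l i)) t₀ F F') {t' : Tree} {R' : Multiset Label}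
    (hs : Sub t' F' R') :
    (∃ R, Sub t' F (.rep k l i ::ₘ R) ∧ R' = t₀.leaves + R) ∨
    (∃ t, Replace (.leaf (.rep k l i)) t₀ [t] [t'] ∧ Sub t F R') ∨
    ∃ R₁ R, Sub t' t₀.sons R₁ ∧ leavesList F = .rep k l i ::ₘ R ∧ R' = R₁ + R := by
  induction h generalizing t' R' with
  | here ts =>
    have hl : ∀ R, (Tree.leaf (.rep k l i)).leaves + R = .rep k l i ::ₘ R := fun R => by
      rw [leaves_leaf, Multiset.singleton_add]
    cases hs with
    | here => exact .inr (.inl ⟨_, .here [], .here ts⟩)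
    | next _ hs => exact .inl ⟨_, hl _ ▸ .next _ hs, rfl⟩
    | sons a _ hs => exact .inr (.inr ⟨_, _, hs, by rw [leavesList, hl], rfl⟩)
  | next s h ih =>
    cases hs with
    | here =>
      obtain ⟨R, h1, h2, -⟩ := h.leaves
      exact .inl ⟨R, h1 ▸ .here _, h2⟩
    | next _ hs =>
      obtain ⟨R, h1, rfl⟩ | ⟨t, h1, h2⟩ | ⟨R₁, R, h1, h2, rfl⟩ := ih hs
      · refine .inl ⟨s.leaves + R, ?_, add_left_comm _ _ _⟩
        rw [← Multiset.add_cons]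
        exact .next s h1
      · exact .inr (.inl ⟨t, h1, .next s h2⟩)
      · refine .inr (.inr ⟨R₁, s.leaves + R, h1, ?_, add_left_comm _ _ _⟩)
        rw [leavesList, h2, Multiset.add_cons]
    | sons a _ hs =>
      obtain ⟨R, h1, h2, -⟩ := h.leaves
      rw [h2]
      refine .inl ⟨_, ?_, add_left_comm _ _ _⟩
      rw [← Multiset.add_cons, ← h1]
      exact .sons a _ hs
  | sons a ts h ih =>
    cases hs with
    | here => exact .inr (.inl ⟨_, .sons a [] h, .here ts⟩)
    | next _ hs =>
      obtain ⟨R, h1, h2, -⟩ := h.leaves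
      rw [leaves_node h.ne_nil.2, h2]
      refine .inl ⟨_, ?_, add_assoc _ _ _⟩
      rw [← Multiset.cons_add, ← h1, ← leaves_node (a := a) h.ne_nil.1]
      exact .next _ hs
    | sons _ _ hs =>
      obtain ⟨R, h1, rfl⟩ | ⟨t, h1, h2⟩ | ⟨R₁, R, h1, h2, rfl⟩ := ih hs
      · refine .inl ⟨R + leavesList ts, ?_, add_assoc _ _ _⟩
        rw [← Multiset.cons_add]
        exact .sons a ts h1
      · exact .inr (.inl ⟨t, h1, .sons a ts h2⟩)
      · refine .inr (.inr ⟨R₁, R + leavesList ts, h1, ?_, add_assoc _ _ _⟩)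
        rw [leavesList, leaves_node h.ne_nil.1, h2, Multiset.cons_add]

/-- What a replacement inside a single tree does to this tree. -/
theorem Replace.singleton {k : Atom} {l : Option ℕ} {i : ℕ} {t₀ t t' : Tree}
    (h : Replace (.leaf (.rep k l i)) t₀ [t] [t']) :
    (t.root = t'.root ∨ t.root = .rep k l i ∧ t' = t₀) ∧
      ∃ R, t.leaves = .rep k l i ::ₘ R ∧ t'.leaves = t₀.leaves + R ∧
        t'.inner = t.inner + t₀.inner := by
  refine ⟨?_, ?_⟩
  · cases h with
    | here => exact .inr ⟨rfl, rfl⟩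
    | next _ h => exact absurd rfl h.ne_nil.1
    | sons a ts h => exact .inl rfl
  · obtain ⟨R, h1, h2, h3⟩ := h.leaves
    exact ⟨R, by simpa [leavesList] using h1, by simpa [leavesList] using h2,
      by simpa [innerList] using h3⟩

theorem Sub.of_newLeaves {ks : List Atom} {t : Tree} {R : Multiset Label}
    (h : Sub t (newLeaves ks) R) : ∃ k, t = .leaf (.rep k none 0) := by
  induction ks generalizing R with
  | nil => exact absurd rfl h.ne_nil
  | cons k ks ih =>
    rw [newLeaves, List.map_cons] at h
    cases h with
    | here => exact ⟨k, rfl⟩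
    | next _ h => exact ih h
    | sons _ _ h => exact absurd rfl h.ne_nil

/-- A path of a tree is the sequence of the roots of a descending chain of subtrees. -/
theorem Tree.IsPath.exists_subtrees {F : Forest} {t : Tree} {σ : List Label} (h : t.IsPath σ) :
    ∀ {R : Multiset Label}, Sub t F R → ∃ l : List Tree, l.map Tree.root = σ ∧
      l.Pairwise (fun s s' => s'.inner < s.inner) ∧ (∀ s ∈ l, ∃ R, Sub s F R) ∧
      ∀ s ∈ l, s.inner ≤ t.inner := by
  induction h with
  | leaf a =>
    intro R hs
    exact ⟨[.node a []], rfl, List.pairwise_singleton _ _, by simpa using ⟨R, hs⟩, by simp⟩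
  | son a ss s σ hmem _ ih =>
    intro R hs
    obtain ⟨R₁, h₁⟩ := exists_sub_of_mem hmem
    obtain ⟨R₂, h₂⟩ := hs.son h₁
    obtain ⟨l, hl, hp, hsub, hle⟩ := ih h₂
    have hlt : s.inner < (Tree.node a ss).inner := by
      rw [inner_node h₁.ne_nil]
      exact Nat.lt_succ_of_le h₁.inner_le
    refine ⟨.node a ss :: l, by rw [List.map_cons, hl]; rfl, List.pairwise_cons.2
      ⟨fun s' hs' => (hle s' hs').trans_lt hlt, hp⟩, ?_, ?_⟩
    · intro s' hs'
      obtain rfl | hs' := List.mem_cons.1 hs'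
      · exact ⟨R, hs⟩
      · exact hsub s' hs'
    · intro s' hs'
      obtain rfl | hs' := List.mem_cons.1 hs'
      · exact le_rfl
      · exact (hle s' hs').trans hlt.le

/-- The leaves of `F` are the constraints of the configuration, and those without an identifier
have index `0`. -/
def LeavesMatch (F : Forest) (c : Config) : Prop :=
  (leavesList F).map Label.key = (c.goal.filterMap Constraint.toAtom?).map (fun k => (k, none)) +
      c.store.map (fun p => (p.1, some p.2)) ∧
    ∀ k i, .rep k none i ∈ leavesList F → i = 0

theorem LeavesMatch.atoms {F : Forest} {c : Config} (h : LeavesMatch F c) :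
    c.atoms = (leavesList F).map Label.atom := by
  have hkey : Label.atom = Prod.fst ∘ Label.key := by
    funext a
    cases a <;> rfl
  rw [hkey, ← Multiset.map_map, h.1, Multiset.map_add, Multiset.map_map, Multiset.map_map,
    Config.atoms]
  congr 1
  exact (Multiset.map_id _).symm

/-! ### The forest of a computation -/

mutual
theorem box_notMem_leaves : ∀ t : Tree, Label.box ∉ t.leaves
  | .node .box [] => by simp [Tree.leaves]
  | .node (.rep _ _ _) [] => by simp [Tree.leaves]
  | .node a (s :: ss) => by
    rw [leaves_node (by simp)]
    exact box_notMem_leavesList (s :: ss)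

theorem box_notMem_leavesList : ∀ F : Forest, Label.box ∉ leavesList F
  | [] => by simp [leavesList]
  | t :: ts => by
    rw [leavesList, Multiset.mem_add]
    exact not_or.2 ⟨box_notMem_leaves t, box_notMem_leavesList ts⟩
end

theorem exists_rep_of_key {F : Forest} {k : Atom} {l : Option ℕ}
    (h : (k, l) ∈ (leavesList F).map Label.key) : ∃ i, .rep k l i ∈ leavesList F := by
  obtain ⟨a, ha, hk⟩ := Multiset.mem_map.1 h
  cases a with
  | box => exact absurd ha (box_notMem_leavesList F)
  | rep k' l' i =>
    simp only [Label.key, Prod.mk.injEq] at hk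
    obtain ⟨rfl, rfl⟩ := hk
    exact ⟨i, ha⟩

/-- An application replaces a leaf `k#l^i` by a tree of height one. -/
theorem Grow.exists_replace {p : Bool} {k : Atom} {l : ℕ} {ks : List Atom} {F F' : Forest}
    (h : Grow (.apply p k l ks) F F') : ∃ (i : ℕ) (t₀ : Tree),
      Replace (.leaf (.rep k (some l) i)) t₀ F F' ∧ t₀.root = .rep k (some l) i ∧
      t₀.leaves.map Label.key =
        ((if p then [(k, some l)] else []) ++ ks.map fun k => (k, none) : List (Atom × Option ℕ)) ∧
      (∀ k' j, .rep k' none j ∈ t₀.leaves → j = 0) ∧ t₀.inner = 1 ∧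
      (∀ t R, Sub t t₀.sons R → ∃ a, t = .leaf a) ∧ t₀.sons.length ≤ ks.length + 1 := by
  have hnew : ∀ ks : List Atom, (leavesList (newLeaves ks)).map Label.key =
      ((ks.map fun k => (k, none) : List (Atom × Option ℕ)) : Multiset (Atom × Option ℕ)) :=
    fun ks => by
      rw [leavesList_newLeaves, Multiset.map_coe, List.map_map]
      rfl
  have hzero : ∀ (ks : List Atom) k' j, .rep k' none j ∈ leavesList (newLeaves ks) → j = 0 :=
    fun ks k' j hj => by
      rw [leavesList_newLeaves, Multiset.mem_coe] at hj
      obtain ⟨_, -, he⟩ := List.mem_map.1 hj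
      injection he with _ _ he
      exact he.symm
  cases h with
  | propagate _ _ i _ _ _ h =>
    refine ⟨i, _, h, rfl, ?_, ?_, ?_, ?_, by simp [Tree.sons, newLeaves]⟩
    · rw [leaves_node (by simp), leavesList, leaves_leaf, Multiset.map_add, hnew]
      rfl
    · intro k' j hj
      rw [leaves_node (by simp), leavesList, leaves_leaf] at hj
      obtain hj | hj := Multiset.mem_add.1 hj
      · simp at hj
      · exact hzero _ _ _ hj
    · rw [inner_node (by simp), innerList, inner_leaf, innerList_newLeaves]
    · intro t R hs
      cases hs with
      | here => exact ⟨_, rfl⟩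
      | next _ hs => exact ⟨_, hs.of_newLeaves.choose_spec⟩
      | sons _ _ hs => exact absurd rfl hs.ne_nil
  | simplify _ _ i _ _ _ hks h =>
    have hne : newLeaves ks ≠ [] := by simpa [newLeaves] using hks
    refine ⟨i, _, h, rfl, ?_, ?_, ?_, ?_, by simp [Tree.sons, newLeaves]⟩
    · rw [leaves_node hne, hnew]
      rfl
    · intro k' j hj
      rw [leaves_node hne] at hj
      exact hzero _ _ _ hj
    · rw [inner_node hne, innerList_newLeaves]
    · exact fun t R hs => ⟨_, hs.of_newLeaves.choose_spec⟩
  | erase _ _ i _ _ h =>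
    refine ⟨i, _, h, rfl, ?_, ?_, ?_, ?_, by simp [Tree.sons]⟩
    · simp [Tree.leaf, Tree.leaves, leavesList]
    · simp [Tree.leaf, Tree.leaves, leavesList]
    · simp [Tree.leaf, Tree.inner, innerList]
    · intro t R hs
      cases hs with
      | here => exact ⟨_, rfl⟩
      | next _ hs => exact absurd rfl hs.ne_nil
      | sons _ _ hs => exact absurd rfl hs.ne_nil

theorem leavesMatch_initial (G : Goal) :
    LeavesMatch (newLeaves (G.filterMap Constraint.toAtom?)) (Config.initial G) := by
  refine ⟨?_, fun k i hi => ?_⟩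
  · rw [leavesList_newLeaves, Multiset.map_coe, List.map_map]
    simp only [Config.initial, Multiset.filterMap_coe, Multiset.map_coe, Multiset.map_zero, add_zero]
    rfl
  · rw [leavesList_newLeaves, Multiset.mem_coe] at hi
    obtain ⟨_, -, he⟩ := List.mem_map.1 hi
    injection he with _ _ he
    exact he.symm

theorem LeavesMatch.introduce {k : Atom} {G : Multiset Constraint} {S : Multiset (Atom × ℕ)}
    {B : List Eqn} {n : ℕ} {F F' : Forest} (h : LeavesMatch F ⟨.chr k ::ₘ G, S, B, n⟩)
    (hR : Replace (.leaf (.rep k none 0)) (.leaf (.rep k (some n) 0)) F F') :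
    LeavesMatch F' ⟨G, (k, n) ::ₘ S, B, n + 1⟩ := by
  obtain ⟨R, h1, h2, -⟩ := hR.leaves
  obtain ⟨hkey, hzero⟩ := h
  rw [h1] at hkey hzero
  rw [leaves_leaf] at h2
  refine ⟨?_, fun k' i hi => hzero k' i ?_⟩
  · rw [Multiset.map_cons, Multiset.filterMap_cons] at hkey
    change (k, none) ::ₘ _ = Multiset.map _ ({k} + _) + _ at hkey
    rw [Multiset.singleton_add, Multiset.map_cons, Multiset.cons_add, Multiset.cons_inj_right]
      at hkey
    rw [h2, Multiset.map_add, hkey, Multiset.map_cons, Multiset.map_singleton,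
      Multiset.singleton_add, Multiset.add_cons]
    rfl
  · rw [h2] at hi
    obtain hi | hi := Multiset.mem_add.1 hi
    · simp at hi
    · exact Multiset.mem_cons_of_mem hi

theorem LeavesMatch.apply {r : Rule} {ρ : Renaming} {k : Atom} {l i : ℕ} {G : Multiset Constraint}
    {S : Multiset (Atom × ℕ)} {B B' : List Eqn} {n : ℕ} {t₀ : Tree} {F F' : Forest}
    (h : LeavesMatch F ⟨G, (k, l) ::ₘ S, B, n⟩)
    (hR : Replace (.leaf (.rep k (some l) i)) t₀ F F')
    (ht₀ : t₀.leaves.map Label.key = ((if r.propagation then [(k, some l)] else []) ++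
      ((r.rename ρ).body.filterMap Constraint.toAtom?).map fun k => (k, none) :
        List (Atom × Option ℕ)))
    (hzero₀ : ∀ k' j, .rep k' none j ∈ t₀.leaves → j = 0) :
    LeavesMatch F' ⟨((r.rename ρ).body : Multiset Constraint) + G,
      if r.propagation then (k, l) ::ₘ S else S, B', n⟩ := by
  obtain ⟨R, h1, h2, -⟩ := hR.leaves
  obtain ⟨hkey, hzero⟩ := h
  rw [h1] at hkey hzero
  refine ⟨?_, fun k' j hj => ?_⟩
  · rw [Multiset.map_cons, Multiset.map_cons, Multiset.add_cons] at hkey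
    change (k, some l) ::ₘ _ = (k, some l) ::ₘ _ at hkey
    rw [Multiset.cons_inj_right] at hkey
    rw [h2, Multiset.map_add, hkey, ht₀]
    simp only [Multiset.filterMap_add, Multiset.filterMap_coe, Multiset.map_add, Multiset.map_coe,
      ← Multiset.coe_add]
    split
    · rw [Multiset.map_cons, Multiset.coe_singleton, Multiset.singleton_add, Multiset.cons_add,
        Multiset.add_cons, add_assoc]
    · simp [add_assoc]
  · rw [h2] at hj
    obtain hj | hj := Multiset.mem_add.1 hj
    · exact hzero₀ k' j hj
    · exact hzero k' j (Multiset.mem_cons_of_mem hj)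

theorem IsForestOf.leavesMatch {P : Program} {G : Goal} {c : Config} {δ : Computation P G c}
    {F : Forest} (h : IsForestOf δ F) : LeavesMatch F c ∧ innerList F = δ.applies := by
  induction h with
  | start => exact ⟨leavesMatch_initial G, innerList_newLeaves _⟩
  | step δ a c' h F F' _ hg ih =>
    cases h with
    | solve e G' S B n =>
      cases hg
      obtain ⟨⟨h1, h2⟩, h3⟩ := ih
      refine ⟨⟨?_, h2⟩, h3⟩
      rw [h1, Multiset.filterMap_cons_none _ _ rfl]
    | introduce k G' S B n =>
      cases hg with
      | introduce _ _ _ _ hR =>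
        refine ⟨ih.1.introduce hR, ?_⟩
        obtain ⟨-, -, -, h3⟩ := hR.leaves
        rw [h3, ih.2, inner_leaf]
        rfl
    | apply r ρ k l G' S B n =>
      obtain ⟨i, t₀, hR, -, hk, hz, hi, -, -⟩ := hg.exists_replace
      refine ⟨ih.1.apply hR hk hz, ?_⟩
      obtain ⟨-, -, -, h3⟩ := hR.leaves
      rw [h3, ih.2, hi]
      rfl

theorem exists_isForestOf {P : Program} {G : Goal} {c : Config} (δ : Computation P G c) :
    ∃ F, IsForestOf δ F := by
  induction δ with
  | start => exact ⟨_, .start⟩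
  | step δ a c' h ih =>
    obtain ⟨F, hF⟩ := ih
    have hm := hF.leavesMatch.1
    suffices ∃ F', Grow a F F' from ⟨_, .step δ a c' h F _ hF this.choose_spec⟩
    cases h with
    | solve e G' S B n => exact ⟨F, .solve F⟩
    | introduce k G' S B n =>
      obtain ⟨i, hi⟩ := exists_rep_of_key (F := F) (k := k) (l := none) (by
        rw [hm.1]
        exact Multiset.mem_add.2 (.inl (Multiset.mem_map.2 ⟨k, (Multiset.mem_filterMap _ _).2
          ⟨_, Multiset.mem_cons_self _ _, rfl⟩, rfl⟩)))
      obtain rfl := hm.2 k i hi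
      obtain ⟨F', hF'⟩ := exists_replace (.leaf (.rep k (some n) 0)) F hi
      exact ⟨F', .introduce k n F F' hF'⟩
    | apply r ρ k l G' S B n =>
      obtain ⟨i, hi⟩ := exists_rep_of_key (F := F) (k := k) (l := some l) (by
        rw [hm.1]
        simp)
      generalize r.propagation = p
      generalize (r.rename ρ).body.filterMap Constraint.toAtom? = ks
      cases p with
      | true =>
        obtain ⟨F', hF'⟩ := exists_replace _ F hi
        exact ⟨F', .propagate k l i ks F F' hF'⟩
      | false =>
        cases ks with
        | nil =>
          obtain ⟨F', hF'⟩ := exists_replace _ F hi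
          exact ⟨F', .erase k l i F F' hF'⟩
        | cons k' ks =>
          obtain ⟨F', hF'⟩ := exists_replace _ F hi
          exact ⟨F', .simplify k l i _ F F' (by simp) hF'⟩

/-! ### The derivations at the nodes of a forest -/

theorem jump_eq_append (d : Bool) (E E' : Set (Port × Port))
    (ch : List (Bool × Set (Port × Port))) : jump d E E' ch = jump d E E' [] ++ ch := by
  unfold jump
  split <;> rfl

/-- The last of the sets of a history that starts from `E`. -/
def lastPat (E : Set (Port × Port)) (ch : List (Bool × Set (Port × Port))) : Set (Port × Port) :=
  ch.foldl (fun _ p => p.2) E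

theorem lastPat_append_jump {d : Bool} {E₀ E E' : Set (Port × Port)}
    {ch : List (Bool × Set (Port × Port))} (h : lastPat E₀ ch = E) :
    lastPat E₀ (ch ++ jump d E E' []) = E' := by
  unfold jump
  split
  · rw [List.append_nil, h]
    assumption
  · simp [lastPat]

/-- No variable of a state disappears: the arguments of the constraint to which a rule is applied
are kept in the matching equations. -/
theorem Over.apply {A : Multiset Atom} {C : Set Eqn} {k : Atom} {r : Rule} {ρ : Renaming}
    (hf : Fires r k C) {x : Var} (h : Over (k ::ₘ A) C [] x) :
    Over ((r.kids (permSub ρ) k : Multiset Atom) + A) ({e | e ∈ r.told (permSub ρ) k} ∪ C) [] x := by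
  obtain ⟨k', hk', hx⟩ | ⟨e, he, hx⟩ | ⟨t, ht, -⟩ := h
  · obtain rfl | hk' := Multiset.mem_cons.1 hk'
    · obtain ⟨i, t, hi, hx⟩ := Atom.mem_vars.1 hx
      have hlt : i < r.head.args.length := hf.2.1 ▸ (List.getElem?_eq_some_iff.1 hi).1
      have hi' : (r.head.sub (permSub ρ)).args[i]? = some (r.head.args[i].sub (permSub ρ)) := by
        rw [Atom.sub_args, List.getElem?_map, List.getElem?_eq_getElem hlt]
        rfl
      refine .inr (.inl ⟨⟨t, r.head.args[i].sub (permSub ρ)⟩, .inl ?_, List.mem_append_left _ hx⟩)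
      exact Rule.mem_told.2 (.inl (mem_matching.2 ⟨i, hi, hi'⟩))
    · exact .inl ⟨k', Multiset.mem_add.2 (.inr hk'), hx⟩
  · exact .inr (.inl ⟨e, .inr he, hx⟩)
  · cases ht

/-- The computation up to the present, which has `N` applications and has led to the constraints `A`
and the equations `C`, split at the node which is the root of the tree `t` and has the constraint
`k`: every continuation to a terminal state extends to a split derivation from the moment when `k`
has appeared, and the history `pre` of its ports leads to their present equations. The multiset `R` holds the leaves outside `t`. -/
def NodeInv (P : Program) (M : ℕ) (G : Goal) (U : Set Const) (K : Set (ℕ × ℕ)) (A : Multiset Atom)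
    (C : Set Eqn) (N : ℕ) (t : Tree) (R : Multiset Label) (k : Atom) : Prop :=
  ∃ (X : Multiset Atom) (C₀ : Set Eqn) (m a : ℕ) (pre : List (Bool × Set (Port × Port)))
    (BO BI : Set Eqn), Reached P M G (k ::ₘ X) C₀ m ∧ InSig U K (k ::ₘ X) C₀ ∧
    (∀ ch a' b', SplitRun P k.args (R.map Label.atom) BO (t.leaves.map Label.atom) BI ch a' b' →
      SplitRun P k.args X C₀ {k} ∅ (pre ++ ch) (a + a') (t.inner + b')) ∧
    BO ∪ BI = C ∧ lastPat (pat k.args (C₀ ∪ ∅)) pre = pat k.args C ∧ m + a + t.inner = N ∧ ∀ x ∈ k.vars, Over A C [] x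

theorem NodeInv.new {P : Program} {M : ℕ} {G : Goal} {U : Set Const} {K : Set (ℕ × ℕ)}
    {C : Set Eqn} {N : ℕ} {R : Multiset Label} {k : Atom} {l : Option ℕ} {i : ℕ}
    (hR : Reached P M G (k ::ₘ R.map Label.atom) C N)
    (hsig : InSig U K (k ::ₘ R.map Label.atom) C) :
    NodeInv P M G U K (k ::ₘ R.map Label.atom) C N (.leaf (.rep k l i)) R k := by
  refine ⟨_, C, N, 0, [], C, ∅, hR, hsig, fun ch a' b' h => ?_, Set.union_empty C, by
    rw [Set.union_empty]; rfl, by simp [inner_leaf], fun x hx => .inl ⟨k, Multiset.mem_cons_self _ _, hx⟩⟩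
  rw [leaves_leaf] at h
  simpa [inner_leaf, Label.atom] using h

/-- A variable of either side of a split state, or of the ports, occurs in the state. -/
theorem over_of_split {A : Multiset Atom} {C BX : Set Eqn} {X : Multiset Atom} {k : Atom}
    (hX : X ≤ A) (hB : BX ⊆ C) (hk : ∀ x ∈ k.vars, Over A C [] x) {x : Var}
    (h : Over X BX k.args x) : Over A C [] x := by
  obtain ⟨k', hk', hx⟩ | ⟨e, he, hx⟩ | ⟨t, ht, hx⟩ := h
  · exact .inl ⟨k', Multiset.mem_of_le hX hk', hx⟩
  · exact .inr (.inl ⟨e, hB he, hx⟩)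
  · exact hk x (List.mem_flatMap.2 ⟨t, ht, hx⟩)

section Step

variable {P : Program} {M : ℕ} {G : Goal} {U : Set Const} {K : Set (ℕ × ℕ)} {A : Multiset Atom}
  {C : Set Eqn} {N : ℕ} {t t' : Tree} {R R' : Multiset Label} {k h : Atom} {r : Rule} {ρ : Renaming}

theorem NodeInv.outer {a : Label} (hinv : NodeInv P M G U K (h ::ₘ A) C N t (a ::ₘ R) k)
    (ha : a.atom = h) (hA : h ::ₘ A = (t.leaves + a ::ₘ R).map Label.atom)
    (hR' : R'.map Label.atom = (r.kids (permSub ρ) h : Multiset Atom) + R.map Label.atom)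
    (hr : r ∈ P) (hC : ¬ Bad C) (hf : Fires r h C)
    (hfresh : ∀ x ∈ (r.rename ρ).vars, ¬ Over (h ::ₘ A) C [] x) :
    NodeInv P M G U K ((r.kids (permSub ρ) h : Multiset Atom) + A)
      ({e | e ∈ r.told (permSub ρ) h} ∪ C) (N + 1) t R' k := by
  obtain ⟨X, C₀, m, n, pre, BO, BI, hreach, hsig, hcont, rfl, hlast, hN, hk⟩ := hinv
  rw [Multiset.map_add, Multiset.map_cons, ha] at hA
  refine ⟨X, C₀, m, n + 1, pre ++ jump true (pat k.args (BO ∪ BI))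
    (pat k.args ({e | e ∈ r.told (permSub ρ) h} ∪ BO ∪ BI)) [],
    {e | e ∈ r.told (permSub ρ) h} ∪ BO, BI, hreach, hsig, fun ch a' b' hs => ?_,
    Set.union_assoc _ _ _, ?_, by omega, fun x hx => (hk x hx).apply hf⟩
  rw [hR'] at hs
  rw [List.append_assoc, ← jump_eq_append, add_assoc n, add_comm 1]
  refine hcont _ _ _ ?_
  rw [Multiset.map_cons, ha]
  refine .outer h r ρ hr hC hf (fun x hx => ⟨fun ho => hfresh x hx ?_, fun ho => hfresh x hx ?_⟩) hs
  · exact over_of_split (hA ▸ Multiset.le_add_left _ _) Set.subset_union_left hk ho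
  · exact over_of_split (hA ▸ Multiset.le_add_right _ _) Set.subset_union_right hk ho
  · rw [lastPat_append_jump hlast, Set.union_assoc]

theorem NodeInv.inside {L : Multiset Atom} (hinv : NodeInv P M G U K (h ::ₘ A) C N t R k)
    (ht : t.leaves.map Label.atom = h ::ₘ L)
    (hA : h ::ₘ A = (t.leaves + R).map Label.atom)
    (ht' : t'.leaves.map Label.atom = (r.kids (permSub ρ) h : Multiset Atom) + L)
    (hinner : t'.inner = t.inner + 1)
    (hr : r ∈ P) (hC : ¬ Bad C) (hf : Fires r h C)
    (hfresh : ∀ x ∈ (r.rename ρ).vars, ¬ Over (h ::ₘ A) C [] x) :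
    NodeInv P M G U K ((r.kids (permSub ρ) h : Multiset Atom) + A)
      ({e | e ∈ r.told (permSub ρ) h} ∪ C) (N + 1) t' R k := by
  obtain ⟨X, C₀, m, n, pre, BO, BI, hreach, hsig, hcont, rfl, hlast, hN, hk⟩ := hinv
  rw [Multiset.map_add, ht] at hA
  refine ⟨X, C₀, m, n, pre ++ jump false (pat k.args (BO ∪ BI))
    (pat k.args (BO ∪ ({e | e ∈ r.told (permSub ρ) h} ∪ BI))) [],
    BO, {e | e ∈ r.told (permSub ρ) h} ∪ BI, hreach, hsig, fun ch a' b' hs => ?_,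
    Set.union_left_comm _ _ _, ?_, by omega, fun x hx => (hk x hx).apply hf⟩
  rw [ht'] at hs
  rw [List.append_assoc, ← jump_eq_append, hinner, add_assoc, add_comm 1]
  refine hcont _ _ _ ?_
  rw [ht]
  refine .inner h r ρ hr hC hf (fun x hx => ⟨fun ho => hfresh x hx ?_, fun ho => hfresh x hx ?_⟩) hs
  · exact over_of_split (hA ▸ Multiset.le_add_right _ _) Set.subset_union_right hk ho
  · exact over_of_split (hA ▸ Multiset.le_add_left _ _) Set.subset_union_left hk ho
  · rw [lastPat_append_jump hlast, Set.union_left_comm]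

end Step

theorem hasVar_iff_over {c : Config} {x : Var} : c.HasVar x ↔ Over c.atoms c.eqs [] x := by
  simp [Config.hasVar_iff, Over]

/-- `NodeInv` at all nodes of a forest. -/
def ForestInv (P : Program) (M : ℕ) (G : Goal) (U : Set Const) (K : Set (ℕ × ℕ)) (A : Multiset Atom)
    (C : Set Eqn) (N : ℕ) (F : Forest) : Prop :=
  Reached P M G A C N ∧ InSig U K A C ∧
    ∀ t R k l i, Sub t F R → t.root = .rep k l i → NodeInv P M G U K A C N t R k

theorem ForestInv.apply {P : Program} {M : ℕ} {G : Goal} {U : Set Const} {K : Set (ℕ × ℕ)}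
    {A : Multiset Atom} {C : Set Eqn} {N : ℕ} {F F' : Forest} {h : Atom} {l : Option ℕ} {i : ℕ}
    {r : Rule} {ρ : Renaming} {t₀ : Tree}
    (hinv : ForestInv P M G U K (h ::ₘ A) C N F) (hA : h ::ₘ A = (leavesList F).map Label.atom)
    (hP : P.InSig U K) (hM : ∀ r ∈ P, ∀ x ∈ r.vars, x < M) (hr : r ∈ P) (hC : ¬ Bad C)
    (hf : Fires r h C) (hfresh : ∀ x ∈ (r.rename ρ).vars, ¬ Over (h ::ₘ A) C [] x)
    (hR : Replace (.leaf (.rep h l i)) t₀ F F') (hroot : t₀.root = .rep h l i)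
    (hleaves : t₀.leaves.map Label.atom = (r.kids (permSub ρ) h : Multiset Atom))
    (hinner : t₀.inner = 1) (hsons : ∀ t R, Sub t t₀.sons R → ∃ a, t = .leaf a) :
    ForestInv P M G U K ((r.kids (permSub ρ) h : Multiset Atom) + A)
      ({e | e ∈ r.told (permSub ρ) h} ∪ C) (N + 1) F' := by
  obtain ⟨hreach, hsig, hnodes⟩ := hinv
  have hreach' := hreach.apply hr (hM r hr) hf hfresh
  have hsig' := hsig.apply (ρ := ρ) hP hr
  refine ⟨hreach', hsig', fun t' R' k l' i' hs hroot' => ?_⟩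
  obtain ⟨R, h1, rfl⟩ | ⟨t, h1, h2⟩ | ⟨R₁, R, h1, h2, rfl⟩ := hR.sub_cases hs
  · refine (hnodes t' _ k l' i' h1 hroot').outer rfl (by rw [hA, h1.leaves]) ?_ hr hC hf hfresh
    rw [Multiset.map_add, hleaves]
  · obtain ⟨hro, L, hl, hl', hi⟩ := h1.singleton
    have hroot'' : ∃ l i, t.root = .rep k l i := by
      obtain hro | ⟨hro, rfl⟩ := hro
      · exact ⟨l', i', hro.trans hroot'⟩
      · exact ⟨l', i', hro.trans (hroot.symm.trans hroot')⟩
    obtain ⟨l'', i'', hroot''⟩ := hroot''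
    refine (hnodes t R' k l'' i'' h2 hroot'').inside (L := L.map Label.atom) ?_
      (by rw [hA, h2.leaves]) ?_ (by rw [hi, hinner]) hr hC hf hfresh
    · rw [hl, Multiset.map_cons]; rfl
    · rw [hl', Multiset.map_add, hleaves]
  · obtain ⟨a, rfl⟩ := hsons _ _ h1
    obtain rfl : a = .rep k l' i' := hroot'
    have hl : t₀.leaves = .rep k l' i' ::ₘ R₁ := by
      have h3 : t₀.leaves = leavesList t₀.sons := by
        obtain ⟨b, ss⟩ := t₀
        exact leaves_node h1.ne_nil
      rw [h3, h1.leaves, leaves_leaf, Multiset.singleton_add]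
    have hAll : (r.kids (permSub ρ) h : Multiset Atom) + A =
        k ::ₘ (R₁ + R).map Label.atom := by
      rw [h2, Multiset.map_cons] at hA
      have hA' : A = R.map Label.atom := (Multiset.cons_inj_right _).1 hA
      rw [← hleaves, hl, hA', Multiset.map_cons, Multiset.map_add, Multiset.cons_add]
      rfl
    rw [hAll] at hreach' hsig' ⊢
    exact .new hreach' hsig'

theorem ForestInv.introduce {P : Program} {M : ℕ} {G : Goal} {U : Set Const} {K : Set (ℕ × ℕ)}
    {A : Multiset Atom} {C : Set Eqn} {N : ℕ} {F F' : Forest} {h : Atom} {l : ℕ}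
    (hinv : ForestInv P M G U K A C N F)
    (hR : Replace (.leaf (.rep h none 0)) (.leaf (.rep h (some l) 0)) F F') :
    ForestInv P M G U K A C N F' := by
  refine ⟨hinv.1, hinv.2.1, fun t' R' k l' i' hs hroot' => ?_⟩
  obtain ⟨R, h1, rfl⟩ | ⟨t, h1, h2⟩ | ⟨R₁, R, h1, h2, rfl⟩ := hR.sub_cases hs
  · have hn := hinv.2.2 t' _ k l' i' h1 hroot'
    unfold NodeInv at hn ⊢
    rw [leaves_leaf, Multiset.singleton_add]
    simpa only [Multiset.map_cons, Label.atom] using hn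
  · obtain ⟨hro, L, hl, hl', hi⟩ := h1.singleton
    have hroot'' : ∃ l i, t.root = .rep k l i := by
      obtain hro | ⟨hro, rfl⟩ := hro
      · exact ⟨l', i', hro.trans hroot'⟩
      · refine ⟨none, 0, hro.trans ?_⟩
        injection hroot' with h1
        rw [h1]
    obtain ⟨l'', i'', hroot''⟩ := hroot''
    have hn := hinv.2.2 t R' k l'' i'' h2 hroot''
    have hmap : t'.leaves.map Label.atom = t.leaves.map Label.atom := by
      rw [hl, hl', leaves_leaf, Multiset.singleton_add, Multiset.map_cons, Multiset.map_cons]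
      rfl
    unfold NodeInv at hn ⊢
    rw [hmap, hi, inner_leaf, Nat.add_zero]
    exact hn
  · exact absurd rfl h1.ne_nil

theorem ForestInv.initial {P : Program} {M : ℕ} {G : Goal} {U : Set Const} {K : Set (ℕ × ℕ)}
    (hM : ∀ c ∈ G, ∀ x ∈ c.vars, x < M)
    (hsig : InSig U K (Config.initial G).atoms (Config.initial G).eqs) :
    ForestInv P M G U K (Config.initial G).atoms (Config.initial G).eqs 0
      (newLeaves (G.filterMap Constraint.toAtom?)) := by
  refine ⟨.initial hM, hsig, fun t R k l i hs hroot => ?_⟩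
  obtain ⟨k', rfl⟩ := hs.of_newLeaves
  obtain ⟨rfl, rfl, rfl⟩ : k' = k ∧ none = l ∧ 0 = i := by simpa [Tree.leaf, Tree.root] using hroot
  have hA : (Config.initial G).atoms = k' ::ₘ R.map Label.atom := by
    rw [(leavesMatch_initial G).atoms, hs.leaves, leaves_leaf, Multiset.singleton_add,
      Multiset.map_cons]
    rfl
  have hreach := Reached.initial (P := P) hM
  rw [hA] at hreach hsig ⊢
  exact .new hreach hsig

/-- If no eager derivation needs less than `T` applications, then each node of the forest of a
computation with at most `T` applications splits it. -/
theorem IsForestOf.forestInv {P : Program} {M : ℕ} {G : Goal} {U : Set Const} {K : Set (ℕ × ℕ)}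
    {T : ℕ} (hP : P.InSig U K) (hMP : ∀ r ∈ P, ∀ x ∈ r.vars, x < M)
    (hMG : ∀ c ∈ G, ∀ x ∈ c.vars, x < M)
    (hsig : InSig U K (Config.initial G).atoms (Config.initial G).eqs)
    (hmin : ∀ t < T, ¬ CanTerm P M t (initAtoms G) (initEqns G) M)
    {c : Config} {δ : Computation P G c} {F : Forest} (hF : IsForestOf δ F) (hT : δ.applies ≤ T) :
    ForestInv P M G U K c.atoms c.eqs δ.applies F := by
  induction hF with
  | start => exact .initial hMG hsig
  | step δ a c' h F F' hF hg ih =>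
    cases h with
    | solve e G' S B n =>
      cases hg
      rw [atoms_solve, eqs_solve]
      exact ih hT
    | introduce k G' S B n =>
      cases hg with
      | introduce _ _ _ _ hR =>
        rw [atoms_introduce, eqs_introduce]
        exact (ih hT).introduce hR
    | apply r ρ k l G' S B n mem apart hp hl he =>
      have hlt : δ.applies < T := hT
      have hinv := ih hlt.le
      have hC : ¬ Bad (Config.eqs ⟨G', (k, l) ::ₘ S, B, n⟩) := fun hbad =>
        hmin _ hlt (hinv.1 0 fun f A' B' n' hJ => .done (.inl (by
          obtain ⟨x, y, hxy, hr⟩ := hbad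
          exact ⟨x, y, hxy, hr.sub fun e he => by
            rw [hJ.eqs]
            exact .inl ⟨e, he, rfl⟩⟩)))
      have hf : Fires r k (Config.eqs ⟨G', (k, l) ::ₘ S, B, n⟩) :=
        fires_of_entails (fun e he => .inl he) hp hl (fun x hx hxk =>
          apart x hx (.inr (.inl ⟨(k, l), Multiset.mem_cons_self _ _, hxk⟩))) he
      obtain ⟨i, t₀, hR, hroot, hkey, -, hi, hsons, -⟩ := hg.exists_replace
      have hm := hF.leavesMatch.1.atoms
      rw [atoms_apply (B := B), eqs_apply (S'' := (k, l) ::ₘ S)]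
      rw [atoms_apply_left] at hinv hm
      refine hinv.apply hm hP hMP mem hC hf (fun x hx ho => apart x hx ?_) hR hroot ?_ hi hsons
      · rw [hasVar_iff_over, atoms_apply_left]
        exact ho
      · have hatom : Label.atom = Prod.fst ∘ Label.key := by
          funext a
          cases a <;> rfl
        rw [hatom, ← Multiset.map_map, hkey, Multiset.map_coe, List.map_append, List.map_map,
          body_rename, Rule.kids]
        congr 2
        · split <;> rfl
        · exact List.map_id _

theorem Config.Final.terminal {P : Program} {c : Config} (h : c.Final P) :
    Terminal P c.atoms c.eqs := by
  by_cases hbad : Bad c.eqs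
  · exact .inl hbad
  obtain h | ⟨h0, h⟩ := h
  · exact .inl ((inconsistent_iff.1 h).mono fun e he => .inl he)
  refine .inr fun k hk r hr hf => h ?_
  obtain ⟨g, S, B, n⟩ := c
  obtain rfl : g = 0 := h0
  rw [Config.eqs_of_goal rfl] at hbad hf
  obtain ⟨l, hl⟩ : ∃ l, (k, l) ∈ S := by simpa [Config.mem_atoms] using hk
  obtain ⟨S, rfl⟩ := Multiset.exists_cons_of_mem hl
  -- Rename the rule by a large shift.
  obtain ⟨M, hM⟩ : ∃ M, ∀ x, x ∈ r.vars ∨ Config.HasVar ⟨0, (k, l) ::ₘ S, B, n⟩ x → x < M := by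
    have hfin : {x | x ∈ r.vars ∨ Config.HasVar ⟨0, (k, l) ::ₘ S, B, n⟩ x}.Finite := by
      refine Set.Finite.union (List.finite_toSet _) ?_
      have : {x | Config.HasVar ⟨0, (k, l) ::ₘ S, B, n⟩ x} ⊆
          {x | x ∈ ((k, l) ::ₘ S).toList.flatMap fun p => p.1.vars} ∪
            {x | x ∈ B.flatMap Eqn.vars} := by
        rintro x (⟨e, he, -⟩ | ⟨p, hp, hx⟩ | ⟨e, he, hx⟩)
        · exact absurd he (Multiset.notMem_zero _)
        · exact .inl (List.mem_flatMap.2 ⟨p, Multiset.mem_toList.2 hp, hx⟩)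
        · exact .inr (List.mem_flatMap.2 ⟨e, he, hx⟩)
      exact ((List.finite_toSet _).union (List.finite_toSet _)).subset this
    obtain ⟨M, hM⟩ := hfin.bddAbove
    exact ⟨M + 1, fun x hx => Nat.lt_succ_of_le (hM hx)⟩
  obtain ⟨ρ, -, hρ⟩ := exists_perm_shift (fun x hx => hM x (.inl hx)) le_rfl
  have hfresh : ∀ x ∈ (r.rename ρ).vars, ¬ Config.HasVar ⟨0, (k, l) ::ₘ S, B, n⟩ x :=
    fun x hx hv => (hM x (.inr hv)).not_ge (hρ x hx).1
  have hfreshk : ∀ x ∈ (r.rename ρ).vars, x ∉ k.vars := fun x hx hxk => hfresh x hx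
    (.inr (.inl ⟨(k, l), Multiset.mem_cons_self _ _, hxk⟩))
  exact ⟨_, _, .apply r ρ k l 0 S B n hr hfresh hf.1 hf.2.1 (entails_of_fires hbad hfreshk hf)⟩

/-- Each node of the forest of a shortest terminating computation splits it into the part of the
descendants of the node, with as many applications as there are inner nodes below it, and the
rest. -/
theorem IsForestOf.nodeRun {P : Program} {M : ℕ} {G : Goal} {U : Set Const} {K : Set (ℕ × ℕ)}
    (hP : P.InSig U K) (hMP : ∀ r ∈ P, ∀ x ∈ r.vars, x < M)
    (hMG : ∀ c ∈ G, ∀ x ∈ c.vars, x < M)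
    (hsig : InSig U K (Config.initial G).atoms (Config.initial G).eqs)
    {c : Config} {δ : Computation P G c} {F : Forest} (hF : IsForestOf δ F) (hfin : c.Final P)
    (hmin : ∀ t < δ.applies, ¬ CanTerm P M t (initAtoms G) (initEqns G) M)
    {t : Tree} {R : Multiset Label} (ht : Sub t F R) {k : Atom} {l : Option ℕ} {i : ℕ}
    (hroot : t.root = .rep k l i) :
    ∃ E ch, NodeRun P M G U K δ.applies k E ch t.inner ∧ lastPat E ch = pat k.args c.eqs := by
  obtain ⟨X, C₀, m, a, pre, BO, BI, hreach, hsig', hcont, hB, hlast, hN, -⟩ :=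
    (hF.forestInv hP hMP hMG hsig hmin le_rfl).2.2 t R k l i ht hroot
  refine ⟨_, pre, ⟨X, C₀, m, a, hreach, ?_, rfl, hN, hsig'⟩, hlast⟩
  rw [← List.append_nil pre]
  refine hcont [] 0 0 (.done ?_)
  rw [hB, ← Multiset.map_add, add_comm, ← ht.leaves, ← hF.leavesMatch.1.atoms]
  exact hfin.terminal

/-! ### Shortest terminating computations -/

theorem CanTerm.mono {P : Program} {M t t' : ℕ} {A : List Atom} {B : List Eqn} {n : ℕ}
    (h : CanTerm P M t A B n) (ht : t ≤ t') : CanTerm P M t' A B n := by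
  induction h generalizing t' with
  | done h => exact .done h
  | step k r hk hr hf _ ih =>
    obtain ⟨s, rfl⟩ := Nat.exists_eq_add_of_lt ht
    exact .step k r hk hr hf (ih (Nat.le_add_right _ s))

/-- Being terminal passes to copies. -/
theorem Joint.terminal {P : Program} {A : Multiset Atom} {C : Set Eqn} {f : Var → Term}
    {A' : List Atom} {B' : List Eqn} {n : ℕ} (h : Joint A C [] f 0 ∅ [] .var A' B' n)
    (ht : Terminal P A C) : Terminal P A' {e | e ∈ B'} := by
  by_cases hbad : Bad {e | e ∈ B'}
  · exact .inl hbad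
  have hC : ¬ Bad C := by
    rintro ⟨x, y, hxy, hr⟩
    refine hbad ⟨x, y, hxy, hr.sub (f := f) fun e he => ?_⟩
    rw [h.eqs]
    exact .inl ⟨e, he, rfl⟩
  refine .inr fun k hk r hr => ?_
  rw [Multiset.mem_coe, ← Multiset.mem_coe, h.atoms, Multiset.map_zero, add_zero] at hk
  obtain ⟨k', hk', rfl⟩ := Multiset.mem_map.1 hk
  exact h.not_fires le_rfl (Set.empty_subset C) hC hC rfl hbad hk' (ht.resolve_left hC k' hk' r hr)

theorem Config.Final.canTerm {P : Program} {M : ℕ} {G : Goal}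
    (hMP : ∀ r ∈ P, ∀ x ∈ r.vars, x < M) (hMG : ∀ c ∈ G, ∀ x ∈ c.vars, x < M)
    {c : Config} (hfin : c.Final P) (δ : Computation P G c) :
    CanTerm P M δ.applies (initAtoms G) (initEqns G) M := by
  by_cases hmin : ∃ t < δ.applies, CanTerm P M t (initAtoms G) (initEqns G) M
  · obtain ⟨t, ht, h⟩ := hmin
    exact h.mono ht.le
  obtain ⟨F, hF⟩ := exists_isForestOf δ
  have h := hF.forestInv (U := Set.univ) (K := Set.univ) (T := δ.applies)
    ⟨fun _ _ _ _ => trivial, fun _ _ _ _ => trivial⟩ hMP hMG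
    ⟨fun _ _ => trivial, fun _ _ _ _ => trivial, fun _ _ _ _ => trivial⟩
    (fun t ht hc => hmin ⟨t, ht, hc⟩) le_rfl
  exact h.1 0 fun f A' B' n hJ => .done (hJ.terminal hfin.terminal)

theorem CanTerm.exists_final {P : Program} {M : ℕ} {G : Goal}
    (hMP : ∀ r ∈ P, ∀ x ∈ r.vars, x < M) (hMG : ∀ c ∈ G, ∀ x ∈ c.vars, x < M) {t : ℕ}
    (h : CanTerm P M t (initAtoms G) (initEqns G) M) :
    ∃ (c : Config) (δ : Computation P G c), c.Final P ∧ δ.applies ≤ t := by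
  obtain ⟨c, δ, h0, hA, hE, hap⟩ := exists_flush (P := P) (G := G) _ _ .start rfl
  have hlt : ∀ x, c.HasVar x → x < M := fun x hx => by
    rw [Config.hasVar_iff, hA, hE, ← Config.hasVar_iff] at hx
    obtain ⟨k, hk, hx⟩ | ⟨k, hk, hx⟩ | ⟨e, he, hx⟩ := hx
    · exact hMG k hk x hx
    · exact absurd hk (Multiset.notMem_zero _)
    · cases he
  obtain ⟨c', δ', hfin, hle⟩ := h.exists_computation hMP c δ h0 (hA.trans (Config.atoms_initial G))
    (hE.trans (Config.eqs_initial G)) hlt le_rfl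
  refine ⟨c', δ', hfin, hle.trans ?_⟩
  rw [hap]
  exact (Nat.zero_add t).le

theorem exists_shortest {P : Program} {M : ℕ} {G : Goal}
    (hMP : ∀ r ∈ P, ∀ x ∈ r.vars, x < M) (hMG : ∀ c ∈ G, ∀ x ∈ c.vars, x < M)
    (h : HasTerminatingComputation P G) :
    ∃ (c : Config) (δ : Computation P G c), c.Final P ∧
      ∀ t < δ.applies, ¬ CanTerm P M t (initAtoms G) (initEqns G) M := by
  classical
  obtain ⟨c₀, δ₀, h₀⟩ := h
  have hex : ∃ t, CanTerm P M t (initAtoms G) (initEqns G) M := ⟨_, h₀.canTerm hMP hMG δ₀⟩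
  obtain ⟨c, δ, hfin, hle⟩ := (Nat.find_spec hex).exists_final hMP hMG
  exact ⟨c, δ, hfin, fun t ht => Nat.find_min hex (ht.trans_le hle)⟩

/-! ### Counting histories -/

/-- `x` is a constant or one of the first `n` positions. -/
def IsPort (n : ℕ) (x : Port) : Prop := ∀ i, x = .inl i → i < n

theorem IsPort.inl {n i : ℕ} (h : i < n) : IsPort n (.inl i) := fun _ hj => Sum.inl.inj hj ▸ h

theorem IsPort.inr {n : ℕ} (c : Const) : IsPort n (.inr c) := fun _ hj => nomatch hj

/-- A pattern is bad if it comes from contradictory equations, see `bad_iff_pat`. -/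
def BadPat (E : Set (Port × Port)) : Prop := (.inr 0, .inr 1) ∈ E

/-- The closure properties of the patterns of lists of `n` terms, when all constants belong
to `U`. -/
structure IsPat (n : ℕ) (U : Set Const) (E : Set (Port × Port)) : Prop where
  dom : ∀ {x y}, (x, y) ∈ E → IsPort n x
  refl : ∀ {x}, IsPort n x → (x, x) ∈ E
  symm : ∀ {x y}, (x, y) ∈ E → (y, x) ∈ E
  trans : ∀ {x y z}, (x, y) ∈ E → (y, z) ∈ E → (x, z) ∈ E
  const : ∀ {c d}, (.inr c, .inr d) ∈ E → c = d ∨ BadPat E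
  bad : BadPat E → ∀ {x y}, IsPort n x → IsPort n y → (x, y) ∈ E
  mem : ∀ {i c}, (.inl i, .inr c) ∈ E → c ∈ U ∨ BadPat E

theorem isPort_iff {q : List Term} {x : Port} : IsPort q.length x ↔ ∃ t, tm q x = some t := by
  cases x with
  | inl i =>
    refine ⟨fun h => ⟨_, List.getElem?_eq_getElem (h i rfl)⟩, ?_⟩
    rintro ⟨t, ht⟩
    exact .inl (List.getElem?_eq_some_iff.1 ht).1
  | inr c => exact ⟨fun _ => ⟨_, rfl⟩, fun _ => .inr c⟩

theorem isPat_pat {U : Set Const} {q : List Term} {C : Set Eqn}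
    (hq : ∀ c, .const c ∈ q → c ∈ U) (hC : ∀ e ∈ C, ∀ c ∈ e.consts, c ∈ U) :
    IsPat q.length U (pat q C) where
  dom := by
    rintro x y ⟨s, t, hs, -⟩
    exact isPort_iff.2 ⟨s, hs⟩
  refl h := by
    obtain ⟨t, ht⟩ := isPort_iff.1 h
    exact ⟨t, t, ht, ht, .refl t⟩
  symm := by
    rintro x y ⟨s, t, hs, ht, h⟩
    exact ⟨t, s, ht, hs, h.symm⟩
  trans := by
    rintro x y z ⟨s, t, hs, ht, h⟩ h'
    obtain ⟨u, hu⟩ := isPort_iff.1 (show IsPort q.length z by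
      obtain ⟨_, u, -, hu, -⟩ := h'
      exact isPort_iff.2 ⟨u, hu⟩)
    exact (pat_iff hs hu).2 (h.trans ((pat_iff ht hu).1 h'))
  const {c d} h := by
    refine or_iff_not_imp_left.2 fun hcd => ?_
    exact bad_iff_pat.1 (bad_of_ent hcd ((pat_iff (s := .const c) (t := .const d) rfl rfl).1 h))
  bad h := by
    intro x y hx hy
    obtain ⟨s, hs⟩ := isPort_iff.1 hx
    obtain ⟨t, ht⟩ := isPort_iff.1 hy
    exact (pat_iff hs ht).2 (.inr (bad_iff_pat.2 h))
  mem := by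
    rintro i c ⟨s, t, hs, ht, h⟩
    obtain rfl : Term.const c = t := Option.some.inj ht
    refine h.imp (fun h => ?_) bad_iff_pat.1
    have hce : ∀ e : Eqn, .const c = e.lhs ∨ .const c = e.rhs → c ∈ e.consts := by
      rintro e (he | he)
      · exact List.mem_append_left _ (by rw [← he]; exact List.mem_singleton_self c)
      · exact List.mem_append_right _ (by rw [← he]; exact List.mem_singleton_self c)
    obtain rfl | ⟨-, e, he, hc⟩ := h.eq_or_mem
    · exact hq c (List.mem_of_getElem? hs)
    · exact hC e he c (hce e hc)

/-- To compare patterns that are both bad or both good, it is enough to look at pairs that begin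
with a position; if both are good, only constants of `U` matter. -/
theorem IsPat.subset {n : ℕ} {U : Set Const} {E E' : Set (Port × Port)} (h : IsPat n U E)
    (h' : IsPat n U E') (hbad : BadPat E → BadPat E')
    (hc : ¬ BadPat E → ∀ i < n, ∀ c ∈ U, (.inl i, .inr c) ∈ E → (.inl i, .inr c) ∈ E')
    (hp : ¬ BadPat E → ∀ i < n, ∀ j < n, (.inl i, .inl j) ∈ E → (.inl i, .inl j) ∈ E') :
    E ⊆ E' := by
  rintro ⟨x, y⟩ hxy
  have hx := h.dom hxy
  have hy := h.dom (h.symm hxy)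
  by_cases hb : BadPat E
  · exact h'.bad (hbad hb) hx hy
  cases x with
  | inl i =>
    cases y with
    | inl j => exact hp hb i (hx i rfl) j (hy j rfl) hxy
    | inr c => exact hc hb i (hx i rfl) c ((h.mem hxy).resolve_right hb) hxy
  | inr c =>
    cases y with
    | inl j =>
      exact h'.symm (hc hb j (hy j rfl) c ((h.mem (h.symm hxy)).resolve_right hb) (h.symm hxy))
    | inr d =>
      obtain rfl := (h.const hxy).resolve_right hb
      exact h'.refl hx

/-- The position `i` is equal to no constant and to no smaller position. -/
def IsFree (E : Set (Port × Port)) (i : ℕ) : Prop :=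
  (∀ c, (.inl i, .inr c) ∉ E) ∧ ∀ j < i, (.inl j, .inl i) ∉ E

/-- The number of equivalence classes of positions which are equal to no constant. -/
noncomputable def rank (n : ℕ) (E : Set (Port × Port)) : ℕ :=
  {i | i < n ∧ IsFree E i}.ncard

theorem rank_le (n : ℕ) (E : Set (Port × Port)) : rank n E ≤ n :=
  (Set.ncard_le_ncard (fun _ hi => Set.mem_Iio.2 hi.1) (Set.finite_Iio n)).trans_eq (by simp)

/-- A good pattern that grows and remains good loses a class of positions without constant. -/
theorem IsPat.rank_lt {n : ℕ} {U : Set Const} {E E' : Set (Port × Port)} (h : IsPat n U E)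
    (h' : IsPat n U E') (hb : ¬ BadPat E') (hsub : E ⊆ E') (hne : E ≠ E') :
    rank n E' < rank n E := by
  classical
  have hmono : ∀ i, IsFree E' i → IsFree E i := fun i hi =>
    ⟨fun c hc => hi.1 c (hsub hc), fun j hj hc => hi.2 j hj (hsub hc)⟩
  unfold rank
  refine Set.ncard_lt_ncard ⟨fun i hi => ⟨hi.1, hmono i hi.2⟩, fun hss => hne ?_⟩
    ((Set.finite_Iio n).subset fun _ hi => Set.mem_Iio.2 hi.1)
  have hQE : ∀ i < n, IsFree E i → IsFree E' i := fun i hi hq => (hss ⟨hi, hq⟩).2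
  -- Each position is equal to a constant or to a position which is the least of its class.
  have hrep : ∀ x, IsPort n x → ∃ y, (x, y) ∈ E ∧ ∀ i, y = .inl i → i < n ∧ IsFree E i := by
    rintro (i | c) hx
    · induction i using Nat.strong_induction_on with
      | _ i ih =>
        by_cases hq : IsFree E i
        · refine ⟨_, h.refl hx, fun j hj => ?_⟩
          obtain rfl := Sum.inl.inj hj
          exact ⟨hx _ rfl, hq⟩
        rw [IsFree, not_and_or] at hq
        push Not at hq
        obtain ⟨c, hc⟩ | ⟨j, hj, hc⟩ := hq
        · exact ⟨_, hc, fun j hj => nomatch hj⟩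
        · obtain ⟨y, hy, hyq⟩ := ih j hj (.inl (hj.trans (hx i rfl)))
          exact ⟨y, h.trans (h.symm hc) hy, hyq⟩
    · exact ⟨_, h.refl hx, fun j hj => nomatch hj⟩
  refine hsub.antisymm ?_
  rintro ⟨x, y⟩ hxy
  obtain ⟨x', hx, hxq⟩ := hrep x (h'.dom hxy)
  obtain ⟨y', hy, hyq⟩ := hrep y (h'.dom (h'.symm hxy))
  have hxy' : (x', y') ∈ E' := h'.trans (h'.symm (hsub hx)) (h'.trans hxy (hsub hy))
  obtain rfl : x' = y' := by
    cases x' with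
    | inl i =>
      obtain ⟨hi, hqi⟩ := hxq i rfl
      cases y' with
      | inl j =>
        obtain ⟨hj, hqj⟩ := hyq j rfl
        obtain hij | rfl | hij := lt_trichotomy i j
        · exact absurd hxy' ((hQE j hj hqj).2 i hij)
        · rfl
        · exact absurd (h'.symm hxy') ((hQE i hi hqi).2 j hij)
      | inr c => exact absurd hxy' ((hQE i hi hqi).1 c)
    | inr c =>
      cases y' with
      | inl j =>
        obtain ⟨hj, hqj⟩ := hyq j rfl
        exact absurd (h'.symm hxy') ((hQE j hj hqj).1 c)
      | inr d => rw [(h'.const hxy').resolve_right hb]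
  exact h.trans hx (h.symm hy)

/-- `E` and the members of `ch` are patterns, each of them is larger than its predecessor, and only the
last one may be bad. -/
def Growing (n : ℕ) (U : Set Const) : Set (Port × Port) → List (Bool × Set (Port × Port)) → Prop
  | E, [] => IsPat n U E
  | E, (_, E') :: ch => IsPat n U E ∧ ¬ BadPat E ∧ E ⊆ E' ∧ E ≠ E' ∧ Growing n U E' ch

theorem Growing.isPat {n : ℕ} {U : Set Const} {E : Set (Port × Port)}
    {ch : List (Bool × Set (Port × Port))} (h : Growing n U E ch) : IsPat n U E := by
  cases ch with
  | nil => exact h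
  | cons p ch => exact h.1

open Classical in
theorem Growing.length_le {n : ℕ} {U : Set Const} {E : Set (Port × Port)}
    {ch : List (Bool × Set (Port × Port))} (h : Growing n U E ch) :
    ch.length ≤ rank n E + if BadPat (lastPat E ch) then 1 else 0 := by
  induction ch generalizing E with
  | nil => exact Nat.zero_le _
  | cons p ch ih =>
    obtain ⟨d, E'⟩ := p
    obtain ⟨hE, hb, hsub, hne, h'⟩ := h
    have hlast : lastPat E ((d, E') :: ch) = lastPat E' ch := rfl
    rw [hlast, List.length_cons]
    by_cases hb' : BadPat E'
    · cases ch with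
      | nil =>
        have : BadPat (lastPat E' []) := hb'
        rw [if_pos this, List.length_nil]
        omega
      | cons p ch => exact absurd hb' h'.2.1
    · have := ih h'
      have := hE.rank_lt h'.isPat hb' hsub hne
      omega

/-- The pattern `E` of at most `w` positions, as a set of pairs, when the constants belong to `U`.
The pair of the first position with itself carries no information about a pattern; it is used to
store the bit `d`. -/
def enc {U : Finset Const} {w : ℕ} (E : Set (Port × Port)) (d : Bool) :
    Set (Fin w × (U ⊕ Fin w)) :=
  {p | match p.2 with
    | .inl c => (.inl p.1, .inr c) ∈ E
    | .inr j => if p.1.1 = 0 ∧ j.1 = 0 then d = true else (.inl p.1, .inl j) ∈ E}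

theorem enc_injective {U : Finset Const} {n w : ℕ} (hw : 0 < w) (hn : n ≤ w)
    {E E' : Set (Port × Port)} {d d' : Bool} (hE : IsPat n U E) (hE' : IsPat n U E')
    (hb : ¬ BadPat E) (hb' : ¬ BadPat E')
    (h : (enc E d : Set (Fin w × (U ⊕ Fin w))) = enc E' d') : E = E' ∧ d = d' := by
  have hmem : ∀ p, p ∈ (enc E d : Set (Fin w × (U ⊕ Fin w))) ↔ p ∈ enc E' d' := fun p => by rw [h]
  have hc : ∀ i < n, ∀ c ∈ (U : Set Const), (Sum.inl i, Sum.inr c) ∈ E ↔ (.inl i, .inr c) ∈ E' :=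
    fun i hi c hc => hmem (⟨i, hi.trans_le hn⟩, .inl ⟨c, hc⟩)
  have hp : ∀ i < n, ∀ j < n, (Sum.inl i, Sum.inl j) ∈ E ↔ (.inl i, .inl j) ∈ E' := by
    intro i hi j hj
    by_cases hij : i = 0 ∧ j = 0
    · obtain ⟨rfl, rfl⟩ := hij
      exact iff_of_true (hE.refl (.inl hi)) (hE'.refl (.inl hi))
    · have := hmem (⟨i, hi.trans_le hn⟩, .inr ⟨j, hj.trans_le hn⟩)
      simpa only [enc, Set.mem_ofPred_eq, if_neg hij] using this
  refine ⟨(hE.subset hE' (fun h => absurd h hb) (fun _ i hi c h => (hc i hi c h).1)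
    fun _ i hi j hj => (hp i hi j hj).1).antisymm (hE'.subset hE (fun h => absurd h hb')
    (fun _ i hi c h => (hc i hi c h).2) fun _ i hi j hj => (hp i hi j hj).2), ?_⟩
  have := hmem (⟨0, hw⟩, .inr ⟨0, hw⟩)
  simp only [enc, Set.mem_ofPred_eq, and_self, if_true] at this
  exact Bool.eq_iff_iff.2 this

open Classical in
/-- The good patterns of a history, each of them with the side from which the next growth comes. -/
noncomputable def code {U : Finset Const} {w : ℕ} : Set (Port × Port) →
    List (Bool × Set (Port × Port)) → List (Set (Fin w × (U ⊕ Fin w)))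
  | E, [] => if BadPat E then [] else [enc E false]
  | E, (d, E') :: ch => enc E d :: code E' ch

open Classical in
theorem length_code {U : Finset Const} {w : ℕ} (E : Set (Port × Port))
    (ch : List (Bool × Set (Port × Port))) :
    (code E ch : List (Set (Fin w × (U ⊕ Fin w)))).length =
      ch.length + if BadPat (lastPat E ch) then 0 else 1 := by
  induction ch generalizing E with
  | nil =>
    have : lastPat E [] = E := rfl
    rw [code, this]
    split <;> rfl
  | cons p ch ih =>
    obtain ⟨d, E'⟩ := p
    have hlast : lastPat E ((d, E') :: ch) = lastPat E' ch := rfl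
    rw [code, hlast, List.length_cons, List.length_cons, ih, Nat.add_right_comm]

theorem IsPat.eq_of_bad {n : ℕ} {U : Set Const} {E E' : Set (Port × Port)} (h : IsPat n U E)
    (h' : IsPat n U E') (hb : BadPat E) (hb' : BadPat E') : E = E' :=
  (h.subset h' (fun _ => hb') (absurd hb) (absurd hb)).antisymm
    (h'.subset h (fun _ => hb) (absurd hb') (absurd hb'))

theorem code_injective {U : Finset Const} {n w : ℕ} (hw : 0 < w) (hn : n ≤ w)
    {E E' : Set (Port × Port)} {ch ch' : List (Bool × Set (Port × Port))} (h : Growing n U E ch)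
    (h' : Growing n U E' ch') (hlast : BadPat (lastPat E ch) ↔ BadPat (lastPat E' ch'))
    (heq : (code E ch : List (Set (Fin w × (U ⊕ Fin w)))) = code E' ch') :
    E = E' ∧ ch = ch' := by
  classical
  have hlen : ch.length = ch'.length := by
    have := congrArg List.length heq
    rw [length_code, length_code] at this
    simp only [hlast] at this
    exact Nat.add_right_cancel this
  induction ch generalizing E E' ch' with
  | nil =>
    obtain rfl := List.length_eq_zero_iff.1 hlen.symm
    refine ⟨?_, rfl⟩
    have hlast' : BadPat E ↔ BadPat E' := hlast
    by_cases hb : BadPat E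
    · exact h.isPat.eq_of_bad h'.isPat hb (hlast'.1 hb)
    · have hb' := fun h => hb (hlast'.2 h)
      rw [code, code, if_neg hb, if_neg hb', List.cons.injEq] at heq
      exact (enc_injective hw hn h.isPat h'.isPat hb hb' heq.1).1
  | cons p ch ih =>
    obtain ⟨d, E₁⟩ := p
    obtain _ | ⟨⟨d', E₁'⟩, ch'⟩ := ch'
    · cases hlen
    rw [code, code, List.cons.injEq] at heq
    obtain ⟨rfl, rfl⟩ := enc_injective hw hn h.isPat h'.isPat h.2.1 h'.2.1 heq.1
    obtain ⟨rfl, rfl⟩ := ih h.2.2.2.2 h'.2.2.2.2 hlast heq.2 (Nat.succ.inj hlen)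
    exact ⟨rfl, rfl⟩

theorem card_le_of_length_lt {α : Type*} [Fintype α] {s : Finset (List α)} {N : ℕ}
    (h : ∀ l ∈ s, l.length < N) : s.card ≤ ∑ i ∈ Finset.range N, Fintype.card α ^ i := by
  classical
  let f : s → Σ i : Fin N, Fin i → α := fun l => ⟨⟨l.1.length, h l.1 l.2⟩, l.1.get⟩
  have hf : Function.Injective f := by
    rintro ⟨l, hl⟩ ⟨l', hl'⟩ hll
    obtain ⟨h1, h2⟩ := Sigma.mk.inj hll
    have h3 : l.length = l'.length := congrArg Fin.val h1
    refine Subtype.ext (List.ext_get h3 fun i hi hi' => ?_)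
    have h4 : ∀ (m m' : ℕ) (g : Fin m → α) (g' : Fin m' → α), m = m' → g ≍ g' →
        ∀ (hi : i < m) (hi' : i < m'), g ⟨i, hi⟩ = g' ⟨i, hi'⟩ := by
      rintro m _ g _ rfl hg hi hi'
      rw [eq_of_heq hg]
    exact h4 _ _ _ _ h3 h2 hi hi'
  have := Fintype.card_le_of_injective f hf
  rw [Fintype.card_coe, Fintype.card_sigma] at this
  refine this.trans_eq ?_
  simp only [Fintype.card_fun, Fintype.card_fin]
  exact Fin.sum_univ_eq_sum_range (fun i => Fintype.card α ^ i) N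

/-- There are at most `bound U.card w` histories at the ports of a node with at most `w` arguments,
if it is known whether the last pattern is bad. -/
theorem card_histories_le {U : Finset Const} {n w : ℕ} (hn : n ≤ w) {β : Prop}
    {s : Finset (Set (Port × Port) × List (Bool × Set (Port × Port)))}
    (hs : ∀ p ∈ s, Growing n U p.1 p.2 ∧ (BadPat (lastPat p.1 p.2) ↔ β)) :
    s.card ≤ bound U.card w := by
  classical
  obtain rfl | hw := Nat.eq_zero_or_pos w
  · -- Without positions, there is one good pattern and one bad pattern.
    obtain rfl := Nat.le_zero.1 hn
    have heq : ∀ {E E' : Set (Port × Port)}, IsPat 0 U E → IsPat 0 U E' →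
        (BadPat E ↔ BadPat E') → E = E' := fun h h' hb =>
      (h.subset h' hb.1 (fun _ i hi => absurd hi (Nat.not_lt_zero i))
        fun _ i hi => absurd hi (Nat.not_lt_zero i)).antisymm
      (h'.subset h hb.2 (fun _ i hi => absurd hi (Nat.not_lt_zero i))
        fun _ i hi => absurd hi (Nat.not_lt_zero i))
    have hlen : ∀ p ∈ s, p.2.length ≤ 1 := fun p hp => by
      have h1 := (hs p hp).1.length_le
      have h2 := rank_le 0 p.1
      split_ifs at h1 <;> omega
    have hinj : Set.InjOn (fun p : Set (Port × Port) × List (Bool × Set (Port × Port)) =>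
        p.2.map Prod.fst) s := by
      rintro ⟨E, ch⟩ hp ⟨E', ch'⟩ hp' hpp
      have h1 := hlen _ hp
      have h2 := hlen _ hp'
      obtain ⟨h, hβ⟩ := hs _ hp
      obtain ⟨h', hβ'⟩ := hs _ hp'
      have hb := hβ.trans hβ'.symm
      obtain _ | ⟨⟨d, E₁⟩, _ | _⟩ := ch <;> obtain _ | ⟨⟨d', E₁'⟩, _ | _⟩ := ch' <;>
        simp at hpp h1 h2
      · obtain rfl := heq h.isPat h'.isPat hb
        rfl
      · obtain rfl := heq h.isPat h'.isPat (iff_of_false h.2.1 h'.2.1)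
        obtain rfl := heq h.2.2.2.2.isPat h'.2.2.2.2.isPat hb
        rw [hpp]
    rw [bound_zero, ← Finset.card_image_of_injOn hinj]
    refine (card_le_of_length_lt (N := 2) fun l hl => ?_).trans (by simp [Finset.sum_range_succ])
    obtain ⟨p, hp, rfl⟩ := Finset.mem_image.1 hl
    rw [List.length_map]
    exact Nat.lt_succ_of_le (hlen p hp)
  · have hinj : Set.InjOn (fun p : Set (Port × Port) × List (Bool × Set (Port × Port)) =>
        (code p.1 p.2 : List (Set (Fin w × (U ⊕ Fin w))))) s := by
      rintro ⟨E, ch⟩ hp ⟨E', ch'⟩ hp' hpp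
      obtain ⟨h, hβ⟩ := hs _ hp
      obtain ⟨h', hβ'⟩ := hs _ hp'
      obtain ⟨rfl, rfl⟩ := code_injective hw hn h h' (hβ.trans hβ'.symm) hpp
      rfl
    rw [← Finset.card_image_of_injOn hinj]
    refine (card_le_of_length_lt (N := w + 3) fun l hl => ?_).trans_eq ?_
    · obtain ⟨p, hp, rfl⟩ := Finset.mem_image.1 hl
      have h1 := (hs p hp).1.length_le
      have h2 := rank_le n p.1
      rw [length_code]
      split_ifs at h1 ⊢ <;> omega
    · simp [bound]

/-! ### The repetitiveness of the forest of a shortest computation -/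

theorem growing_jump {n : ℕ} {U : Set Const} {d : Bool} {E E' : Set (Port × Port)}
    {ch : List (Bool × Set (Port × Port))} (hE : IsPat n U E) (hb : ¬ BadPat E) (hsub : E ⊆ E')
    (h : Growing n U E' ch) : Growing n U E (jump d E E' ch) := by
  unfold jump
  split_ifs with he
  · rwa [he]
  · exact ⟨hE, hb, hsub, he, h⟩

theorem SplitRun.growing {P : Program} {U : Set Const} {K : Set (ℕ × ℕ)} (hP : P.InSig U K)
    {q : List Term} (hq : ∀ c, .const c ∈ q → c ∈ U) {O I : Multiset Atom} {BO BI : Set Eqn}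
    {ch : List (Bool × Set (Port × Port))} {a b : ℕ} (h : SplitRun P q O BO I BI ch a b)
    (hsig : InSig U K (O + I) (BO ∪ BI)) : Growing q.length U (pat q (BO ∪ BI)) ch := by
  induction h with
  | done h => exact isPat_pat hq hsig.eqs
  | outer k r ρ hr hB hf hfresh h ih =>
    refine growing_jump (isPat_pat hq hsig.eqs) (fun h => hB (bad_iff_pat.2 h))
      (pat_mono (Set.union_subset_union_left _ Set.subset_union_right)) (ih ?_)
    rw [Multiset.cons_add] at hsig
    rw [add_assoc, Set.union_assoc]
    exact hsig.apply hP hr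
  | inner k r ρ hr hB hf hfresh h ih =>
    refine growing_jump (isPat_pat hq hsig.eqs) (fun h => hB (bad_iff_pat.2 h))
      (pat_mono (Set.union_subset_union_right _ Set.subset_union_right)) (ih ?_)
    rw [Multiset.add_cons] at hsig
    rw [add_left_comm, Set.union_left_comm]
    exact hsig.apply hP hr

theorem NodeRun.growing {P : Program} {M : ℕ} {G : Goal} {U : Set Const} {K : Set (ℕ × ℕ)} {T : ℕ}
    {k : Atom} {E : Set (Port × Port)} {ch : List (Bool × Set (Port × Port))} {b : ℕ}
    (hP : P.InSig U K) (h : NodeRun P M G U K T k E ch b) : Growing k.args.length U E ch ∧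
      (k.pred, k.args.length) ∈ K ∧ ∀ c, .const c ∈ k.args → c ∈ U := by
  obtain ⟨X, C, m, a, -, hS, rfl, -, hsig⟩ := h
  have hk : k ∈ k ::ₘ X := Multiset.mem_cons_self _ _
  have hU : ∀ c, .const c ∈ k.args → c ∈ U := fun c hc => hsig.atoms k hk c (Atom.mem_consts.2 hc)
  refine ⟨hS.growing hP hU ?_, hsig.sig k hk, hU⟩
  rwa [add_comm, Multiset.singleton_add, Set.union_empty]

theorem REqual.pat_eq {h k : Atom} (hr : REqual h k) :
    k.pred = h.pred ∧ k.args.length = h.args.length ∧ pat k.args ∅ = pat h.args ∅ := by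
  obtain ⟨ρ, rfl⟩ := hr
  refine ⟨rfl, by simp [Atom.rename], ?_⟩
  have hinj : Function.Injective (Term.sub fun x => .var (ρ x)) := by
    rintro (x | c) (y | d) hxy <;> simp_all [Term.sub]
  rw [Atom.rename_eq_sub, Atom.sub_args]
  ext ⟨x, y⟩
  simp only [mem_pat, tm_map, Option.map_eq_some_iff]
  constructor
  · rintro ⟨s, t, hs, ht, hst⟩
    obtain rfl := rel_empty.1 (hst.rel not_bad_empty)
    exact ⟨_, _, ⟨s, hs, rfl⟩, ⟨s, ht, rfl⟩, .refl _⟩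
  · rintro ⟨_, _, ⟨s, hs, rfl⟩, ⟨t, ht, rfl⟩, hst⟩
    obtain rfl := hinj (rel_empty.1 (hst.rel not_bad_empty))
    exact ⟨s, s, hs, ht, .refl _⟩

/-- The trees `l` at the nodes of a path: each of them is smaller than its predecessors, and those
at a constraint split a derivation of `T` steps, where `T` is minimal. -/
structure PathRuns (P : Program) (M : ℕ) (G : Goal) (U : Set Const) (K : Set (ℕ × ℕ)) (T : ℕ)
    (β : Prop) (l : List Tree) : Prop where
  pairwise : l.Pairwise fun t t' => t'.inner < t.inner
  run : ∀ t ∈ l, ∀ k id i, t.root = .rep k id i →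
    ∃ E ch, NodeRun P M G U K T k E ch t.inner ∧ (BadPat (lastPat E ch) ↔ β)
  min : ∀ t < T, ¬ CanTerm P M t (initAtoms G) (initEqns G) M
  box : ∀ t ∈ l, t.root = .box → t.inner = 0

theorem PathRuns.inner_injOn {P : Program} {M : ℕ} {G : Goal} {U : Set Const} {K : Set (ℕ × ℕ)}
    {T : ℕ} {β : Prop} {l : List Tree} (h : PathRuns P M G U K T β l) {t t' : Tree} (ht : t ∈ l)
    (ht' : t' ∈ l) (heq : t.inner = t'.inner) : t = t' := by
  refine List.inj_on_of_nodup_map (f := Tree.inner) ?_ ht ht' heq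
  exact List.pairwise_map.2 (h.pairwise.imp fun h => h.ne')

/-- On a path, the nodes of one class of r-equal constraints have different histories. -/
theorem PathRuns.card_class_le {P : Program} {M : ℕ} {G : Goal} {U : Finset Const}
    {K : Set (ℕ × ℕ)} {T : ℕ} {β : Prop} {l : List Tree} (hP : P.InSig U K)
    (hM : ∀ r ∈ P, ∀ x ∈ r.vars, x < M) (h : PathRuns P M G U K T β l) {s : Finset Tree}
    (hs : ∀ t ∈ s, t ∈ l) {w p n : ℕ} {E₀ : Set (Port × Port)} (hn : n ≤ w)
    (hclass : ∀ t ∈ s, ∃ k id i, t.root = .rep k id i ∧ k.pred = p ∧ k.args.length = n ∧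
      pat k.args ∅ = E₀) : s.card ≤ bound U.card w := by
  classical
  have hex : ∀ t : Tree, ∃ H : Set (Port × Port) × List (Bool × Set (Port × Port)), t ∈ s →
      ∃ k, NodeRun P M G U K T k H.1 H.2 t.inner ∧ (BadPat (lastPat H.1 H.2) ↔ β) ∧
        k.pred = p ∧ k.args.length = n ∧ pat k.args ∅ = E₀ := by
    intro t
    by_cases ht : t ∈ s
    · obtain ⟨k, id, i, hroot, hk⟩ := hclass t ht
      obtain ⟨E, ch, hr, hβ⟩ := h.run t (hs t ht) k id i hroot
      exact ⟨(E, ch), fun _ => ⟨k, hr, hβ, hk⟩⟩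
    · exact ⟨(∅, []), fun h => absurd h ht⟩
  choose H hH using hex
  have hinj : Set.InjOn H s := by
    intro t ht t' ht' heq
    refine h.inner_injOn (hs t ht) (hs t' ht') ?_
    by_contra hne
    -- Of two nodes with the same history, the upper one could be replaced by the lower one.
    have hlt : ∀ t ∈ s, ∀ t' ∈ s, H t = H t' → ¬ t'.inner < t.inner := by
      intro t ht t' ht' heq hlt
      obtain ⟨k, hr, -, hk1, hk2, hk3⟩ := hH t ht
      obtain ⟨k', hr', -, hk1', hk2', hk3'⟩ := hH t' ht'
      rw [← heq] at hr'
      obtain ⟨T', hT', hc⟩ := hr.canTerm hM hr' (hk1.trans hk1'.symm) (hk2.trans hk2'.symm)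
        (hk3.trans hk3'.symm) hlt
      exact h.min T' hT' hc
    obtain hl | hl := Nat.lt_or_gt_of_ne hne
    · exact hlt t' ht' t ht heq.symm hl
    · exact hlt t ht t' ht' heq hl
  rw [← Finset.card_image_of_injOn hinj]
  refine card_histories_le hn (β := β) fun q hq => ?_
  obtain ⟨t, ht, rfl⟩ := Finset.mem_image.1 hq
  obtain ⟨k, hr, hβ, -, rfl, -⟩ := hH t ht
  exact ⟨(hr.growing hP).1, hβ⟩

theorem PathRuns.ncard_repsEqualTo_le {P : Program} {M : ℕ} {G : Goal} {U : Finset Const}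
    {K : Set (ℕ × ℕ)} {T : ℕ} {β : Prop} {l : List Tree} (hP : P.InSig U K)
    (hM : ∀ r ∈ P, ∀ x ∈ r.vars, x < M) (h : PathRuns P M G U K T β l) {w : ℕ}
    (hK : ∀ p n, (p, n) ∈ K → n ≤ w) {k : Atom} {id : Option ℕ} {i : ℕ}
    (hk : .rep k id i ∈ l.map Tree.root) :
    (repsEqualTo k (l.map Tree.root)).ncard ≤ bound U.card w := by
  classical
  obtain ⟨t, ht, hroot⟩ := List.mem_map.1 hk
  obtain ⟨E, ch, hr, -⟩ := h.run t ht k id i hroot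
  have hn := hK _ _ (hr.growing hP).2.1
  let s := l.toFinset.filter fun t => ∃ k' id i, t.root = .rep k' id i ∧ REqual k k'
  have hsub : repsEqualTo k (l.map Tree.root) ⊆ ((s.image Tree.root : Finset Label) : Set Label) := by
    rintro _ ⟨ha, k', id', j, rfl, hkk⟩
    obtain ⟨t', ht', hroot'⟩ := List.mem_map.1 ha
    exact Finset.mem_coe.2 (Finset.mem_image.2 ⟨t', Finset.mem_filter.2
      ⟨List.mem_toFinset.2 ht', k', id', j, hroot', hkk⟩, hroot'⟩)
  refine (Set.ncard_le_ncard hsub (Finset.finite_toSet _)).trans ?_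
  rw [Set.ncard_coe_finset]
  refine Finset.card_image_le.trans (h.card_class_le hP hM (p := k.pred) (E₀ := pat k.args ∅)
    (fun t ht => List.mem_toFinset.1 (Finset.mem_filter.1 ht).1) hn fun t ht => ?_)
  obtain ⟨k', id', j, hroot', hkk⟩ := (Finset.mem_filter.1 ht).2
  exact ⟨k', id', j, hroot', hkk.pat_eq⟩

/-- The length of a path: there are at most `2 ^ (w * (u + w))` patterns of the arguments of a
constraint, which determine its class of r-equal constraints, and a path ends in at most one box. -/
theorem PathRuns.length_le {P : Program} {M : ℕ} {G : Goal} {U : Finset Const}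
    {K : Finset (ℕ × ℕ)} {T : ℕ} {β : Prop} {l : List Tree} (hP : P.InSig U K)
    (hM : ∀ r ∈ P, ∀ x ∈ r.vars, x < M) (h : PathRuns P M G U K T β l) {w : ℕ}
    (hK : ∀ p n, (p, n) ∈ K → n ≤ w) :
    l.length ≤ bound U.card w * (K.card * 2 ^ (w * (U.card + w))) + 1 := by
  classical
  have hnodup : l.Nodup := h.pairwise.imp fun h he => h.ne (congrArg Tree.inner he.symm)
  rw [← List.toFinset_card_of_nodup hnodup,
    ← Finset.card_filter_add_card_filter_not (s := l.toFinset) fun t => t.root ≠ .box]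
  refine add_le_add ?_ (Finset.card_le_one.2 fun t ht t' ht' => ?_)
  · let f : Tree → (ℕ × ℕ) × Set (Fin w × (U ⊕ Fin w)) := fun t =>
      ((t.root.atom.pred, t.root.atom.args.length), enc (pat t.root.atom.args ∅) false)
    set s := l.toFinset.filter fun t => t.root ≠ .box with hs
    have hmem : ∀ t ∈ s, t ∈ l ∧ ∃ k id i, t.root = .rep k id i := fun t ht => by
      obtain ⟨h1, h2⟩ := Finset.mem_filter.1 ht
      refine ⟨List.mem_toFinset.1 h1, ?_⟩
      cases hr : t.root with
      | rep k id i => exact ⟨k, id, i, rfl⟩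
      | box => exact absurd hr h2
    have hgood : ∀ t ∈ s, IsPat t.root.atom.args.length U (pat t.root.atom.args ∅) ∧
        (t.root.atom.pred, t.root.atom.args.length) ∈ K := fun t ht => by
      obtain ⟨hl, k, id, i, hroot⟩ := hmem t ht
      obtain ⟨E, ch, hr, -⟩ := h.run t hl k id i hroot
      obtain ⟨-, hk, hU⟩ := hr.growing hP
      rw [hroot]
      exact ⟨isPat_pat hU fun _ h => h.elim, hk⟩
    have himage : (s.image f).card ≤ K.card * 2 ^ (w * (U.card + w)) := by
      refine (Finset.card_le_card (t := K ×ˢ Finset.univ) fun q hq => ?_).trans ?_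
      · obtain ⟨t, ht, rfl⟩ := Finset.mem_image.1 hq
        exact Finset.mem_product.2 ⟨(hgood t ht).2, Finset.mem_univ _⟩
      · simp [Finset.card_product]
    refine (Finset.card_le_mul_card_image s (bound U.card w) fun q hq => ?_).trans
      (Nat.mul_le_mul_left _ himage)
    obtain ⟨t, ht, rfl⟩ := Finset.mem_image.1 hq
    refine h.card_class_le hP hM (p := t.root.atom.pred) (E₀ := pat t.root.atom.args ∅)
      (fun t' ht' => (hmem t' (Finset.mem_filter.1 ht').1).1) (hK _ _ (hgood t ht).2)
      fun t' ht' => ?_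
    obtain ⟨ht', heq⟩ := Finset.mem_filter.1 ht'
    obtain ⟨hl', k', id', i', hroot'⟩ := hmem t' ht'
    obtain ⟨heq1, heq2⟩ := Prod.mk.inj heq
    obtain ⟨hp, hlen⟩ := Prod.mk.inj heq1
    refine ⟨k', id', i', hroot', ?_⟩
    have hk' : k' = t'.root.atom := by rw [hroot']; rfl
    rw [hk']
    refine ⟨hp, hlen, ?_⟩
    have hnb : ∀ q : List Term, ¬ BadPat (pat q ∅) := fun q hb => not_bad_empty (bad_iff_pat.2 hb)
    obtain hw | hw := Nat.eq_zero_or_pos w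
    · have hnil : ∀ t ∈ s, t.root.atom.args = [] := fun t ht =>
        List.length_eq_zero_iff.1 (Nat.le_zero.1 (hw ▸ hK _ _ (hgood t ht).2))
      rw [hnil t ht, hnil t' ht']
    · have h1 := (hgood t' ht').1
      rw [hlen] at h1
      exact (enc_injective hw (hK _ _ (hgood t ht).2) h1 (hgood t ht).1 (hnb _) (hnb _) heq2).1
  · simp only [Finset.mem_filter, List.mem_toFinset, ne_eq, not_not] at ht ht'
    exact h.inner_injOn ht.1 ht'.1 ((h.box t ht.1 ht.2).trans (h.box t' ht'.1 ht'.2).symm)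

theorem Replace.length_eq {t t' : Tree} {F F' : Forest} (h : Replace t t' F F') :
    F'.length = F.length := by
  induction h with
  | here => rfl
  | next _ _ ih => rw [List.length_cons, List.length_cons, ih]
  | sons => rfl

/-- In the forest of a computation with rules whose bodies have at most `d` members, a node has at
most `d + 1` sons, and boxes are leaves. -/
theorem IsForestOf.sons_le {P : Program} {G : Goal} {d : ℕ} (hd : ∀ r ∈ P, r.body.length ≤ d)
    {c : Config} {δ : Computation P G c} {F : Forest} (hF : IsForestOf δ F) {t : Tree}
    {R : Multiset Label} (ht : Sub t F R) :
    t.sons.length ≤ d + 1 ∧ (t.root = .box → t.sons = []) := by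
  have key : ∀ {F F' : Forest} {k : Atom} {l : Option ℕ} {i : ℕ} {t₀ : Tree},
      Replace (.leaf (.rep k l i)) t₀ F F' → t₀.root ≠ .box → t₀.sons.length ≤ d + 1 →
      (∀ t R, Sub t t₀.sons R → ∃ a, t = .leaf a) →
      (∀ t R, Sub t F R → t.sons.length ≤ d + 1 ∧ (t.root = .box → t.sons = [])) →
      ∀ t R, Sub t F' R → t.sons.length ≤ d + 1 ∧ (t.root = .box → t.sons = []) := by
    intro F F' k l i t₀ hR hroot hlen hsons h t R ht
    obtain ⟨R, h1, -⟩ | ⟨t₁, h1, h2⟩ | ⟨R₁, R, h1, -, -⟩ := hR.sub_cases ht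
    · exact h t _ h1
    · have h3 := h t₁ R h2
      cases h1 with
      | here => exact ⟨hlen, fun hb => absurd hb hroot⟩
      | next _ h => cases h
      | @sons a _ ss ss' h =>
        refine ⟨h.length_eq ▸ h3.1, fun hb => ?_⟩
        have : ss = [] := h3.2 hb
        exact absurd this h.ne_nil.1
    · obtain ⟨a, rfl⟩ := hsons t _ h1
      exact ⟨Nat.zero_le _, fun _ => rfl⟩
  induction hF generalizing t R with
  | start =>
    obtain ⟨k, rfl⟩ := ht.of_newLeaves
    exact ⟨Nat.zero_le _, fun _ => rfl⟩
  | step δ a c' h F F' hF hg ih =>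
    cases h with
    | solve => cases hg; exact ih ht
    | introduce =>
      cases hg with
      | introduce _ _ _ _ hR =>
        refine key hR (by simp [Tree.leaf, Tree.root]) (Nat.zero_le _) (fun t R ht => ?_)
          (fun t R ht => ih ht) t R ht
        exact absurd rfl ht.ne_nil
    | apply r ρ k l G' S B n mem =>
      obtain ⟨i, t₀, hR, hroot, -, -, -, hsons, hlen⟩ := hg.exists_replace
      refine key hR (by simp [hroot]) (hlen.trans (Nat.succ_le_succ ?_)) hsons
        (fun t R ht => ih ht) t R ht
      refine (List.length_filterMap_le _ _).trans ?_
      simpa [Rule.rename] using hd r mem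

theorem IsForestOf.length_eq {P : Program} {G : Goal} {c : Config} {δ : Computation P G c}
    {F : Forest} (hF : IsForestOf δ F) : F.length = (initAtoms G).length := by
  induction hF with
  | start => simp [newLeaves, initAtoms]
  | step δ a c' h F F' hF hg ih =>
    cases hg with
    | solve => exact ih
    | introduce _ _ _ _ hR => exact hR.length_eq ▸ ih
    | propagate _ _ _ _ _ _ hR => exact hR.length_eq ▸ ih
    | simplify _ _ _ _ _ _ _ hR => exact hR.length_eq ▸ ih
    | erase _ _ _ _ _ hR => exact hR.length_eq ▸ ih

theorem Tree.exists_isPath : ∀ t : Tree, ∃ σ, t.IsPath σ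
  | .node a [] => ⟨_, .leaf a⟩
  | .node a (s :: ss) =>
    have ⟨_, hσ⟩ := exists_isPath s
    ⟨_, .son a (s :: ss) s _ List.mem_cons_self hσ⟩

theorem innerList_le {N : ℕ} {F : Forest} (h : ∀ t ∈ F, t.inner ≤ N) :
    innerList F ≤ F.length * N := by
  induction F with
  | nil => exact Nat.zero_le _
  | cons t ts ih =>
    rw [innerList, List.length_cons, Nat.succ_mul, add_comm]
    exact add_le_add (ih fun t ht => h t (List.mem_cons_of_mem _ ht)) (h t List.mem_cons_self)

theorem Tree.inner_le_pow {F : Forest} {d : ℕ} (hd : ∀ t R, Sub t F R → t.sons.length ≤ d) (D : ℕ)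
    {t : Tree} {R : Multiset Label} (ht : Sub t F R) (hD : ∀ σ, t.IsPath σ → σ.length ≤ D) :
    t.inner ≤ (d + 1) ^ D := by
  induction D generalizing t R with
  | zero =>
    obtain ⟨σ, hσ⟩ := t.exists_isPath
    have h := hD σ hσ
    cases hσ <;> cases h
  | succ D ih =>
    obtain ⟨a, ss⟩ := t
    cases ss with
    | nil => rw [show (Tree.node a []).inner = 0 from rfl]; exact Nat.zero_le _
    | cons s ss =>
      have hle : ∀ t ∈ s :: ss, t.inner ≤ (d + 1) ^ D := fun t' ht' => by
        obtain ⟨R', hR'⟩ := ht.son (exists_sub_of_mem ht').choose_spec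
        exact ih hR' fun σ hσ => Nat.succ_le_succ_iff.1 (hD _ (.son a _ t' σ ht' hσ))
      rw [inner_node (by simp), pow_succ, Nat.mul_succ, mul_comm _ d]
      exact add_le_add ((innerList_le hle).trans (Nat.mul_le_mul_right _ (hd _ _ ht)))
        (Nat.one_le_pow _ _ (Nat.succ_pos d))

/-- The predicate symbols of `P` and `G` with their arities. -/
def sigs (P : Program) (G : Goal) : List (ℕ × ℕ) :=
  ((P.flatMap Rule.body ++ G).filterMap Constraint.toAtom?).map fun k => (k.pred, k.args.length)

/-- The constants of `P` and `G`, with repetitions. -/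
def occurringConsts (P : Program) (G : Goal) : List Const :=
  P.flatMap Rule.consts ++ G.flatMap Constraint.consts

theorem program_inSig (P : Program) (G : Goal) :
    P.InSig ((occurringConsts P G).toFinset : Finset Const) ((sigs P G).toFinset : Finset _) where
  body r hr h hh := by
    refine Finset.mem_coe.2 (List.mem_toFinset.2 (List.mem_map.2 ⟨h, List.mem_filterMap.2
      ⟨.chr h, List.mem_append_left _ (List.mem_flatMap.2 ⟨r, hr, hh⟩), rfl⟩, rfl⟩))
  consts r hr c hc := Finset.mem_coe.2 (List.mem_toFinset.2
    (List.mem_append_left _ (List.mem_flatMap.2 ⟨r, hr, hc⟩)))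

theorem initial_inSig (P : Program) (G : Goal) :
    InSig ((occurringConsts P G).toFinset : Finset Const) ((sigs P G).toFinset : Finset _)
      (Config.initial G).atoms (Config.initial G).eqs := by
  rw [Config.atoms_initial, Config.eqs_initial]
  refine ⟨fun k hk => ?_, fun k hk c hc => ?_, fun e he c hc => ?_⟩
  · exact Finset.mem_coe.2 (List.mem_toFinset.2 (List.mem_map.2 ⟨k, List.mem_filterMap.2
      ⟨.chr k, List.mem_append_right _ (mem_initAtoms.1 hk), rfl⟩, rfl⟩))
  · exact Finset.mem_coe.2 (List.mem_toFinset.2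
      (List.mem_append_right _ (List.mem_flatMap.2 ⟨_, mem_initAtoms.1 hk, hc⟩)))
  · exact Finset.mem_coe.2 (List.mem_toFinset.2
      (List.mem_append_right _ (List.mem_flatMap.2 ⟨_, mem_initEqns.1 he, hc⟩)))

theorem le_foldr_max {l : List ℕ} {n : ℕ} (h : n ∈ l) : n ≤ l.foldr max 0 := by
  induction l with
  | nil => cases h
  | cons m l ih =>
    obtain rfl | h := List.mem_cons.1 h
    · exact le_max_left _ _
    · exact (ih h).trans (le_max_right _ _)

theorem arity_le_maxArity {P : Program} {G : Goal} {p n : ℕ} (h : (p, n) ∈ sigs P G) :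
    n ≤ maxArity P G := by
  obtain ⟨k, hk, heq⟩ := List.mem_map.1 h
  obtain ⟨-, rfl⟩ := Prod.mk.inj heq
  obtain ⟨c, hc, hck⟩ := List.mem_filterMap.1 hk
  obtain rfl := Constraint.toAtom?_eq_some.1 hck
  refine le_foldr_max ?_
  obtain hc | hc := List.mem_append.1 hc
  · obtain ⟨r, hr, hc⟩ := List.mem_flatMap.1 hc
    exact List.mem_append_left _ (List.mem_flatMap.2 ⟨r, hr, List.mem_cons_of_mem _
      (List.mem_map.2 ⟨_, hc, rfl⟩)⟩)
  · exact List.mem_append_right _ (List.mem_map.2 ⟨_, hc, rfl⟩)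

/-- The trees at the nodes of a path in the forest of a shortest computation. -/
theorem IsForestOf.pathRuns {P : Program} {M : ℕ} {G : Goal}
    (hMP : ∀ r ∈ P, ∀ x ∈ r.vars, x < M) (hMG : ∀ c ∈ G, ∀ x ∈ c.vars, x < M)
    {c : Config} {δ : Computation P G c} {F : Forest} (hF : IsForestOf δ F) (hfin : c.Final P)
    (hmin : ∀ t < δ.applies, ¬ CanTerm P M t (initAtoms G) (initEqns G) M)
    {t : Tree} {R : Multiset Label} (ht : Sub t F R) {σ : List Label} (hσ : t.IsPath σ) :
    ∃ l : List Tree, l.map Tree.root = σ ∧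
      PathRuns P M G ((occurringConsts P G).toFinset : Finset Const)
        ((sigs P G).toFinset : Finset _) δ.applies (Bad c.eqs) l := by
  obtain ⟨l, hl, hpw, hsub, -⟩ := hσ.exists_subtrees ht
  refine ⟨l, hl, hpw, fun t ht k id i hroot => ?_, hmin, fun t ht hroot => ?_⟩
  · obtain ⟨R, hR⟩ := hsub t ht
    obtain ⟨E, ch, hrun, hlast⟩ := hF.nodeRun (program_inSig P G) hMP hMG (initial_inSig P G) hfin
      hmin hR hroot
    refine ⟨E, ch, hrun, ?_⟩
    rw [hlast]
    exact bad_iff_pat.symm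
  · obtain ⟨R, hR⟩ := hsub t ht
    have h := (hF.sons_le (d := (P.map fun r => r.body.length).foldr max 0)
      (fun r hr => le_foldr_max (List.mem_map.2 ⟨r, hr, rfl⟩)) hR).2 hroot
    obtain ⟨a, ss⟩ := t
    obtain rfl : ss = [] := h
    rfl

theorem IsForestOf.exists_repetitive_le {P : Program} {M : ℕ} {G : Goal}
    (hMP : ∀ r ∈ P, ∀ x ∈ r.vars, x < M) (hMG : ∀ c ∈ G, ∀ x ∈ c.vars, x < M)
    {c : Config} {δ : Computation P G c} {F : Forest} (hF : IsForestOf δ F) (hfin : c.Final P)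
    (hmin : ∀ t < δ.applies, ¬ CanTerm P M t (initAtoms G) (initEqns G) M) :
    ∃ m, F.Repetitive m ∧ m ≤ bound (numConsts P G) (maxArity P G) := by
  have hle : ∀ p ∈ {p | ∃ σ, Forest.IsScComputation F σ ∧ ScRepetitive σ p},
      p ≤ bound (numConsts P G) (maxArity P G) := by
    rintro p ⟨σ, ⟨t, ht, hσ⟩, ⟨k, id, i, hk, rfl⟩, -⟩
    obtain ⟨l, rfl, hl⟩ := hF.pathRuns hMP hMG hfin hmin (exists_sub_of_mem ht).choose_spec hσ
    exact hl.ncard_repsEqualTo_le (program_inSig P G) hMP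
      (fun p n h => arity_le_maxArity (List.mem_toFinset.1 h)) hk
  obtain h0 | hne := Set.eq_empty_or_nonempty
    {p | ∃ σ, Forest.IsScComputation F σ ∧ ScRepetitive σ p}
  · refine ⟨0, ?_, Nat.zero_le _⟩
    rw [Forest.Repetitive, h0]
    exact isLUB_empty
  · exact ⟨_, isLUB_csSup hne ⟨_, hle⟩, csSup_le hne hle⟩

/-- A bound for the number of inner nodes of a forest of at most `s` trees whose nodes have at most
`s + 1` sons each, when paths are as short as in `PathRuns.length_le` for at most `s` predicate
symbols. -/
def sizeBound (s u w : ℕ) : ℕ :=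
  s * (s + 2) ^ (bound u w * (s * 2 ^ (w * (u + w))) + 1)

theorem bound_mono {u u' : ℕ} (h : u ≤ u') (w : ℕ) : bound u w ≤ bound u' w := by
  unfold bound
  gcongr
  norm_num

theorem IsForestOf.applies_le {P : Program} {M : ℕ} {G : Goal}
    (hMP : ∀ r ∈ P, ∀ x ∈ r.vars, x < M) (hMG : ∀ c ∈ G, ∀ x ∈ c.vars, x < M)
    {c : Config} {δ : Computation P G c} {F : Forest} (hF : IsForestOf δ F) (hfin : c.Final P)
    (hmin : ∀ t < δ.applies, ¬ CanTerm P M t (initAtoms G) (initEqns G) M) :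
    δ.applies ≤ sizeBound (P.flatMap Rule.body ++ G).length (occurringConsts P G).length
      (maxArity P G) := by
  set s := (P.flatMap Rule.body ++ G).length with hs
  have hG : (initAtoms G).length ≤ s := (List.length_filterMap_le _ _).trans (by simp [hs])
  have hbody : ∀ r ∈ P, r.body.length ≤ s := fun r hr => by
    have h : r.body.length ≤ (P.flatMap Rule.body).length :=
      by
      rw [List.length_flatMap]
      exact List.le_sum_of_mem (List.mem_map.2 ⟨r, hr, rfl⟩)
    simp only [hs, List.length_append]
    omega
  have hK : (sigs P G).toFinset.card ≤ s := (List.toFinset_card_le _).trans (by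
    rw [sigs, List.length_map]
    exact List.length_filterMap_le _ _)
  rw [← hF.leavesMatch.2, sizeBound]
  refine (innerList_le fun t ht => ?_).trans (Nat.mul_le_mul_right _ (hF.length_eq.trans_le hG))
  refine Tree.inner_le_pow (d := s + 1) (fun t R h => (hF.sons_le hbody h).1) _
    (exists_sub_of_mem ht).choose_spec fun σ hσ => ?_
  obtain ⟨l, rfl, hl⟩ := hF.pathRuns hMP hMG hfin hmin (exists_sub_of_mem ht).choose_spec hσ
  rw [List.length_map]
  have hu : (occurringConsts P G).toFinset.card ≤ (occurringConsts P G).length :=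
    List.toFinset_card_le _
  refine (hl.length_le (program_inSig P G) hMP
    fun p n h => arity_le_maxArity (List.mem_toFinset.1 h)).trans ?_
  gcongr
  · exact bound_mono hu _
  · norm_num

/-! ### Deciding entailment and applicability -/

/-- Replace by `p.2` what is `p.1`, for the members `p` of the list, the last one first. -/
def replaceAll (σ : List (Term × Term)) (s : Term) : Term :=
  σ.foldr (fun p s => if s = p.1 then p.2 else s) s

/-- Replacements that map terms to representatives of their classes modulo `B`. -/
def solution (B : List Eqn) : List (Term × Term) :=
  B.foldr (fun e σ => (replaceAll σ e.lhs, replaceAll σ e.rhs) :: σ) []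

theorem replaceAll_solution_cons (e : Eqn) (B : List Eqn) (s : Term) :
    replaceAll (solution (e :: B)) s =
      if replaceAll (solution B) s = replaceAll (solution B) e.lhs then
        replaceAll (solution B) e.rhs else replaceAll (solution B) s := rfl

theorem replaceAll_solution_eq_iff {B : List Eqn} {s t : Term} :
    replaceAll (solution B) s = replaceAll (solution B) t ↔ Rel {e | e ∈ B} s t := by
  induction B generalizing s t with
  | nil =>
    have h : {e : Eqn | e ∈ ([] : List Eqn)} = ∅ := by simp
    rw [h, rel_empty]
    rfl
  | cons e B ih =>
    have hsub : {e' | e' ∈ B} ⊆ {e' | e' ∈ e :: B} := fun _ h => List.mem_cons_of_mem _ h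
    have he : Rel {e' | e' ∈ e :: B} e.lhs e.rhs :=
      .of_mem (show e ∈ {e' | e' ∈ e :: B} from List.mem_cons_self)
    constructor
    · intro h
      rw [replaceAll_solution_cons, replaceAll_solution_cons] at h
      split_ifs at h with h1 h2 h2
      · exact ((ih.1 h1).mono hsub).trans ((ih.1 h2).mono hsub).symm
      · exact ((ih.1 h1).mono hsub).trans (he.trans ((ih.1 h).mono hsub))
      · exact ((ih.1 h).mono hsub).trans (he.symm.trans ((ih.1 h2).mono hsub).symm)
      · exact (ih.1 h).mono hsub
    · intro h
      refine h.lift (Q := fun s t => replaceAll (solution (e :: B)) s =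
        replaceAll (solution (e :: B)) t) (fun e' he' => ?_) (fun _ => rfl) (fun _ _ h => h.symm)
        fun _ _ _ h h' => h.trans h'
      rw [replaceAll_solution_cons, replaceAll_solution_cons]
      obtain rfl | he' := List.mem_cons.1 he'
      · rw [if_pos rfl]
        split <;> rfl
      · rw [ih.2 (.of_mem (show e' ∈ {e | e ∈ B} from he'))]

/-- A list of equations is contradictory if it identifies two of its constants. -/
theorem bad_list_iff {B : List Eqn} : Bad {e | e ∈ B} ↔ ∃ c ∈ B.flatMap Eqn.consts,
    ∃ d ∈ B.flatMap Eqn.consts, c ≠ d ∧ Rel {e | e ∈ B} (.const c) (.const d) := by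
  refine ⟨?_, fun ⟨c, _, d, _, h⟩ => ⟨c, d, h⟩⟩
  rintro ⟨c, d, hcd, h⟩
  have hmem : ∀ c : Const, (∃ e ∈ {e | e ∈ B}, .const c = e.lhs ∨ .const c = e.rhs) →
      c ∈ B.flatMap Eqn.consts := by
    rintro c ⟨e, he, hc⟩
    refine List.mem_flatMap.2 ⟨e, he, List.mem_append.2 (hc.imp (fun hc => ?_) fun hc => ?_)⟩ <;>
      rw [← hc] <;> exact List.mem_singleton_self c
  obtain he | ⟨h1, h2⟩ := h.eq_or_mem
  · exact absurd (Term.const.inj he) hcd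
  · exact ⟨c, hmem c h1, d, hmem d h2, hcd, h⟩

/-- An equation that is not entailed is violated by a solution. -/
theorem exists_separating {B : Set Eqn} (hB : ¬ Bad B) {s t : Term} (h : ¬ Rel B s t) :
    ∃ v : Var → Const, (∀ e ∈ B, e.Holds v) ∧ s.eval v ≠ t.eval v := by
  classical
  have huniq : ∀ {u : Term} {c d : Const}, Rel B u (.const c) → Rel B u (.const d) → c = d :=
    fun hc hd => by_contra fun hcd => hB ⟨_, _, hcd, hc.symm.trans hd⟩
  -- The class of `s` gets the value `a`, and all others get `b`, except for those with a constant.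
  obtain ⟨a, b, hab, ha, hb⟩ : ∃ a b : Const, a ≠ b ∧ (∀ c, Rel B t (.const c) → a ≠ c) ∧
      ∀ c, Rel B s (.const c) → b ≠ c := by
    by_cases hs : ∃ c, Rel B s (.const c)
    · obtain ⟨c, hc⟩ := hs
      by_cases ht : ∃ c, Rel B t (.const c)
      · obtain ⟨d, hd⟩ := ht
        refine ⟨c + d + 1, c + d + 2, by simp, fun c' hc' => ?_, fun c' hc' => ?_⟩
        · rw [huniq hc' hd]; exact (Nat.lt_succ_of_le (Nat.le_add_left d c)).ne'
        · rw [huniq hc' hc]; exact (Nat.lt_of_lt_of_le (Nat.lt_succ_self c)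
            (Nat.add_le_add (Nat.le_add_right c d) one_le_two)).ne'
      · refine ⟨c, c + 1, (Nat.lt_succ_self c).ne, fun c' hc' => absurd ⟨c', hc'⟩ ht,
          fun c' hc' => ?_⟩
        rw [huniq hc' hc]; exact (Nat.lt_succ_self c).ne'
    · by_cases ht : ∃ c, Rel B t (.const c)
      · obtain ⟨d, hd⟩ := ht
        refine ⟨d + 1, d, (Nat.lt_succ_self d).ne', fun c' hc' => ?_,
          fun c' hc' => absurd ⟨c', hc'⟩ hs⟩
        rw [huniq hc' hd]; exact (Nat.lt_succ_self d).ne'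
      · exact ⟨0, 1, zero_ne_one, fun c' hc' => absurd ⟨c', hc'⟩ ht,
          fun c' hc' => absurd ⟨c', hc'⟩ hs⟩
  let val (u : Term) : Const :=
    if h : ∃ c, Rel B u (.const c) then h.choose else if Rel B u s then a else b
  have hval : ∀ {u c}, Rel B u (.const c) → val u = c := fun {u c} hc => by
    have hex : ∃ c, Rel B u (.const c) := ⟨c, hc⟩
    simp only [val, dif_pos hex]
    exact huniq hex.choose_spec hc
  have heval : ∀ u : Term, u.eval (fun x => val (.var x)) = val u := by
    rintro (x | c)
    · rfl
    · exact (hval (.refl _)).symm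
  refine ⟨fun x => val (.var x), fun e he => ?_, ?_⟩
  · rw [Eqn.Holds, heval, heval]
    by_cases hex : ∃ c, Rel B e.lhs (.const c)
    · obtain ⟨c, hc⟩ := hex
      rw [hval hc, hval ((Rel.of_mem he).symm.trans hc)]
    · have hex' : ¬ ∃ c, Rel B e.rhs (.const c) := fun ⟨c, hc⟩ => hex ⟨c, (Rel.of_mem he).trans hc⟩
      have hiff : Rel B e.lhs s ↔ Rel B e.rhs s :=
        ⟨fun h => (Rel.of_mem he).symm.trans h, fun h => (Rel.of_mem he).trans h⟩
      simp only [val, dif_neg hex, dif_neg hex', hiff]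
  · rw [heval, heval]
    have hts : ¬ Rel B t s := fun h' => h h'.symm
    by_cases hs : ∃ c, Rel B s (.const c)
    · obtain ⟨c, hc⟩ := hs
      by_cases ht : ∃ c, Rel B t (.const c)
      · obtain ⟨d, hd⟩ := ht
        rw [hval hc, hval hd]
        rintro rfl
        exact h (hc.trans hd.symm)
      · rw [hval hc, show val t = b by simp only [val, dif_neg ht, if_neg hts]]
        exact (hb c hc).symm
    · have hsa : val s = a := by simp only [val, dif_neg hs, if_pos (Rel.refl (B := B) s)]
      rw [hsa]
      by_cases ht : ∃ c, Rel B t (.const c)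
      · obtain ⟨d, hd⟩ := ht
        rw [hval hd]
        exact ha d hd
      · rw [show val t = b by simp only [val, dif_neg ht, if_neg hts]]
        exact hab

/-- The matching of `k` with the head of `r`, and the guard of `r`, with variables from `n` on. -/
def Rule.conditions (r : Rule) (n : ℕ) (k : Atom) : List Eqn :=
  matching k (r.head.sub (shift n)) ++ r.guard.map (Eqn.sub (shift n))

theorem Term.eval_shift {n : ℕ} {v y : Var → Const} (t : Term) :
    (t.sub (shift n)).eval (fun x => if x < n then v x else y (x - n)) = t.eval y := by
  cases t with
  | var x =>
    have h : ¬ x + n < n := (Nat.le_add_left n x).not_gt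
    change (if x + n < n then v (x + n) else y (x + n - n)) = y x
    rw [if_neg h]
    exact congrArg y (Nat.add_sub_cancel x n)
  | const c => rfl

/-- A rule is applicable to `k` if its conditions entail no further equations between
the arguments of `k` and constants. -/
theorem firesPat_iff {r : Rule} {k : Atom} {B : List Eqn} {n : ℕ} (hB : ¬ Bad {e | e ∈ B})
    (hl : k.args.length = r.head.args.length) (hk : ∀ x ∈ k.vars, x < n)
    (hn : ∀ e ∈ B, ∀ x ∈ e.vars, x < n) :
    FiresPat r (pat k.args {e | e ∈ B}) ↔
      pat k.args {e | e ∈ r.conditions n k ++ B} ⊆ pat k.args {e | e ∈ B} := by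
  constructor
  · rintro hf ⟨x, y⟩ ⟨s, t, hs, ht, hst⟩
    by_contra hxy
    have hst' : ¬ Rel {e | e ∈ B} s t := fun h => hxy ⟨s, t, hs, ht, .inl h⟩
    obtain ⟨v, hv, hne⟩ := exists_separating hB hst'
    let vals (i : ℕ) : Const := ((k.args[i]?).getD (.const 0)).eval v
    have hvals : ∀ i s, k.args[i]? = some s → s.eval v = vals i := fun i s hs => by
      simp only [vals, hs, Option.getD_some]
    obtain ⟨z, hz, hguard⟩ := hf vals (respects_of_holds hB hv hvals)
    set w : Var → Const := fun x => if x < n then v x else z (x - n) with hw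
    have hlow : ∀ u : Term, (∀ x ∈ u.vars, x < n) → u.eval w = u.eval v := fun u hu =>
      Term.eval_congr fun x hx => if_pos (hu x hx)
    have hport : ∀ {x u}, tm k.args x = some u → u.eval w = u.eval v := by
      rintro (i | c) u hu
      · exact hlow u fun x hx => hk x (Atom.mem_vars.2 ⟨i, u, hu, hx⟩)
      · obtain rfl : Term.const c = u := Option.some.inj hu
        rfl
    have hall : ∀ e ∈ {e | e ∈ r.conditions n k ++ B}, e.Holds w := by
      intro e he
      obtain he | he := List.mem_append.1 he
      · obtain he | he := List.mem_append.1 he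
        · obtain ⟨i, h1, h2⟩ := mem_matching.1 he
          rw [Atom.sub_args, List.getElem?_map, Option.map_eq_some_iff] at h2
          obtain ⟨u, hu, heq⟩ := h2
          rw [Eqn.Holds, ← heq, Term.eval_shift, hz i u hu, ← hvals i _ h1]
          exact hport (x := .inl i) h1
        · obtain ⟨e', he', rfl⟩ := List.mem_map.1 he
          exact (Term.eval_shift _).trans ((hguard e' he').trans (Term.eval_shift _).symm)
      · have h := hv e he
        rw [Eqn.Holds, hlow _ fun x hx => hn e he x (List.mem_append_left _ hx),
          hlow _ fun x hx => hn e he x (List.mem_append_right _ hx)]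
        exact h
    have hnb : ¬ Bad {e | e ∈ r.conditions n k ++ B} := fun ⟨c, d, hcd, h⟩ => hcd (h.eval hall)
    have heq := (hst.rel hnb).eval hall
    rw [hport hs, hport ht] at heq
    exact hne heq
  · intro hsub vals hvals
    obtain ⟨v, hv, hq⟩ := exists_valuation fun x y hxy => hvals x y (hsub hxy)
    have hshift : ∀ t : Term, t.eval (fun x => v (x + n)) = (t.sub (shift n)).eval v := by
      rintro (x | c) <;> rfl
    refine ⟨fun x => v (x + n), fun i t ht => ?_, fun e he => ?_⟩
    · have hi : i < k.args.length := hl ▸ (List.getElem?_eq_some_iff.1 ht).1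
      have hki : k.args[i]? = some k.args[i] := List.getElem?_eq_getElem hi
      rw [hshift, ← hq i _ hki]
      refine (hv ⟨k.args[i], t.sub (shift n)⟩ (List.mem_append_left _ (List.mem_append_left _
        (mem_matching.2 ⟨i, hki, ?_⟩)))).symm
      rw [Atom.sub_args, List.getElem?_map, ht]
      rfl
    · have h := hv (e.sub (shift n)) (List.mem_append_left _ (List.mem_append_right _
        (List.mem_map.2 ⟨e, he, rfl⟩)))
      exact (hshift _).trans (Eq.trans h (hshift _).symm)

/-- To compare entailed equations, finitely many pairs of terms are enough. -/
theorem pat_subset_iff {q : List Term} {B C : List Eqn} (hB : ¬ Bad {e | e ∈ B}) :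
    pat q {e | e ∈ C} ⊆ pat q {e | e ∈ B} ↔ ¬ Bad {e | e ∈ C} ∧
      ∀ s ∈ q, ∀ t ∈ q ++ (C.flatMap Eqn.consts).map .const,
        ¬ Rel {e | e ∈ C} s t ∨ Rel {e | e ∈ B} s t := by
  constructor
  · intro h
    have hC : ¬ Bad {e | e ∈ C} := fun hb => hB (bad_iff_pat.2 (h (bad_iff_pat.1 hb)))
    refine ⟨hC, fun s hs t ht => or_iff_not_imp_left.2 fun hst => ?_⟩
    obtain ⟨i, hi⟩ := List.mem_iff_getElem?.1 hs
    obtain ⟨y, hy⟩ : ∃ y, tm q y = some t := by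
      obtain ht | ht := List.mem_append.1 ht
      · obtain ⟨j, hj⟩ := List.mem_iff_getElem?.1 ht
        exact ⟨.inl j, hj⟩
      · obtain ⟨c, -, rfl⟩ := List.mem_map.1 ht
        exact ⟨.inr c, rfl⟩
    have hx : tm q (.inl i) = some s := hi
    exact ((pat_iff hx hy).1 (h ((pat_iff hx hy).2 (.inl (not_not.1 hst))))).rel hB
  · rintro ⟨hC, h⟩ ⟨x, y⟩ ⟨s, t, hs, ht, hst⟩
    have hst := hst.rel hC
    refine ⟨s, t, hs, ht, .inl ?_⟩
    have hconst : ∀ s ∈ q, ∀ c, Rel {e | e ∈ C} s (.const c) → Rel {e | e ∈ B} s (.const c) := by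
      intro s hs c hc
      obtain rfl | ⟨-, e, he, hce⟩ := hc.eq_or_mem
      · exact .refl _
      refine (h s hs _ (List.mem_append_right _ (List.mem_map.2 ⟨c, List.mem_flatMap.2
        ⟨e, he, List.mem_append.2 (hce.imp (fun hc => ?_) fun hc => ?_)⟩, rfl⟩))).resolve_left
        (not_not.2 hc) <;> rw [← hc] <;> exact List.mem_singleton_self c
    cases x with
    | inl i =>
      have hsq := List.mem_of_getElem? hs
      cases y with
      | inl j =>
        have htq : t ∈ q := List.mem_of_getElem? ht
        exact (h s hsq t (List.mem_append_left _ htq)).resolve_left (not_not.2 hst)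
      | inr d =>
        obtain rfl : Term.const d = t := Option.some.inj ht
        exact hconst s hsq d hst
    | inr c =>
      obtain rfl : Term.const c = s := Option.some.inj hs
      cases y with
      | inl j => exact (hconst t (List.mem_of_getElem? ht) c hst.symm).symm
      | inr d =>
        obtain rfl : Term.const d = t := Option.some.inj ht
        obtain rfl : c = d := by_contra fun hcd => hC ⟨c, d, hcd, hst⟩
        exact .refl _

/-- A number greater than all variables of `k` and `B`. -/
def freshFrom (k : Atom) (B : List Eqn) : ℕ := (k.vars ++ B.flatMap Eqn.vars).foldr max 0 + 1

/-- `B` is not contradictory, and `r` is applicable to `k`. -/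
def Active (r : Rule) (k : Atom) (B : List Eqn) : Prop := ¬ Bad {e | e ∈ B} ∧ Fires r k {e | e ∈ B}

theorem active_iff {r : Rule} {k : Atom} {B : List Eqn} : Active r k B ↔
    ¬ Bad {e | e ∈ B} ∧ k.pred = r.head.pred ∧ k.args.length = r.head.args.length ∧
      ¬ Bad {e | e ∈ r.conditions (freshFrom k B) k ++ B} ∧
      ∀ s ∈ k.args, ∀ t ∈
        k.args ++ ((r.conditions (freshFrom k B) k ++ B).flatMap Eqn.consts).map .const,
        ¬ Rel {e | e ∈ r.conditions (freshFrom k B) k ++ B} s t ∨ Rel {e | e ∈ B} s t := by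
  refine and_congr_right fun hB => and_congr_right fun hp => and_congr_right fun hl => ?_
  rw [firesPat_iff (n := freshFrom k B) hB hl, pat_subset_iff hB]
  · exact fun x hx => Nat.lt_succ_of_le (le_foldr_max (List.mem_append_left _ hx))
  · exact fun e he x hx => Nat.lt_succ_of_le (le_foldr_max
      (List.mem_append_right _ (List.mem_flatMap.2 ⟨e, he, hx⟩)))

/-! ### A search for eager derivations -/

/-- Constraints and equations of a state of an eager derivation, and a number which is greater than
all of its variables. -/
abbrev State := List Atom × List Eqn × ℕ

/-- The state after the application of `r` to `k`. -/
def State.apply (M : ℕ) (S : State) (k : Atom) (r : Rule) : State :=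
  (r.kids (shift S.2.2) k ++ S.1.erase k, r.told (shift S.2.2) k ++ S.2.1, S.2.2 + M)

open Classical in
/-- The states that follow after one step; there are none for a contradictory state. -/
noncomputable def successors (P : Program) (M : ℕ) (S : State) : List State :=
  S.1.flatMap fun k => P.flatMap fun r => if Active r k S.2.1 then [S.apply M k r] else []

/-- The states that are reached from members of `L` by at most `t` steps. -/
noncomputable def reachable (P : Program) (M t : ℕ) (L : List State) : List State :=
  (fun L => L.flatMap (successors P M) ++ L)^[t] L

theorem mem_successors {P : Program} {M : ℕ} {S S' : State} : S' ∈ successors P M S ↔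
    ∃ k ∈ S.1, ∃ r ∈ P, Active r k S.2.1 ∧ S' = S.apply M k r := by
  simp [successors]

theorem exists_reachable_iff {P : Program} {M t : ℕ} {L : List State} :
    (∃ S ∈ reachable P M t L, Terminal P S.1 {e | e ∈ S.2.1}) ↔
      ∃ S ∈ L, CanTerm P M t S.1 S.2.1 S.2.2 := by
  induction t generalizing L with
  | zero =>
    refine exists_congr fun S => and_congr_right fun _ => ⟨.done, fun h => ?_⟩
    cases h with
    | done h => exact h
  | succ t ih =>
    rw [reachable, Function.iterate_succ_apply, ← reachable, ih]
    constructor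
    · rintro ⟨S', hS', h⟩
      obtain hS' | hS' := List.mem_append.1 hS'
      · obtain ⟨S, hS, hS'⟩ := List.mem_flatMap.1 hS'
        obtain ⟨k, hk, r, hr, hact, rfl⟩ := mem_successors.1 hS'
        exact ⟨S, hS, .step k r hk hr hact.2 h⟩
      · exact ⟨S', hS', h.mono (Nat.le_succ t)⟩
    · rintro ⟨⟨A, B, n⟩, hS, h⟩
      cases h with
      | done h => exact ⟨_, List.mem_append_right _ hS, .done h⟩
      | step k r hk hr hf h =>
        by_cases hbad : Bad {e | e ∈ B}
        · exact ⟨_, List.mem_append_right _ hS, .done (.inl hbad)⟩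
        · exact ⟨_, List.mem_append_left _ (List.mem_flatMap.2
            ⟨_, hS, mem_successors.2 ⟨k, hk, r, hr, ⟨hbad, hf⟩, rfl⟩⟩), h⟩

theorem terminal_iff {P : Program} {A : List Atom} {B : List Eqn} :
    Terminal P A {e | e ∈ B} ↔ Bad {e | e ∈ B} ∨ ∀ k ∈ A, ∀ r ∈ P, ¬ Active r k B := by
  by_cases hbad : Bad {e | e ∈ B}
  · simp [Terminal, hbad]
  · simp [Terminal, hbad, Active]

/-- A number greater than all variables of `P` and `G`. -/
def varBound (P : Program) (G : Goal) : ℕ :=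
  (P.flatMap Rule.vars ++ G.flatMap Constraint.vars).foldr max 0 + 1

theorem lt_varBound {P : Program} {G : Goal} : (∀ r ∈ P, ∀ x ∈ r.vars, x < varBound P G) ∧
    ∀ c ∈ G, ∀ x ∈ c.vars, x < varBound P G :=
  ⟨fun r hr _ hx => Nat.lt_succ_of_le (le_foldr_max (List.mem_append_left _
      (List.mem_flatMap.2 ⟨r, hr, hx⟩))),
    fun c hc _ hx => Nat.lt_succ_of_le (le_foldr_max (List.mem_append_right _
      (List.mem_flatMap.2 ⟨c, hc, hx⟩)))⟩

/-- A bound for the number of applications in a shortest terminating computation for `G` in `P`, see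
`IsForestOf.applies_le`. -/
def stepBound (P : Program) (G : Goal) : ℕ :=
  sizeBound (P.flatMap Rule.body ++ G).length (occurringConsts P G).length (maxArity P G)

theorem hasTerminatingComputation_iff {P : Program} {G : Goal} :
    HasTerminatingComputation P G ↔
      ∃ S ∈ reachable P (varBound P G) (stepBound P G) [(initAtoms G, initEqns G, varBound P G)],
        Terminal P S.1 {e | e ∈ S.2.1} := by
  obtain ⟨hP, hG⟩ := lt_varBound (P := P) (G := G)
  rw [exists_reachable_iff]
  constructor
  · intro h
    obtain ⟨c, δ, hfin, hmin⟩ := exists_shortest hP hG h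
    obtain ⟨F, hF⟩ := exists_isForestOf δ
    exact ⟨_, List.mem_singleton_self _,
      (hfin.canTerm hP hG δ).mono (hF.applies_le hP hG hfin hmin)⟩
  · rintro ⟨S, hS, h⟩
    obtain rfl := List.mem_singleton.1 hS
    obtain ⟨c, δ, hfin, -⟩ := h.exists_final hP hG
    exact ⟨c, δ, hfin⟩

/-! ### The search is primitive recursive -/

section Computability

open Primrec

variable {α β σ : Type*} [Primcodable α] [Primcodable β] [Primcodable σ]

theorem primrec_sum_elim {γ δ : Type*} [Primcodable γ] [Primcodable δ] {f : α → γ ⊕ δ}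
    {g : α → γ → σ} {h : α → δ → σ} (hf : Primrec f) (hg : Primrec₂ g) (hh : Primrec₂ h) :
    Primrec fun a => Sum.elim (g a) (h a) (f a) :=
  (sumCasesOn hf hg hh).of_eq fun a => by cases f a <;> rfl

theorem primrec_termEquiv : Primrec Term.equiv := of_equiv

theorem primrec_var : Primrec Term.var := (of_equiv_symm (e := Term.equiv)).comp sumInl

theorem primrec_const : Primrec Term.const := (of_equiv_symm (e := Term.equiv)).comp sumInr

theorem primrec_lhs : Primrec Eqn.lhs := fst.comp (of_equiv (e := Eqn.equiv))

theorem primrec_rhs : Primrec Eqn.rhs := snd.comp (of_equiv (e := Eqn.equiv))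

theorem primrec_eqn_mk : Primrec₂ Eqn.mk := of_equiv_symm (e := Eqn.equiv)

theorem primrec_pred : Primrec Atom.pred := fst.comp (of_equiv (e := Atom.equiv))

theorem primrec_args : Primrec Atom.args := snd.comp (of_equiv (e := Atom.equiv))

theorem primrec_atom_mk : Primrec₂ Atom.mk := of_equiv_symm (e := Atom.equiv)

theorem primrec_constraintEquiv : Primrec Constraint.equiv := of_equiv

theorem primrec_ruleEquiv : Primrec Rule.equiv := of_equiv

theorem primrec_propagation : Primrec Rule.propagation := fst.comp primrec_ruleEquiv

theorem primrec_head : Primrec Rule.head := fst.comp (snd.comp primrec_ruleEquiv)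

theorem primrec_guard : Primrec Rule.guard := fst.comp (snd.comp (snd.comp primrec_ruleEquiv))

theorem primrec_body : Primrec Rule.body := snd.comp (snd.comp (snd.comp primrec_ruleEquiv))

theorem primrec_term_vars : Primrec Term.vars :=
  (primrec_sum_elim (g := fun _ x => [x]) (h := fun _ _ => []) primrec_termEquiv
    (list_cons.comp snd (const [])) (const [])).of_eq fun t => by cases t <;> rfl

theorem primrec_term_consts : Primrec Term.consts :=
  (primrec_sum_elim (g := fun _ _ => []) (h := fun _ x => [x]) primrec_termEquiv
    (const []) (list_cons.comp snd (const []))).of_eq fun t => by cases t <;> rfl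

theorem primrec_atom_vars : Primrec Atom.vars :=
  list_flatMap primrec_args (primrec_term_vars.comp snd)

theorem primrec_atom_consts : Primrec Atom.consts :=
  list_flatMap primrec_args (primrec_term_consts.comp snd)

theorem primrec_eqn_vars : Primrec Eqn.vars :=
  list_append.comp (primrec_term_vars.comp primrec_lhs) (primrec_term_vars.comp primrec_rhs)

theorem primrec_eqn_consts : Primrec Eqn.consts :=
  list_append.comp (primrec_term_consts.comp primrec_lhs) (primrec_term_consts.comp primrec_rhs)

theorem primrec_constraint_vars : Primrec Constraint.vars :=
  (primrec_sum_elim primrec_constraintEquiv (primrec_eqn_vars.comp₂ .right)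
    (primrec_atom_vars.comp₂ .right)).of_eq fun c => by cases c <;> rfl

theorem primrec_constraint_consts : Primrec Constraint.consts :=
  (primrec_sum_elim primrec_constraintEquiv (primrec_eqn_consts.comp₂ .right)
    (primrec_atom_consts.comp₂ .right)).of_eq fun c => by cases c <;> rfl

theorem primrec_chrArity : Primrec Constraint.chrArity :=
  (primrec_sum_elim primrec_constraintEquiv (.const 0)
    (list_length.comp₂ (primrec_args.comp₂ .right))).of_eq fun c => by cases c <;> rfl

theorem primrec_toAtom? : Primrec Constraint.toAtom? :=
  (primrec_sum_elim primrec_constraintEquiv (.const none)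
    (option_some.comp₂ .right)).of_eq fun c => by cases c <;> rfl

theorem primrec_toEqn? : Primrec Constraint.toEqn? :=
  (primrec_sum_elim primrec_constraintEquiv (option_some.comp₂ .right)
    (.const none)).of_eq fun c => by cases c <;> rfl

theorem primrec_rule_vars : Primrec Rule.vars :=
  list_append.comp (list_append.comp (primrec_atom_vars.comp primrec_head)
    (list_flatMap primrec_guard (primrec_eqn_vars.comp snd)))
    (list_flatMap primrec_body (primrec_constraint_vars.comp snd))

theorem primrec_rule_consts : Primrec Rule.consts :=
  list_append.comp (list_append.comp (primrec_atom_consts.comp primrec_head)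
    (list_flatMap primrec_guard (primrec_eqn_consts.comp snd)))
    (list_flatMap primrec_body (primrec_constraint_consts.comp snd))

theorem primrec_rule_arities : Primrec Rule.arities :=
  list_cons.comp (list_length.comp (primrec_args.comp primrec_head))
    (list_map primrec_body (primrec_chrArity.comp snd))

theorem primrec_shift_term : Primrec₂ fun (n : ℕ) (t : Term) => t.sub (shift n) :=
  (primrec_sum_elim (g := fun (p : ℕ × Term) (x : ℕ) => Term.var (x + p.1)) (h := fun _ c => Term.const c)
    (primrec_termEquiv.comp snd) (primrec_var.comp (nat_add.comp snd (fst.comp fst)))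
    (primrec_const.comp snd)).of_eq fun ⟨n, t⟩ => by cases t <;> rfl

theorem primrec_shift_atom : Primrec₂ fun (n : ℕ) (k : Atom) => k.sub (shift n) :=
  primrec_atom_mk.comp (primrec_pred.comp snd)
    (list_map (primrec_args.comp snd) (primrec_shift_term.comp (fst.comp fst) snd))

theorem primrec_shift_eqn : Primrec₂ fun (n : ℕ) (e : Eqn) => e.sub (shift n) :=
  primrec_eqn_mk.comp (primrec_shift_term.comp fst (primrec_lhs.comp snd))
    (primrec_shift_term.comp fst (primrec_rhs.comp snd))

theorem primrec_matching : Primrec₂ matching := by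
  have h : Primrec fun p : Atom × Atom => (List.range p.1.args.length).filterMap fun i =>
      (p.1.args[i]?).bind fun s => (p.2.args[i]?).map fun t => Eqn.mk s t :=
    listFilterMap (list_range.comp (list_length.comp (primrec_args.comp fst)))
      (option_bind (list_getElem?.comp (primrec_args.comp (fst.comp fst)) snd)
        (option_map (list_getElem?.comp (primrec_args.comp (snd.comp (fst.comp fst)))
          (snd.comp fst)) (primrec_eqn_mk.comp (snd.comp fst) snd)))
  refine h.of_eq fun ⟨k, h⟩ => ?_
  unfold matching
  generalize k.args = q
  generalize h.args = q'
  induction q generalizing q' with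
  | nil => simp
  | cons s q ih =>
    rw [List.length_cons, List.range_succ_eq_map, List.filterMap_cons, List.filterMap_map]
    cases q' with
    | nil => simp
    | cons t q' => simpa [Function.comp_def] using ih q'

theorem primrec_conditions : Primrec fun p : Rule × ℕ × Atom => p.1.conditions p.2.1 p.2.2 :=
  list_append.comp
    (primrec_matching.comp (snd.comp snd)
      (primrec_shift_atom.comp (fst.comp snd) (primrec_head.comp fst)))
    (list_map (primrec_guard.comp fst) (primrec_shift_eqn.comp (fst.comp (snd.comp fst)) snd))

theorem primrec_kids : Primrec fun p : Rule × ℕ × Atom => p.1.kids (shift p.2.1) p.2.2 := by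
  have h : Primrec fun p : Rule × ℕ × Atom =>
      (if p.1.propagation = true then [p.2.2] else []) ++
        p.1.body.filterMap fun c => c.toAtom?.map fun k => k.sub (shift p.2.1) :=
    list_append.comp
      (.ite (Primrec.eq.comp (primrec_propagation.comp fst) (const true))
        (list_cons.comp (snd.comp snd) (const [])) (const []))
      (listFilterMap (primrec_body.comp fst) (option_map (primrec_toAtom?.comp snd)
        (primrec_shift_atom.comp (fst.comp (snd.comp (fst.comp fst))) snd)))
  exact h.of_eq fun p => by simp only [Rule.kids, Constraint.toAtom?_sub]

theorem primrec_told : Primrec fun p : Rule × ℕ × Atom => p.1.told (shift p.2.1) p.2.2 := by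
  have h : Primrec fun p : Rule × ℕ × Atom => matching p.2.2 (p.1.head.sub (shift p.2.1)) ++
      p.1.body.filterMap fun c => c.toEqn?.map fun e => e.sub (shift p.2.1) :=
    list_append.comp
      (primrec_matching.comp (snd.comp snd)
        (primrec_shift_atom.comp (fst.comp snd) (primrec_head.comp fst)))
      (listFilterMap (primrec_body.comp fst) (option_map (primrec_toEqn?.comp snd)
        (primrec_shift_eqn.comp (fst.comp (snd.comp (fst.comp fst))) snd)))
  exact h.of_eq fun p => by simp only [Rule.told, Constraint.toEqn?_sub]

theorem primrec_replaceAll : Primrec₂ replaceAll :=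
  list_foldr (h := fun _ (p : (Term × Term) × Term) => if p.2 = p.1.1 then p.1.2 else p.2)
    fst snd (.ite (Primrec.eq.comp (snd.comp snd) (fst.comp (fst.comp snd)))
    (snd.comp (fst.comp snd)) (snd.comp snd))

theorem primrec_solution : Primrec solution :=
  list_foldr (h := fun _ (p : Eqn × List (Term × Term)) =>
    (replaceAll p.2 p.1.lhs, replaceAll p.2 p.1.rhs) :: p.2) .id (const []) (list_cons.comp (Primrec.pair
    (primrec_replaceAll.comp (snd.comp snd) (primrec_lhs.comp (fst.comp snd)))
    (primrec_replaceAll.comp (snd.comp snd) (primrec_rhs.comp (fst.comp snd)))) (snd.comp snd))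

theorem primrecPred_exists {f : α → List β} {R : α → β → Prop} (hf : Primrec f)
    (hR : PrimrecPred fun p : α × β => R p.1 p.2) : PrimrecPred fun a => ∃ b ∈ f a, R a b :=
  (PrimrecRel.exists_mem_list (R := fun b a => R a b)
    (hR.comp (Primrec.pair snd fst))).comp hf .id

theorem primrecPred_forall {f : α → List β} {R : α → β → Prop} (hf : Primrec f)
    (hR : PrimrecPred fun p : α × β => R p.1 p.2) : PrimrecPred fun a => ∀ b ∈ f a, R a b :=
  (PrimrecRel.forall_mem_list (R := fun b a => R a b)
    (hR.comp (Primrec.pair snd fst))).comp hf .id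

theorem primrecPred_rel {f : α → List Eqn} {g h : α → Term} (hf : Primrec f) (hg : Primrec g)
    (hh : Primrec h) : PrimrecPred fun a => Rel {e | e ∈ f a} (g a) (h a) :=
  (Primrec.eq.comp (primrec_replaceAll.comp (primrec_solution.comp hf) hg)
    (primrec_replaceAll.comp (primrec_solution.comp hf) hh)).of_eq
    fun _ => replaceAll_solution_eq_iff

theorem primrecPred_bad {f : α → List Eqn} (hf : Primrec f) :
    PrimrecPred fun a => Bad {e | e ∈ f a} := by
  have hc : Primrec fun a => (f a).flatMap Eqn.consts := list_flatMap hf (primrec_eqn_consts.comp snd)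
  refine (primrecPred_exists hc (primrecPred_exists (hc.comp fst) (.and (.not
    (Primrec.eq.comp (snd.comp fst) snd)) (primrecPred_rel (hf.comp (fst.comp fst))
      (primrec_const.comp (snd.comp fst)) (primrec_const.comp snd))))).of_eq
    fun a => bad_list_iff.symm

theorem primrec_foldr_max {f : α → List ℕ} (hf : Primrec f) :
    Primrec fun a => (f a).foldr max 0 :=
  list_foldr (h := fun _ p => max p.1 p.2) hf (const 0) (nat_max.comp (fst.comp snd) (snd.comp snd))

theorem primrecPred_active : PrimrecPred fun p : Rule × Atom × List Eqn =>
    Active p.1 p.2.1 p.2.2 := by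
  have hr : Primrec fun p : Rule × Atom × List Eqn => p.1 := fst
  have hk : Primrec fun p : Rule × Atom × List Eqn => p.2.1 := fst.comp snd
  have hB : Primrec fun p : Rule × Atom × List Eqn => p.2.2 := snd.comp snd
  have hn : Primrec fun p : Rule × Atom × List Eqn => freshFrom p.2.1 p.2.2 :=
    succ.comp (primrec_foldr_max (list_append.comp (primrec_atom_vars.comp hk)
      (list_flatMap hB (primrec_eqn_vars.comp snd))))
  have hC : Primrec fun p : Rule × Atom × List Eqn =>
      p.1.conditions (freshFrom p.2.1 p.2.2) p.2.1 ++ p.2.2 :=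
    list_append.comp (primrec_conditions.comp (Primrec.pair hr (Primrec.pair hn hk))) hB
  have hargs := primrec_args.comp hk
  refine (PrimrecPred.and (primrecPred_bad hB).not (.and (Primrec.eq.comp (primrec_pred.comp hk)
    (primrec_pred.comp (primrec_head.comp hr))) (.and (Primrec.eq.comp (list_length.comp hargs)
    (list_length.comp (primrec_args.comp (primrec_head.comp hr)))) (.and (primrecPred_bad hC).not
    (primrecPred_forall hargs (primrecPred_forall ((list_append.comp hargs (list_map
      (list_flatMap hC (primrec_eqn_consts.comp₂ .right)) (primrec_const.comp₂ .right))).comp fst)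
      (.or (.not (primrecPred_rel (hC.comp (fst.comp fst)) (snd.comp fst) snd))
        (primrecPred_rel (hB.comp (fst.comp fst)) (snd.comp fst) snd)))))))).of_eq
    fun p => active_iff.symm

theorem primrec_erase [DecidableEq α] : Primrec₂ fun (l : List α) (a : α) => l.erase a := by
  have h : Primrec fun p : List α × α => (List.recOn p.1 [] fun b l IH =>
      if b = p.2 then l else b :: IH : List α) :=
    list_rec (h := fun (a : List α × α) (p : α × List α × List α) =>
      if p.1 = a.2 then p.2.1 else p.1 :: p.2.2) fst (const []) (.ite (Primrec.eq.comp (fst.comp snd) (snd.comp fst))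
      (fst.comp (snd.comp snd)) (list_cons.comp (fst.comp snd) (snd.comp (snd.comp snd))))
  refine h.of_eq fun ⟨l, a⟩ => ?_
  induction l with
  | nil => rfl
  | cons b l ih =>
    change (if b = a then l else b :: _) = (b :: l).erase a
    rw [List.erase_cons]
    simp only [beq_iff_eq]
    split
    · rfl
    · exact congrArg (b :: ·) ih

theorem primrec_state_apply : Primrec fun p : ℕ × State × Atom × Rule =>
    p.2.1.apply p.1 p.2.2.1 p.2.2.2 := by
  have hM : Primrec fun p : ℕ × State × Atom × Rule => p.1 := fst
  have hS : Primrec fun p : ℕ × State × Atom × Rule => p.2.1 := fst.comp snd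
  have hk : Primrec fun p : ℕ × State × Atom × Rule => p.2.2.1 := fst.comp (snd.comp snd)
  have hr : Primrec fun p : ℕ × State × Atom × Rule => p.2.2.2 := snd.comp (snd.comp snd)
  have hn := snd.comp (snd.comp hS)
  have hq := Primrec.pair hr (Primrec.pair hn hk)
  exact Primrec.pair (list_append.comp (primrec_kids.comp hq) (primrec_erase.comp (fst.comp hS) hk))
    (Primrec.pair (list_append.comp (primrec_told.comp hq) (fst.comp (snd.comp hS)))
      (nat_add.comp hn hM))

open Classical in
theorem primrec_successors : Primrec fun p : (Program × ℕ) × State =>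
    successors p.1.1 p.1.2 p.2 :=
  list_flatMap (fst.comp snd) (list_flatMap (fst.comp (fst.comp fst))
    (.ite (primrecPred_active.comp (Primrec.pair snd (Primrec.pair (snd.comp fst)
      (fst.comp (snd.comp (snd.comp (fst.comp fst)))))))
      (list_cons.comp (primrec_state_apply.comp (Primrec.pair (snd.comp (fst.comp (fst.comp fst)))
        (Primrec.pair (snd.comp (fst.comp fst)) (Primrec.pair (snd.comp fst) snd)))) (const []))
      (const [])))

theorem primrec_expand : Primrec fun p : (Program × ℕ) × List State =>
    p.2.flatMap (successors p.1.1 p.1.2) ++ p.2 := by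
  have hL : Primrec fun q : (Program × ℕ) × List State => q.2 := snd
  have hS : Primrec fun r : ((Program × ℕ) × List State) × State =>
      successors r.1.1.1 r.1.1.2 r.2 :=
    primrec_successors.comp (Primrec.pair (fst.comp fst) snd)
  have h : Primrec fun q : (Program × ℕ) × List State =>
      q.2.flatMap fun S => successors q.1.1 q.1.2 S := list_flatMap hL hS.to₂
  exact list_append.comp h hL

theorem primrec_reachable : Primrec fun p : (Program × ℕ) × ℕ × List State =>
    reachable p.1.1 p.1.2 p.2.1 p.2.2 := by
  have hp : Primrec fun q : ((Program × ℕ) × ℕ × List State) × List State => (q.1.1, q.2) :=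
    Primrec.pair (fst.comp fst) snd
  have h : Primrec₂ fun (p : (Program × ℕ) × ℕ × List State) (L : List State) =>
      L.flatMap (successors p.1.1 p.1.2) ++ L := (primrec_expand.comp hp).to₂
  have hf : Primrec fun p : (Program × ℕ) × ℕ × List State => p.2.1 := fst.comp snd
  have hg : Primrec fun p : (Program × ℕ) × ℕ × List State => p.2.2 := snd.comp snd
  have h' : Primrec fun p : (Program × ℕ) × ℕ × List State =>
      (fun L => L.flatMap (successors p.1.1 p.1.2) ++ L)^[p.2.1] p.2.2 := nat_iterate hf hg h
  exact h'

theorem primrecPred_terminal : PrimrecPred fun p : Program × State =>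
    Terminal p.1 p.2.1 {e | e ∈ p.2.2.1} := by
  have hB : Primrec fun p : Program × State => p.2.2.1 := fst.comp (snd.comp snd)
  exact ((primrecPred_bad hB).or (primrecPred_forall (fst.comp snd) (primrecPred_forall
    (fst.comp fst) (primrecPred_active.comp (Primrec.pair snd (Primrec.pair (snd.comp fst)
      (hB.comp (fst.comp fst))))).not))).of_eq fun p => terminal_iff.symm

theorem primrec_pow : Primrec₂ fun m n : ℕ => m ^ n := Primrec₂.unpaired'.1 Nat.Primrec.pow

theorem primrec_bound : Primrec₂ bound := by
  have h : Primrec fun p : ℕ × ℕ => (List.range (p.2 + 3)).foldr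
      (fun i s => (2 ^ (p.2 * (p.1 + p.2))) ^ i + s) 0 :=
    list_foldr (h := fun p q => (2 ^ (p.2 * (p.1 + p.2))) ^ q.1 + q.2)
      (list_range.comp (nat_add.comp snd (const 3))) (const 0) (nat_add.comp
      (primrec_pow.comp (primrec_pow.comp (const 2) (nat_mul.comp (snd.comp fst)
        (nat_add.comp (fst.comp fst) (snd.comp fst)))) (fst.comp snd)) (snd.comp snd))
  refine h.of_eq fun ⟨u, w⟩ => ?_
  change _ = ((List.range (w + 3)).map fun i => (2 ^ (w * (u + w))) ^ i).sum
  rw [List.sum, List.foldr_map]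

theorem primrec_stepBound : Primrec fun p : Program × Goal => stepBound p.1 p.2 := by
  have hs : Primrec fun p : Program × Goal => (p.1.flatMap Rule.body ++ p.2).length :=
    list_length.comp (list_append.comp (list_flatMap fst (primrec_body.comp snd)) snd)
  have hu : Primrec fun p : Program × Goal => (occurringConsts p.1 p.2).length :=
    list_length.comp (list_append.comp (list_flatMap fst (primrec_rule_consts.comp snd))
      (list_flatMap snd (primrec_constraint_consts.comp snd)))
  have hw : Primrec fun p : Program × Goal => maxArity p.1 p.2 :=
    primrec_foldr_max (list_append.comp (list_flatMap fst (primrec_rule_arities.comp snd))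
      (list_map snd (primrec_chrArity.comp snd)))
  exact nat_mul.comp hs (primrec_pow.comp (nat_add.comp hs (const 2)) (nat_add.comp (nat_mul.comp
    (primrec_bound.comp hu hw) (nat_mul.comp hs (primrec_pow.comp (const 2) (nat_mul.comp hw
      (nat_add.comp hu hw))))) (const 1)))

theorem primrec_varBound : Primrec fun p : Program × Goal => varBound p.1 p.2 :=
  succ.comp (primrec_foldr_max (list_append.comp (list_flatMap fst (primrec_rule_vars.comp snd))
    (list_flatMap snd (primrec_constraint_vars.comp snd))))

theorem primrecPred_hasTerminatingComputation :
    PrimrecPred fun p : Program × Goal => HasTerminatingComputation p.1 p.2 := by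
  have hA : Primrec fun p : Program × Goal => initAtoms p.2 :=
    listFilterMap snd (primrec_toAtom?.comp snd)
  have hB : Primrec fun p : Program × Goal => initEqns p.2 :=
    listFilterMap snd (primrec_toEqn?.comp snd)
  exact (primrecPred_exists (primrec_reachable.comp (Primrec.pair (Primrec.pair fst primrec_varBound)
    (Primrec.pair primrec_stepBound (list_cons.comp (Primrec.pair hA
      (Primrec.pair hB primrec_varBound)) (const []))))) (primrecPred_terminal.comp
        (Primrec.pair (fst.comp fst) snd))).of_eq fun p => hasTerminatingComputation_iff.symm

end Computability

end CHR

theorem mainTheorem3 :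
    (∀ (P : CHR.Program) (G : CHR.Goal),
      CHR.HasTerminatingComputation P G ↔
        ∃ (c : CHR.Config) (δ : CHR.Computation P G c) (F : CHR.Forest) (m : ℕ),
          c.Final P ∧ CHR.IsForestOf δ F ∧ CHR.Forest.Repetitive F m ∧
            m ≤ CHR.bound (CHR.numConsts P G) (CHR.maxArity P G)) ∧
    ComputablePred (fun x : CHR.Program × CHR.Goal => CHR.HasTerminatingComputation x.1 x.2) := by
  refine ⟨fun P G => ⟨fun h => ?_, fun ⟨c, δ, _, _, hfin, _⟩ => ⟨c, δ, hfin⟩⟩, ?_⟩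
  · obtain ⟨hP, hG⟩ := CHR.lt_varBound (P := P) (G := G)
    obtain ⟨c, δ, hfin, hmin⟩ := CHR.exists_shortest hP hG h
    obtain ⟨F, hF⟩ := CHR.exists_isForestOf δ
    obtain ⟨m, hm, hle⟩ := hF.exists_repetitive_le hP hG hfin hmin
    exact ⟨c, δ, F, m, hfin, hF, hm, hle⟩
  · obtain ⟨_, h⟩ := CHR.primrecPred_hasTerminatingComputation
    exact ⟨_, h.to_comp⟩
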